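/- Let $k$ be a finite field with $q$ elements and $A=k[t]$. For a $k$-scheme $S$ let $S_A=S\times_k\operatorname{Spec}A$, let $\mathrm{pr}\colon S_A\to S$ be the projection, and let $\tau_A\colon S_A\to S_A$ be the base change of the $q$-th power Frobenius endomorphism of $S$. A shtuka on $S$ is a diagram $\mathcal M=[\mathcal M\xrightarrow{\sigma}\mathcal M'\xleftarrow{j}\tau_A^*\mathcal M]$ of quasi-coherent $\mathcal O_{S_A}$-modules; with the obvious morphisms the shtukas on $S$ form an $A$-linear abelian category, and $\operatorname{Ext}^i$ denotes Yoneda Ext in it. The unit shtuka is $\mathbf 1_S=[\mathcal O_{S_A}\xrightarrow{1}\mathcal O_{S_A}\xleftarrow{1}\tau_A^*\mathcal O_{S_A}]$. For a shtuka $\mathcal M$ on $S$ let $\mathcal M^\bullet$ be the complex, in degrees $0$ and $1$, of sheaves of $A$-modules on $S$ $$\mathrm{pr}_*\mathcal M\xrightarrow{\ \partial\ }\mathrm{pr}_*\mathcal M',\qquad \partial=\sigma-j\circ\tau,$$ where $\tau\colon\Gamma(\mathrm{pr}^{-1}U,\mathcal M)\to\Gamma(\mathrm{pr}^{-1}U,\tau_A^*\mathcal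 M)$, $s\mapsto\tau_A^*s$, for $U\subset S$ open (note $\tau_A^{-1}\mathrm{pr}^{-1}U=\mathrm{pr}^{-1}U$). Let $\mathbb H^i(S_A,\mathcal M^\bullet)$ be the hypercohomology of this complex of sheaves of $A$-modules on $S$. Call $S$ admissible if it is locally Noetherian, or quasi-compact with affine diagonal. Then there are isomorphisms of $A$-modules $$\Phi=\Phi^i_{S,\mathcal M}\colon\operatorname{Ext}^i(\mathbf 1_S,\mathcal M)\xrightarrow{\ \sim\ }\mathbb H^i(S_A,\mathcal M^\bullet)$$ for all admissible $k$-schemes $S$, all shtukas $\mathcal M$ on $S$ and all $i\ge 0$, such that: 1. $\Phi$ is natural in $\mathcal M$; 2. $\Phi^0$ sends the identity of $\mathbf 1_S$ to the class of the section $1\in\Gamma(S_A,\mathcal O_{S_A})$ (hence, by 1, $f\colon\mathbf 1_S\to\mathcal M$ to the class of $f(1)$); 3. every short exact sequence of shtukas on $S$ gives a short exact sequence of complexes $\mathcal M^\bullet$, and $\Phi$ commutes with the connecting homomorphisms; 4. $\Phi$ is functorial in $S$: let $g\colon S\to T$ be a morphism of admissible $k$-schemes, with base change $g_A\colon S_A\to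 T_A$. By a morphism over $g$ from a shtuka $\mathcal M$ on $T$ to a shtuka $\mathcal N$ on $S$ we mean a pair of maps $\mathcal M\to g_{A*}\mathcal N$, $\mathcal M'\to g_{A*}\mathcal N'$ compatible with $\sigma$ and with $j$ (for example $\mathcal M\to\mathcal N=g_A^*\mathcal M$). Then there are $A$-linear pullback maps $g^*\colon\operatorname{Ext}^i(\mathbf 1_T,\mathcal M)\to\operatorname{Ext}^i(\mathbf 1_S,\mathcal N)$, for all such morphisms over $g$ and all $i\ge0$, which send the identity of $\mathbf 1_T$ to the identity of $\mathbf 1_S$, are natural with respect to commutative squares of morphisms of shtukas and morphisms over $g$, commute with the connecting homomorphisms of compatible short exact sequences, and satisfy $\Phi_{S,\mathcal N}\circ g^*=g^*\circ\Phi_{T,\mathcal M}$, where on the right $g^*\colon\mathbb H^i(T_A,\mathcal M^\bullet)\to\mathbb H^i(S_A,\mathcal N^\bullet)$ is the pullback on hypercohomology. -/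

import Mathlib

open CategoryTheory Limits AlgebraicGeometry Opposite TopologicalSpace

universe u

set_option linter.unusedSectionVars false

noncomputable section

namespace Sht
section Quasicoherent
variable {X Y : Scheme.{u}}

/-- Quasi-coherent `𝒪_X`-modules. -/
def qcoh (X : Scheme.{u}) : ObjectProperty X.Modules := fun M => SheafOfModules.IsQuasicoherent M

instance : (qcoh X).IsClosedUnderIsomorphisms where
  of_iso e h := (SheafOfModules.isQuasicoherent X.ringCatSheaf).prop_of_iso e h

lemma qcoh_restrict (f : X ⟶ Y) [IsOpenImmersion f] (M : Y.Modules) (h : qcoh Y M) :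
    qcoh X ((Scheme.Modules.restrictFunctor f).obj M) := by
  have : M.IsQuasicoherent := h
  exact Scheme.Modules.isQuasicoherent_restrictFunctor f M

instance (f : X ⟶ Y) [IsOpenImmersion f]  :
    PreservesLimitsOfSize.{u, u} (Scheme.Modules.restrictFunctor f) := by
  have : PreservesLimitsOfSize.{u, u}
    (Scheme.Modules.restrictFunctor f ⋙ Scheme.Modules.toPresheaf X) := by
    have h1 : PreservesLimitsOfSize.{u, u} (Scheme.Modules.toPresheaf Y) := inferInstance
    have h2 : PreservesLimitsOfSize.{u, u} ((Functor.whiskeringLeft (Opens X)ᵒᵖ (Opens Y)ᵒᵖ Ab.{u}).obj f.opensFunctor.op) := inferInstance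
    have h3 : PreservesLimitsOfSize.{u, u} (Scheme.Modules.toPresheaf Y ⋙
      (Functor.whiskeringLeft (Opens X)ᵒᵖ (Opens Y)ᵒᵖ Ab.{u}).obj f.opensFunctor.op) :=
      @comp_preservesLimits _ _ _ _ _ _ _ _ h1 h2
    exact h3
  have : ReflectsLimitsOfSize.{u, u} (Scheme.Modules.toPresheaf X) :=
    reflectsLimits_of_reflectsIsomorphisms
  exact preservesLimits_of_reflects_of_preserves _ (Scheme.Modules.toPresheaf X)

lemma restrict_preservesKernel (f : X ⟶ Y) [IsOpenImmersion f] {M N : Y.Modules} (a : M ⟶ N) :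
    PreservesLimit (parallelPair a 0) (Scheme.Modules.restrictFunctor f) := by
  have := preservesLimitsOfSize_shrink.{0, u, 0, u} (Scheme.Modules.restrictFunctor f)
  infer_instance

variable {R : CommRingCat.{u}}

lemma qcoh_iff_localizing (M : (Spec R).Modules) :
   qcoh _ M ↔ IsLocalizing (modulesSpecToSheaf.obj M) :=
  (isQuasicoherent_iff_isIso_fromTildeΓ M).trans (isIso_fromTildeΓ_iff_isLocalizing M)

lemma qcoh_spec_iff (M : (Spec R).Modules) : qcoh _ M ↔ IsIso M.fromTildeΓ :=
  isQuasicoherent_iff_isIso_fromTildeΓ M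

lemma qcoh_tilde (N : ModuleCat R) : qcoh (Spec R) ((tilde.functor R).obj N) :=
  inferInstanceAs <| (tilde N).IsQuasicoherent

lemma qcoh_spec_colimit {J : Type u} [SmallCategory J] {F : J ⥤ (Spec R).Modules}
    (hF : ∀ j, qcoh _ (F.obj j)) {c : Cocone F} (hc : IsColimit c) : qcoh _ c.pt := by
  let e : (F ⋙ moduleSpecΓFunctor) ⋙ tilde.functor R ≅ F :=
    NatIso.ofComponents (fun j => @asIso _ _ _ _ (Scheme.Modules.fromTildeΓ (F.obj j))
      ((qcoh_spec_iff _).1 (hF j)))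
      (fun f => tilde.adjunction (R := R).counit.naturality (F.map f))
  let c' : Cocone (F ⋙ moduleSpecΓFunctor) := colimit.cocone _
  have h' := isColimitOfPreserves (tilde.functor R) (colimit.isColimit (F ⋙ moduleSpecΓFunctor))
  exact (qcoh _).prop_of_iso (h'.coconePointsIsoOfNatIso hc e) (qcoh_tilde _)

lemma qcoh_of_cover (M : X.Modules) {ι : Type u} (U : ι → X.Opens) (hU : iSup U = ⊤)
    (h : ∀ i, (Scheme.Modules.restrict M (U i).ι).Presentation) : qcoh X M := by
  refine SheafOfModules.QuasicoherentData.isQuasicoherent.{u}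
    (q := { I := ι, X := U, coversTop := ?_, presentation := fun i => ?_ })
  · rw [Opens.coversTop_iff]; exact hU
  · let E := Scheme.Modules.overEquiv (U i)
    let e1 : E.functor.obj (M.over (U i)) ≅ M.restrict (U i).ι :=
      (Scheme.Modules.overFunctorEquiv (U i)).app M
    let e0 : E.functor.obj (SheafOfModules.unit _) ≅ SheafOfModules.unit _ :=
      (Scheme.Modules.overFunctorEquiv (U i)).app (SheafOfModules.unit X.ringCatSheaf) ≪≫
        Scheme.Modules.restrictUnitIso (U i).ι
    have : PreservesColimitsOfSize.{u, u} E.inverse :=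
      E.symm.toAdjunction.leftAdjoint_preservesColimits
    let F : SheafOfModules.{u} (U i).toScheme.ringCatSheaf ⥤
        SheafOfModules.{u} (X.ringCatSheaf.over (U i)) := E.inverse
    have hF : PreservesColimitsOfSize.{u, u} F := by exact this
    let p := (h i).map F (E.unitIso.app _ ≪≫ E.inverse.mapIso e0)
    exact SheafOfModules.Presentation.ofIsIso.{u, u, u}
      (E.inverse.mapIso e1.symm ≪≫ E.unitIso.symm.app _).hom p

/-- Transport of a presentation along an isomorphism. -/
def presentationOfIso {M N : X.Modules} (e : M ≅ N) (p : SheafOfModules.Presentation.{u} M) :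
    SheafOfModules.Presentation.{u} N :=
  @SheafOfModules.Presentation.ofIsIso _ _ _ _ _ _ _ _ e.hom (by
    have : IsIso e.hom := inferInstance
    exact this) p

lemma qcoh_of_affine (M : X.Modules)
    (h : ∀ (U : X.Opens) (hU : IsAffineOpen U),
      qcoh _ ((Scheme.Modules.restrictFunctor hU.fromSpec).obj M)) : qcoh X M := by
  refine qcoh_of_cover M (fun U : X.affineOpens => U.1) ?_ (fun U => ?_)
  · have := iSup_affineOpens_eq_top X
    exact this
  · have hU : IsAffineOpen U.1 := U.2
    let N := (Scheme.Modules.restrictFunctor hU.fromSpec).obj M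
    let Γ' := (modulesSpecToSheaf.obj N).presheaf.obj (.op ⊤)
    have : IsIso N.fromTildeΓ := (qcoh_spec_iff _).1 (h U.1 hU)
    let pN := presentationOfIso (asIso N.fromTildeΓ)
      (presentationTilde.{u} Γ' .univ (by simp) _ (Submodule.span_eq _))
    exact presentationOfIso
      (((Scheme.Modules.restrictFunctorComp hU.isoSpec.hom hU.fromSpec).app M).symm ≪≫
        (Scheme.Modules.restrictFunctorCongr hU.isoSpec_hom_fromSpec).app M)
      (Scheme.Modules.presentationRestrict hU.isoSpec.hom pN)

lemma qcoh_colimit {J : Type u} [SmallCategory J] {F : J ⥤ X.Modules}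
    (hF : ∀ j, qcoh _ (F.obj j)) {c : Cocone F} (hc : IsColimit c) : qcoh _ c.pt := by
  refine qcoh_of_affine _ fun U hU => ?_
  have h := isColimitOfPreserves (Scheme.Modules.restrictFunctor hU.fromSpec) hc
  exact qcoh_spec_colimit (fun j => qcoh_restrict _ _ (hF j)) h

lemma qcoh_colimit' {J : Type} [SmallCategory J] {F : J ⥤ X.Modules}
    (hF : ∀ j, qcoh _ (F.obj j)) {c : Cocone F} (hc : IsColimit c) : qcoh _ c.pt := by
  let e : ULiftHom.{u} (ULift.{u} J) ≌ J := (ULiftHomULiftCategory.equiv.{u, u} J).symm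
  exact qcoh_colimit (F := e.functor ⋙ F) (fun j => hF _) (hc.whiskerEquivalence e)

lemma kernel_sections {M N K : X.Modules} (i : K ⟶ M) (a : M ⟶ N) (w : i ≫ a = 0)
    (hK : IsLimit (KernelFork.ofι i w)) (U : X.Opens) :
    Function.Injective (i.app U) ∧ ∀ m, a.app U m = 0 → ∃ x, i.app U x = m := by
  have h1 : PreservesLimitsOfSize.{0, 0} (Scheme.Modules.toPresheaf X) :=
    preservesLimitsOfSize_shrink.{0, u, 0, u} _
  have : (Scheme.Modules.toPresheaf X ⋙
      (evaluation (Opens X)ᵒᵖ Ab.{u}).obj (op U)).PreservesZeroMorphisms := ⟨fun _ _ => rfl⟩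
  have h2 : PreservesLimitsOfSize.{0, 0} ((evaluation (Opens X)ᵒᵖ Ab.{u}).obj (op U)) :=
    inferInstance
  have h3 : PreservesLimitsOfSize.{0, 0} (Scheme.Modules.toPresheaf X ⋙
      (evaluation (Opens X)ᵒᵖ Ab.{u}).obj (op U)) := @comp_preservesLimits _ _ _ _ _ _ _ _ h1 h2
  have hK' := KernelFork.mapIsLimit _ hK
    (Scheme.Modules.toPresheaf X ⋙ (evaluation (Opens X)ᵒᵖ Ab.{u}).obj (op U))
  let S : ShortComplex Ab.{u} := ShortComplex.mk (i.app U) (a.app U) (by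
    rw [← Scheme.Modules.Hom.comp_app, w]; rfl)
  have hS : S.Exact := S.exact_of_f_is_kernel hK'
  have hm : Mono S.f := Fork.IsLimit.mono hK'
  refine ⟨(AddCommGrpCat.mono_iff_injective _).1 hm, fun m hm => ?_⟩
  exact (ShortComplex.ab_exact_iff S).1 hS m hm

lemma qcoh_spec_kernel {M N K : (Spec R).Modules} (i : K ⟶ M) (a : M ⟶ N) (w : i ≫ a = 0)
    (hK : IsLimit (KernelFork.ofι i w)) (hM : qcoh _ M) (hN : qcoh _ N) : qcoh _ K := by
  rw [qcoh_iff_localizing] at *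
  intro f
  have hM := hM f
  have hN := hN f
  have hT := kernel_sections i a w hK ⊤
  have hD := kernel_sections i a w hK (PrimeSpectrum.basicOpen f)
  let I := modulesSpecToSheaf.map i
  let A := modulesSpecToSheaf.map a
  let res (F : (Spec R).Modules) := ((modulesSpecToSheaf.obj F).obj.map (PrimeSpectrum.basicOpen f).leTop.op).hom
  have nI : ∀ x, res M ((I.hom.app (op ⊤)).hom x) = (I.hom.app (op (PrimeSpectrum.basicOpen f))).hom (res K x) :=
    fun x => (congr($(I.hom.naturality (PrimeSpectrum.basicOpen f).leTop.op).hom x)).symm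
  have nA : ∀ x, res N ((A.hom.app (op ⊤)).hom x) = (A.hom.app (op (PrimeSpectrum.basicOpen f))).hom (res M x) :=
    fun x => (congr($(A.hom.naturality (PrimeSpectrum.basicOpen f).leTop.op).hom x)).symm
  have iT : Function.Injective (I.hom.app (op ⊤)).hom := hT.1
  have eT : ∀ m, (A.hom.app (op ⊤)).hom m = 0 → ∃ x, (I.hom.app (op ⊤)).hom x = m := hT.2
  have iD : Function.Injective (I.hom.app (op (PrimeSpectrum.basicOpen f))).hom := hD.1
  have cD : ∀ x, (A.hom.app (op (PrimeSpectrum.basicOpen f))).hom ((I.hom.app (op (PrimeSpectrum.basicOpen f))).hom x) = 0 := by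
    intro x
    have h0 : I ≫ A = 0 := by
      rw [← Functor.map_comp, w]; rfl
    exact congr(($(h0).hom.app (op (PrimeSpectrum.basicOpen f))).hom x)
  refine ⟨?_, ?_, ?_⟩
  · rintro ⟨x, n, rfl⟩
    change IsUnit (algebraMap _ _ (f ^ n))
    rw [map_pow]
    exact (K.isUnit_algebraMap_end_of_le_basicOpen f le_rfl).pow n
  · intro y
    obtain ⟨⟨m, s⟩, hms⟩ := hM.surj ((I.hom.app (op (PrimeSpectrum.basicOpen f))).hom y)
    have h1 : res N ((A.hom.app (op ⊤)).hom m) = res N 0 := by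
      rw [nA, map_zero]
      rw [← show _ = res M m from hms]
      change (A.hom.app (op (PrimeSpectrum.basicOpen f))).hom ((s : R) • _) = 0
      rw [map_smul, cD, smul_zero]
    obtain ⟨c, hc⟩ := hN.exists_of_eq h1
    rw [smul_zero] at hc
    obtain ⟨x, hx⟩ := eT (c • m) (by
      rw [← hc]; exact map_smul _ (c : R) m)
    refine ⟨(x, c * s), iD ?_⟩
    change _ = (I.hom.app (op (PrimeSpectrum.basicOpen f))).hom (res K x)
    rw [← nI, hx]
    change (I.hom.app (op (PrimeSpectrum.basicOpen f))).hom (((c * s : Submonoid.powers f) : R) • y) = res M ((c : R) • m)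
    rw [map_smul, map_smul, Submonoid.coe_mul, mul_smul]
    exact congrArg (fun z => (c : R) • z) hms
  · intro x₁ x₂ h
    have : res M ((I.hom.app (op ⊤)).hom x₁) = res M ((I.hom.app (op ⊤)).hom x₂) := by
      rw [nI, nI]; exact congrArg _ h
    obtain ⟨c, hc⟩ := hM.exists_of_eq this
    refine ⟨c, iT ?_⟩
    change (I.hom.app (op ⊤)).hom ((c : R) • x₁) = (I.hom.app (op ⊤)).hom ((c : R) • x₂)
    rw [map_smul, map_smul]
    exact hc

lemma qcoh_kernel {M N K : X.Modules} (i : K ⟶ M) (a : M ⟶ N) (w : i ≫ a = 0)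
    (hK : IsLimit (KernelFork.ofι i w)) (hM : qcoh _ M) (hN : qcoh _ N) : qcoh _ K := by
  refine qcoh_of_affine _ fun U hU => ?_
  have := restrict_preservesKernel hU.fromSpec a
  have hK' := KernelFork.mapIsLimit _ hK (Scheme.Modules.restrictFunctor hU.fromSpec)
  exact qcoh_spec_kernel ((Scheme.Modules.restrictFunctor hU.fromSpec).map i) _
    (by rw [← Functor.map_comp, w]; rfl) hK' (qcoh_restrict _ _ hM) (qcoh_restrict _ _ hN)

instance : (qcoh X).IsClosedUnderKernels where
  kernels_le := by
    rintro _ ⟨f, k, hk, hf⟩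
    exact qcoh_kernel k.ι f k.condition (IsLimit.ofIsoLimit hk (Fork.ext (Iso.refl _))) hf.1 hf.2

instance : (qcoh X).IsClosedUnderCokernels where
  cokernels_le := by
    rintro _ ⟨f, k, hk, hf⟩
    refine qcoh_colimit' (fun j => ?_) hk
    rcases j with _ | _
    exacts [hf.1, hf.2]

instance : (qcoh X).ContainsZero where
  exists_zero := by
    let c : Cocone (Functor.empty.{0} X.Modules) := asEmptyCocone (⊥_ X.Modules)
    have h : IsZero (⊥_ X.Modules) := (isZero_zero X.Modules).of_iso
      (initialIsInitial.uniqueUpToIso (isZero_zero X.Modules).isInitial)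
    exact ⟨_, h, qcoh_colimit' (J := Discrete PEmpty) (c := c) (by rintro ⟨⟨⟩⟩) h.isInitial⟩

instance : (qcoh X).IsClosedUnderBinaryProducts where
  limitsOfShape_le := by
    rintro M ⟨p⟩
    have e : M ≅ (p.diag.obj ⟨.left⟩) ⊞ (p.diag.obj ⟨.right⟩) :=
      (IsLimit.conePointsIsoOfNatIso p.isLimit (BinaryBiproduct.isLimit _ _)
        (diagramIsoPair p.diag))
    refine (qcoh X).prop_of_iso e.symm (qcoh_colimit' (fun j => ?_)
      (BinaryBiproduct.isColimit (p.diag.obj ⟨.left⟩) (p.diag.obj ⟨.right⟩)))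
    rcases j with ⟨_ | _⟩
    exacts [p.prop_diag_obj _, p.prop_diag_obj _]

instance : (qcoh X).IsClosedUnderFiniteProducts := .mk'

end Quasicoherent

section Frobenius
variable (k : Type u) [Field k] [Fintype k]

/-- The `q`-th power map of a commutative ring `R` which receives a ring homomorphism
from the field `k` with `q` elements. -/
def powHom {R : Type u} [CommRing R] (i : k →+* R) : R →+* R :=
  letI := i.toAlgebra
  (FiniteField.frobeniusAlgHom k R).toRingHom

@[simp] lemma powHom_apply {R : Type u} [CommRing R] (i : k →+* R) (x : R) :
    powHom k i x = x ^ Fintype.card k := rfl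

variable {k}
variable (S : Over (Spec (CommRingCat.of k)))

/-- The structure morphism on sections. -/
def scalars (U : S.left.Opens) : k →+* Γ(S.left, U) :=
  ((Scheme.ΓSpecIso (CommRingCat.of k)).inv ≫ S.hom.appTop ≫
    S.left.presheaf.map U.leTop.op).hom

/-- The `q`-th power Frobenius endomorphism: identity on the space, `s ↦ s ^ q` on sections. -/
def frob : S.left ⟶ S.left where
  base := 𝟙 _
  c := { app U := CommRingCat.ofHom (powHom k (scalars S U.unop))
         naturality := fun U V i => by
           ext x
           exact (map_pow (S.left.presheaf.map i).hom x _).symm }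
  prop := by
    intro x
    refine ⟨fun a ha => ?_⟩
    obtain ⟨U, hxU, s, rfl⟩ := S.left.presheaf.exists_germ_eq a
    rw [PresheafedSpace.stalkMap_germ_apply _ U x hxU s] at ha
    have h2 : S.left.presheaf.germ U x hxU (s ^ Fintype.card k) =
        (S.left.presheaf.germ U x hxU s) ^ Fintype.card k :=
      map_pow (S.left.presheaf.germ U x hxU).hom s _
    exact (isUnit_pow_iff Fintype.card_ne_zero).1 (h2 ▸ ha)

lemma frob_app (U : S.left.Opens) (s : Γ(S.left, U)) :
    (frob S).app U s = s ^ Fintype.card k := rfl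

lemma frob_preimage (U : S.left.Opens) : (frob S) ⁻¹ᵁ U = U := rfl

lemma frob_hom : frob S ≫ S.hom = S.hom := by
  refine ext_of_isAffine ?_
  ext x
  obtain ⟨c, rfl⟩ := (ConcreteCategory.bijective_of_isIso
    (Scheme.ΓSpecIso (CommRingCat.of k)).inv).2 x
  rw [Scheme.Hom.comp_appTop]
  change (CommRingCat.Hom.hom S.hom.appTop ((Scheme.ΓSpecIso (CommRingCat.of k)).inv.hom c)) ^
    Fintype.card k = _
  rw [← map_pow, ← map_pow]
  congr 2
  exact FiniteField.pow_card c

end Frobenius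


/-- A diagram `M ⟶ M' ⟵ τ^* M` of quasi-coherent `𝒪_X`-modules, for an endomorphism `τ` of a
scheme `X`. -/
structure Diag (X : Scheme.{u}) (τ : X ⟶ X) where
  M : X.Modules
  M' : X.Modules
  qcoh_M : qcoh X M
  qcoh_M' : qcoh X M'
  σ : M ⟶ M'
  j : (Scheme.Modules.pullback τ).obj M ⟶ M'

namespace Diag
variable {X : Scheme.{u}} {τ : X ⟶ X}

/-- Morphisms of diagrams. -/
@[ext]
structure Hom (P Q : Diag X τ) where
  f : P.M ⟶ Q.M
  f' : P.M' ⟶ Q.M'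
  comm_σ : f ≫ Q.σ = P.σ ≫ f'
  comm_j : (Scheme.Modules.pullback τ).map f ≫ Q.j = P.j ≫ f'

instance : Category (Diag X τ) where
  Hom := Hom
  id P := ⟨𝟙 _, 𝟙 _, by simp, by simp⟩
  comp a b := ⟨a.f ≫ b.f, a.f' ≫ b.f', by
    rw [Category.assoc, b.comm_σ, ← Category.assoc, a.comm_σ, Category.assoc], by
    rw [Functor.map_comp, Category.assoc, b.comm_j, ← Category.assoc, a.comm_j, Category.assoc]⟩

variable {P Q T : Diag X τ}

@[ext] lemma hom_ext {a b : P ⟶ Q} (h : a.f = b.f) (h' : a.f' = b.f') : a = b := Hom.ext h h'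

@[simp] lemma id_f : Hom.f (𝟙 P) = 𝟙 P.M := rfl
@[simp] lemma id_f' : Hom.f' (𝟙 P) = 𝟙 P.M' := rfl
@[simp] lemma comp_f (a : P ⟶ Q) (b : Q ⟶ T) : (a ≫ b).f = a.f ≫ b.f := rfl
@[simp] lemma comp_f' (a : P ⟶ Q) (b : Q ⟶ T) : (a ≫ b).f' = a.f' ≫ b.f' := rfl

instance : Zero (P ⟶ Q) := ⟨⟨0, 0, by simp, by simp⟩⟩
instance : Add (P ⟶ Q) := ⟨fun a b => ⟨a.f + b.f, a.f' + b.f', by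
  simp [a.comm_σ, b.comm_σ], by simp [a.comm_j, b.comm_j, Functor.map_add]⟩⟩
instance : Neg (P ⟶ Q) := ⟨fun a => ⟨-a.f, -a.f', by
  simp [a.comm_σ], by simp [a.comm_j, Functor.map_neg]⟩⟩

@[simp] lemma zero_f : Hom.f (0 : P ⟶ Q) = 0 := rfl
@[simp] lemma zero_f' : Hom.f' (0 : P ⟶ Q) = 0 := rfl
@[simp] lemma add_f (a b : P ⟶ Q) : (a + b).f = a.f + b.f := rfl
@[simp] lemma add_f' (a b : P ⟶ Q) : (a + b).f' = a.f' + b.f' := rfl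
@[simp] lemma neg_f (a : P ⟶ Q) : (-a).f = -a.f := rfl
@[simp] lemma neg_f' (a : P ⟶ Q) : (-a).f' = -a.f' := rfl

instance : AddCommGroup (P ⟶ Q) where
  add_assoc a b c := by ext1 <;> simp [add_assoc]
  zero_add a := by ext1 <;> simp
  add_zero a := by ext1 <;> simp
  add_comm a b := by ext1 <;> simp [add_comm]
  neg_add_cancel a := by ext1 <;> simp
  nsmul := nsmulRec
  zsmul := zsmulRec

instance : Preadditive (Diag X τ) where
  add_comp _ _ _ _ _ _ := by ext1 <;> simp
  comp_add _ _ _ _ _ _ := by ext1 <;> simp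

/-- The functor `[M → M' ← τ^* M] ↦ M`. -/
@[simps] def fstF : Diag X τ ⥤ X.Modules where
  obj P := P.M
  map a := a.f

/-- The functor `[M → M' ← τ^* M] ↦ M'`. -/
@[simps] def sndF : Diag X τ ⥤ X.Modules where
  obj P := P.M'
  map a := a.f'

instance : (fstF (X := X) (τ := τ)).Additive where
instance : (sndF (X := X) (τ := τ)).Additive where

lemma isIso_of (a : P ⟶ Q) [IsIso a.f] [IsIso a.f'] : IsIso a := by
  refine ⟨⟨⟨inv a.f, inv a.f', ?_, ?_⟩, ?_, ?_⟩⟩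
  · rw [IsIso.inv_comp_eq, ← Category.assoc, IsIso.eq_comp_inv, a.comm_σ]
  · rw [Functor.map_inv, IsIso.inv_comp_eq, ← Category.assoc, IsIso.eq_comp_inv, a.comm_j]
  · ext1 <;> simp
  · ext1 <;> simp

/-- The adjoint `M ⟶ τ_* M'` of `j`. -/
def jAdj (P : Diag X τ) : P.M ⟶ (Scheme.Modules.pushforward τ).obj P.M' :=
  (Scheme.Modules.pullbackPushforwardAdjunction τ).homEquiv _ _ P.j

lemma comm_j_iff {f : P.M ⟶ Q.M} {f' : P.M' ⟶ Q.M'} :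
    (Scheme.Modules.pullback τ).map f ≫ Q.j = P.j ≫ f' ↔
      f ≫ Q.jAdj = P.jAdj ≫ (Scheme.Modules.pushforward τ).map f' := by
  rw [jAdj, jAdj, ← Adjunction.homEquiv_naturality_left, ← Adjunction.homEquiv_naturality_right,
    EmbeddingLike.apply_eq_iff_eq]

/-- The kernel of a morphism. -/
def ker (a : P ⟶ Q) : Diag X τ where
  M := kernel a.f
  M' := kernel a.f'
  qcoh_M := (qcoh X).prop_kernel a.f P.qcoh_M Q.qcoh_M
  qcoh_M' := (qcoh X).prop_kernel a.f' P.qcoh_M' Q.qcoh_M'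
  σ := kernel.lift _ (kernel.ι a.f ≫ P.σ) (by
    rw [Category.assoc, ← a.comm_σ, kernel.condition_assoc, zero_comp])
  j := kernel.lift _ ((Scheme.Modules.pullback τ).map (kernel.ι a.f) ≫ P.j) (by
    rw [Category.assoc, ← a.comm_j, ← Functor.map_comp_assoc, kernel.condition,
      Functor.map_zero, zero_comp])

/-- The inclusion of the kernel. -/
def kerι (a : P ⟶ Q) : ker a ⟶ P :=
  ⟨kernel.ι a.f, kernel.ι a.f', by simp [ker], by simp [ker]⟩

lemma kerι_comp (a : P ⟶ Q) : kerι a ≫ a = 0 :=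
  hom_ext (kernel.condition _) (kernel.condition _)

/-- The universal property of the kernel. -/
def kerIsLimit (a : P ⟶ Q) : IsLimit (KernelFork.ofι (kerι a) (kerι_comp a)) :=
  KernelFork.IsLimit.ofι _ _
    (fun {W} g hg => ⟨kernel.lift _ g.f congr(Hom.f $hg), kernel.lift _ g.f' congr(Hom.f' $hg),
      by
        apply equalizer.hom_ext
        simp [ker, g.comm_σ],
      by
        apply equalizer.hom_ext
        simp [ker, ← g.comm_j, ← Functor.map_comp_assoc]⟩)
    (fun {W} g hg => hom_ext (kernel.lift_ι _ _ _) (kernel.lift_ι _ _ _))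
    (fun {W} g hg m hm => by
      ext1
      · exact (cancel_mono (kernel.ι a.f)).1
          ((congr(Hom.f $hm)).trans (kernel.lift_ι a.f g.f _).symm)
      · exact (cancel_mono (kernel.ι a.f')).1
          ((congr(Hom.f' $hm)).trans (kernel.lift_ι a.f' g.f' _).symm))

/-- The cokernel of a morphism. -/
def coker (a : P ⟶ Q) : Diag X τ where
  M := cokernel a.f
  M' := cokernel a.f'
  qcoh_M := (qcoh X).prop_cokernel a.f P.qcoh_M Q.qcoh_M
  qcoh_M' := (qcoh X).prop_cokernel a.f' P.qcoh_M' Q.qcoh_M'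
  σ := cokernel.desc _ (Q.σ ≫ cokernel.π a.f') (by
    rw [← Category.assoc, a.comm_σ, Category.assoc, cokernel.condition, comp_zero])
  j := ((Scheme.Modules.pullbackPushforwardAdjunction τ).homEquiv _ _).symm
    (cokernel.desc _ (Q.jAdj ≫ (Scheme.Modules.pushforward τ).map (cokernel.π a.f')) (by
      rw [← Category.assoc, comm_j_iff.1 a.comm_j, Category.assoc, ← Functor.map_comp,
        cokernel.condition, Functor.map_zero, comp_zero]))

lemma coker_jAdj (a : P ⟶ Q) : cokernel.π a.f ≫ (coker a).jAdj =
    Q.jAdj ≫ (Scheme.Modules.pushforward τ).map (cokernel.π a.f') := by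
  refine Eq.trans (congrArg (cokernel.π a.f ≫ ·) (Equiv.apply_symm_apply _ _)) ?_
  exact cokernel.π_desc _ _ _

/-- The projection onto the cokernel. -/
def cokerπ (a : P ⟶ Q) : Q ⟶ coker a :=
  ⟨cokernel.π a.f, cokernel.π a.f', by simp [coker], comm_j_iff.2 (coker_jAdj a)⟩

lemma comp_cokerπ (a : P ⟶ Q) : a ≫ cokerπ a = 0 :=
  hom_ext (cokernel.condition _) (cokernel.condition _)

/-- The universal property of the cokernel. -/
def cokerIsColimit (a : P ⟶ Q) : IsColimit (CokernelCofork.ofπ (cokerπ a) (comp_cokerπ a)) :=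
  CokernelCofork.IsColimit.ofπ _ _
    (fun {W} g hg => ⟨cokernel.desc _ g.f congr(Hom.f $hg), cokernel.desc _ g.f' congr(Hom.f' $hg),
      by
        apply coequalizer.hom_ext
        simp [coker, g.comm_σ],
      by
        refine comm_j_iff.2 ((cancel_epi (cokernel.π a.f)).1 ?_)
        have h1 := cokernel.π_desc a.f g.f congr(Hom.f $hg)
        have h2 := cokernel.π_desc a.f' g.f' congr(Hom.f' $hg)
        refine Eq.trans ((Category.assoc _ _ _).symm.trans (congrArg (· ≫ W.jAdj) h1)) ?_
        refine (comm_j_iff.1 g.comm_j).trans ?_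
        refine Eq.trans ?_ (Category.assoc _ _ _)
        refine Eq.trans ?_ (congrArg (· ≫ _) (coker_jAdj a).symm)
        refine Eq.trans ?_ (Category.assoc _ _ _).symm
        refine congrArg (Q.jAdj ≫ ·) ?_
        exact (congrArg (Scheme.Modules.pushforward τ).map h2.symm).trans
          (Functor.map_comp _ _ _)⟩)
    (fun {W} g hg => hom_ext (cokernel.π_desc _ _ _) (cokernel.π_desc _ _ _))
    (fun {W} g hg m hm => by
      ext1
      · exact (cancel_epi (cokernel.π a.f)).1
          ((congr(Hom.f $hm)).trans (cokernel.π_desc a.f g.f _).symm)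
      · exact (cancel_epi (cokernel.π a.f')).1
          ((congr(Hom.f' $hm)).trans (cokernel.π_desc a.f' g.f' _).symm))

instance : HasKernels (Diag X τ) := ⟨fun a => ⟨⟨⟨_, kerIsLimit a⟩⟩⟩⟩
instance : HasCokernels (Diag X τ) := ⟨fun a => ⟨⟨⟨_, cokerIsColimit a⟩⟩⟩⟩

instance (a : P ⟶ Q) : PreservesLimit (parallelPair a 0) (fstF (X := X) (τ := τ)) :=
  preservesLimit_of_preserves_limit_cone (kerIsLimit a)
    ((KernelFork.isLimitMapConeEquiv _ _).symm
      (IsLimit.ofIsoLimit (kernelIsKernel a.f) (Fork.ext (Iso.refl _))))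
instance (a : P ⟶ Q) : PreservesLimit (parallelPair a 0) (sndF (X := X) (τ := τ)) :=
  preservesLimit_of_preserves_limit_cone (kerIsLimit a)
    ((KernelFork.isLimitMapConeEquiv _ _).symm
      (IsLimit.ofIsoLimit (kernelIsKernel a.f') (Fork.ext (Iso.refl _))))
instance (a : P ⟶ Q) : PreservesColimit (parallelPair a 0) (fstF (X := X) (τ := τ)) :=
  preservesColimit_of_preserves_colimit_cocone (cokerIsColimit a)
    ((CokernelCofork.isColimitMapCoconeEquiv _ _).symm
      (IsColimit.ofIsoColimit (cokernelIsCokernel a.f) (Cofork.ext (Iso.refl _))))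
instance (a : P ⟶ Q) : PreservesColimit (parallelPair a 0) (sndF (X := X) (τ := τ)) :=
  preservesColimit_of_preserves_colimit_cocone (cokerIsColimit a)
    ((CokernelCofork.isColimitMapCoconeEquiv _ _).symm
      (IsColimit.ofIsoColimit (cokernelIsCokernel a.f') (Cofork.ext (Iso.refl _))))

/-- The direct sum of two diagrams. -/
def sum (P Q : Diag X τ) : Diag X τ where
  M := P.M ⊞ Q.M
  M' := P.M' ⊞ Q.M'
  qcoh_M := (qcoh X).prop_of_isLimit_binaryFan (BinaryBiproduct.isLimit P.M Q.M)
    P.qcoh_M Q.qcoh_M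
  qcoh_M' := (qcoh X).prop_of_isLimit_binaryFan (BinaryBiproduct.isLimit P.M' Q.M')
    P.qcoh_M' Q.qcoh_M'
  σ := biprod.map P.σ Q.σ
  j := biprod.lift ((Scheme.Modules.pullback τ).map biprod.fst ≫ P.j)
    ((Scheme.Modules.pullback τ).map biprod.snd ≫ Q.j)

/-- The direct sum is a biproduct. -/
def sumBicone (P Q : Diag X τ) : BinaryBicone P Q where
  pt := sum P Q
  fst := ⟨biprod.fst, biprod.fst, by simp [sum], by simp [sum]⟩
  snd := ⟨biprod.snd, biprod.snd, by simp [sum], by simp [sum]⟩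
  inl := ⟨biprod.inl, biprod.inl, by simp [sum], by
    apply biprod.hom_ext <;> simp [sum, ← Functor.map_comp_assoc]⟩
  inr := ⟨biprod.inr, biprod.inr, by simp [sum], by
    apply biprod.hom_ext <;> simp [sum, ← Functor.map_comp_assoc]⟩
  inl_fst := hom_ext biprod.inl_fst biprod.inl_fst
  inl_snd := hom_ext biprod.inl_snd biprod.inl_snd
  inr_fst := hom_ext biprod.inr_fst biprod.inr_fst
  inr_snd := hom_ext biprod.inr_snd biprod.inr_snd

instance : HasBinaryBiproducts (Diag X τ) :=
  ⟨fun P Q => ⟨⟨⟨sumBicone P Q, isBinaryBilimitOfTotal _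
    (hom_ext biprod.total biprod.total)⟩⟩⟩⟩

lemma exists_zero : ∃ Z : Diag X τ, IsZero Z := by
  obtain ⟨Z, hZ, hq⟩ := (qcoh X).exists_prop_of_containsZero
  refine ⟨⟨Z, Z, hq, hq, 0, 0⟩, (IsZero.iff_id_eq_zero _).2 (hom_ext ?_ ?_)⟩
  · exact hZ.eq_of_src _ _
  · exact hZ.eq_of_src _ _

instance : HasZeroObject (Diag X τ) := ⟨exists_zero⟩

instance : HasFiniteProducts (Diag X τ) :=
  hasFiniteProducts_of_has_binary_and_terminal

lemma isIso_coimageImageComparison (a : P ⟶ Q) : IsIso (Abelian.coimageImageComparison a) := by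
  have h1 : IsIso (Hom.f (Abelian.coimageImageComparison a)) :=
    ((MorphismProperty.isomorphisms X.Modules).arrow_mk_iso_iff
      (Abelian.PreservesCoimageImageComparison.iso fstF a)).2
      (inferInstanceAs (IsIso (Abelian.coimageImageComparison a.f)))
  have h2 : IsIso (Hom.f' (Abelian.coimageImageComparison a)) :=
    ((MorphismProperty.isomorphisms X.Modules).arrow_mk_iso_iff
      (Abelian.PreservesCoimageImageComparison.iso sndF a)).2
      (inferInstanceAs (IsIso (Abelian.coimageImageComparison a.f')))
  exact isIso_of _

instance : Abelian (Diag X τ) :=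
  haveI := fun (P Q : Diag X τ) (a : P ⟶ Q) => isIso_coimageImageComparison a
  Abelian.ofCoimageImageComparisonIsIso

end Diag

section Sections
variable {A : Type u} [CommRing A] {X Y : Scheme.{u}}

/-- The ring homomorphism `A → Γ(X, V)` given by a morphism `X ⟶ Spec A`. -/
def aScalars (t : X ⟶ Spec (CommRingCat.of A)) (V : X.Opens) : A →+* Γ(X, V) :=
  ((Scheme.ΓSpecIso (CommRingCat.of A)).inv ≫ t.appTop ≫ X.presheaf.map V.leTop.op).hom

lemma aScalars_map (t : X ⟶ Spec (CommRingCat.of A)) {V W : X.Opens} (i : W ⟶ V) (a : A) :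
    X.presheaf.map i.op (aScalars t V a) = aScalars t W a := by
  change ((X.presheaf.map V.leTop.op) ≫ X.presheaf.map i.op).hom _ = _
  rw [← Functor.map_comp]
  rfl

lemma aScalars_app {t : X ⟶ Spec (CommRingCat.of A)} {t' : Y ⟶ Spec (CommRingCat.of A)}
    (g : Y ⟶ X) (hg : g ≫ t = t') (V : X.Opens) (a : A) :
    g.app V (aScalars t V a) = aScalars t' (g ⁻¹ᵁ V) a := by
  subst hg
  have h : t.appTop ≫ X.presheaf.map V.leTop.op ≫ g.app V =
      (g ≫ t).appTop ≫ Y.presheaf.map (g ⁻¹ᵁ V).leTop.op := by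
    rw [Scheme.Hom.naturality, Scheme.Hom.comp_appTop, Category.assoc]
    rfl
  exact congr(($h).hom ((Scheme.ΓSpecIso (CommRingCat.of A)).inv.hom a))

/-- The sections `Γ(M, V)` of an `𝒪_X`-module as an `A`-module. -/
def secMod (t : X ⟶ Spec (CommRingCat.of A)) (M : X.Modules) (V : X.Opens) : ModuleCat.{u} A :=
  letI : Module A Γ(M, V) := Module.compHom _ (aScalars t V)
  ModuleCat.of A Γ(M, V)

/-- For a morphism `g : Y ⟶ X` over `A` and `φ : M ⟶ g_* N`, the map
`Γ(M, V) → Γ(N, g⁻¹ V) → Γ(N, W)`, where `W ⊆ g⁻¹ V`. -/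
def secMap {t : X ⟶ Spec (CommRingCat.of A)} {t' : Y ⟶ Spec (CommRingCat.of A)}
    (g : Y ⟶ X) (hg : g ≫ t = t') {M : X.Modules} {N : Y.Modules}
    (φ : M ⟶ (Scheme.Modules.pushforward g).obj N) {V : X.Opens} {W : Y.Opens}
    (h : W ≤ g ⁻¹ᵁ V) : secMod t M V ⟶ secMod t' N W :=
  ModuleCat.ofHom (X := secMod t M V) (Y := secMod t' N W)
    { toFun := fun s : Γ(M, V) => N.presheaf.map (homOfLE h).op (φ.app V s)
      map_add' := fun (a b : Γ(M, V)) => by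
        exact (congrArg (N.presheaf.map (homOfLE h).op).hom (map_add (φ.app V).hom a b)).trans
          (map_add (N.presheaf.map (homOfLE h).op).hom _ _)
      map_smul' := fun a (s : Γ(M, V)) => by
        change N.presheaf.map (homOfLE h).op (φ.app V (aScalars t V a • s)) =
          aScalars t' W a • (N.presheaf.map (homOfLE h).op (φ.app V s))
        rw [Scheme.Modules.Hom.app_smul, ← aScalars_map t' (homOfLE h), ← aScalars_app g hg]
        exact N.map_smul (homOfLE h) (g.app V (aScalars t V a)) (φ.app V s) }

lemma secMap_apply {t : X ⟶ Spec (CommRingCat.of A)} {t' : Y ⟶ Spec (CommRingCat.of A)}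
    (g : Y ⟶ X) (hg : g ≫ t = t') {M : X.Modules} {N : Y.Modules}
    (φ : M ⟶ (Scheme.Modules.pushforward g).obj N) {V : X.Opens} {W : Y.Opens}
    (h : W ≤ g ⁻¹ᵁ V) (s : Γ(M, V)) :
    (secMap g hg φ h).hom s = N.presheaf.map (homOfLE h).op (φ.app V s) := rfl

/-- The presheaf of `A`-modules `V ↦ Γ(M, V)`. -/
def secPresheaf (t : X ⟶ Spec (CommRingCat.of A)) (M : X.Modules) :
    TopCat.Presheaf (ModuleCat.{u} A) X where
  obj V := secMod t M V.unop
  map {V W} i := ModuleCat.ofHom (X := secMod t M V.unop) (Y := secMod t M W.unop)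
    { toFun := fun s : Γ(M, V.unop) => M.presheaf.map i s
      map_add' := fun a b => map_add (M.presheaf.map i).hom a b
      map_smul' := fun a (s : Γ(M, V.unop)) => by
        refine (M.map_smul i.unop (aScalars t V.unop a) s).trans ?_
        rw [aScalars_map]
        rfl }
  map_id V := by
    ext s
    exact congr(($(M.presheaf.map_id V)).hom s)
  map_comp i i' := by
    ext s
    exact congr(($(M.presheaf.map_comp i i')).hom s)

lemma secMap_naturality {t : X ⟶ Spec (CommRingCat.of A)} {t' : Y ⟶ Spec (CommRingCat.of A)}
    (g : Y ⟶ X) (hg : g ≫ t = t') {M : X.Modules} {N : Y.Modules}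
    (φ : M ⟶ (Scheme.Modules.pushforward g).obj N) {V V' : X.Opens} {W W' : Y.Opens}
    (h : W ≤ g ⁻¹ᵁ V) (h' : W' ≤ g ⁻¹ᵁ V') (i : V' ⟶ V) (i' : W' ⟶ W) :
    (secPresheaf t M).map i.op ≫ secMap g hg φ h' =
      secMap g hg φ h ≫ (secPresheaf t' N).map i'.op := by
  ext s
  have h1 : φ.app V ≫ ((Scheme.Modules.pushforward g).obj N).presheaf.map i.op =
      M.presheaf.map i.op ≫ φ.app V' := (φ.mapPresheaf.naturality i.op).symm
  refine (congrArg (N.presheaf.map (homOfLE h').op).hom congr(($h1).hom s)).symm.trans ?_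
  have h2 : N.presheaf.map (((Opens.map g.base).map i).op ≫ (homOfLE h').op) =
      N.presheaf.map ((homOfLE h).op ≫ i'.op) := rfl
  rw [Functor.map_comp, Functor.map_comp] at h2
  exact congr(($h2).hom (φ.app V s))

lemma secPresheaf_isSheaf (t : X ⟶ Spec (CommRingCat.of A)) (M : X.Modules) :
    (secPresheaf t M).IsSheaf :=
  Presheaf.isSheaf_of_isSheaf_comp _ _ (forget₂ (ModuleCat.{u} A) Ab) M.isSheaf

/-- The sheaf of `A`-modules on `X` underlying an `𝒪_X`-module. -/
def secSheaf (t : X ⟶ Spec (CommRingCat.of A)) (M : X.Modules) :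
    TopCat.Sheaf (ModuleCat.{u} A) X :=
  ⟨secPresheaf t M, secPresheaf_isSheaf t M⟩

/-- The `A`-linear map on sections given by a morphism of `𝒪_X`-modules. -/
def secSheafMap (t : X ⟶ Spec (CommRingCat.of A)) {M N : X.Modules} (φ : M ⟶ N) :
    secSheaf t M ⟶ secSheaf t N :=
  ⟨{ app V := ModuleCat.ofHom (X := secMod t M V.unop) (Y := secMod t N V.unop)
      { toFun := fun s : Γ(M, V.unop) => φ.app V.unop s
        map_add' := fun a b => map_add (φ.app V.unop).hom a b
        map_smul' := fun a (s : Γ(M, V.unop)) => φ.app_smul (aScalars t V.unop a) s }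
     naturality := fun V W i => by
      ext s
      exact congr(($(φ.mapPresheaf.naturality i)).hom s) }⟩

/-- The functor which sends an `𝒪_X`-module to the underlying sheaf of `A`-modules. -/
def secFunctor (t : X ⟶ Spec (CommRingCat.of A)) :
    X.Modules ⥤ TopCat.Sheaf (ModuleCat.{u} A) X where
  obj := secSheaf t
  map := secSheafMap t

end Sections

section Lin
variable {A : Type u} [CommRing A] {X : Scheme.{u}} (t : X ⟶ Spec (CommRingCat.of A))

/-- Multiplication by `a ∈ A` on an `𝒪_X`-module. -/
def smulEnd (a : A) (M : X.Modules) : M ⟶ M :=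
  ⟨{ app V := ModuleCat.ofHom (X := M.val.obj V) (Y := M.val.obj V)
      { toFun := fun s : Γ(M, V.unop) => aScalars t V.unop a • s
        map_add' := fun (x y : Γ(M, V.unop)) => smul_add (aScalars t V.unop a) x y
        map_smul' := fun (r : Γ(X, V.unop)) (x : Γ(M, V.unop)) => smul_comm (aScalars t V.unop a) r x }
     naturality := fun {V W} i => by
      ext s
      have h := M.map_smul i.unop (aScalars t V.unop a) (s : Γ(M, V.unop))
      rw [aScalars_map] at h
      exact h.symm }⟩

lemma smulEnd_app (a : A) (M : X.Modules) (V : X.Opens) (s : Γ(M, V)) :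
    (smulEnd t a M).app V s = aScalars t V a • s := rfl

lemma smulEnd_comm (a : A) {M N : X.Modules} (f : M ⟶ N) :
    smulEnd t a M ≫ f = f ≫ smulEnd t a N := by
  ext V s
  exact f.app_smul (aScalars t V a) s

lemma smulEnd_one (M : X.Modules) : smulEnd t 1 M = 𝟙 M := by
  ext V s
  exact (congrArg (· • s) (map_one (aScalars t V))).trans (one_smul _ s)

lemma smulEnd_zero (M : X.Modules) : smulEnd t 0 M = 0 := by
  ext V s
  exact (congrArg (· • s) (map_zero (aScalars t V))).trans (zero_smul _ s)

lemma smulEnd_add (a b : A) (M : X.Modules) :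
    smulEnd t (a + b) M = smulEnd t a M + smulEnd t b M := by
  ext V s
  exact (congrArg (· • s) (map_add (aScalars t V) a b)).trans (add_smul _ _ s)

lemma smulEnd_mul (a b : A) (M : X.Modules) :
    smulEnd t (a * b) M = smulEnd t b M ≫ smulEnd t a M := by
  ext V s
  exact (congrArg (· • s) (map_mul (aScalars t V) a b)).trans (mul_smul _ _ s)

lemma smulEnd_pushforward {τ : X ⟶ X} (hτ : τ ≫ t = t) (a : A) (M : X.Modules) :
    (Scheme.Modules.pushforward τ).map (smulEnd t a M) =
      smulEnd t a ((Scheme.Modules.pushforward τ).obj M) := by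
  ext V s
  exact congrArg (fun r : Γ(X, τ ⁻¹ᵁ V) => r • (show Γ(M, τ ⁻¹ᵁ V) from s))
    (aScalars_app τ hτ V a).symm

variable {τ : X ⟶ X} {P Q : Diag X τ}

/-- The action of `a ∈ A` on morphisms of diagrams. -/
def smulHom (hτ : τ ≫ t = t) (a : A) (u : P ⟶ Q) : P ⟶ Q :=
  ⟨smulEnd t a _ ≫ u.f, smulEnd t a _ ≫ u.f', by
    rw [Category.assoc, u.comm_σ, ← Category.assoc, smulEnd_comm, Category.assoc], by
    rw [Diag.comm_j_iff, Category.assoc, Diag.comm_j_iff.1 u.comm_j, ← Category.assoc,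
      smulEnd_comm, Functor.map_comp, smulEnd_pushforward t hτ, Category.assoc]⟩

/-- The category of diagrams is `A`-linear. -/
abbrev linearDiag (hτ : τ ≫ t = t) : Linear A (Diag X τ) where
  homModule P Q :=
    { smul := smulHom t hτ
      one_smul u := by
        change smulHom t hτ 1 u = u
        ext1 <;> simp [smulHom, smulEnd_one]
      mul_smul a b u := by
        change smulHom t hτ (a * b) u = smulHom t hτ a (smulHom t hτ b u)
        ext1 <;> simp [smulHom, mul_comm a b, smulEnd_mul]
      smul_zero a := by
        change smulHom t hτ a 0 = 0
        ext1 <;> simp [smulHom]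
      smul_add a u v := by
        change smulHom t hτ a (u + v) = smulHom t hτ a u + smulHom t hτ a v
        ext1 <;> simp [smulHom]
      add_smul a b u := by
        change smulHom t hτ (a + b) u = smulHom t hτ a u + smulHom t hτ b u
        ext1 <;> simp [smulHom, smulEnd_add]
      zero_smul u := by
        change smulHom t hτ 0 u = 0
        ext1 <;> simp [smulHom, smulEnd_zero] }
  smul_comp P Q R a u v := by
    change smulHom t hτ a u ≫ v = smulHom t hτ a (u ≫ v)
    ext1 <;> simp [smulHom]
  comp_smul P Q R u a v := by
    change u ≫ smulHom t hτ a v = smulHom t hτ a (u ≫ v)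
    ext1
    · change u.f ≫ smulEnd t a _ ≫ v.f = smulEnd t a _ ≫ u.f ≫ v.f
      rw [← Category.assoc, ← smulEnd_comm, Category.assoc]
    · change u.f' ≫ smulEnd t a _ ≫ v.f' = smulEnd t a _ ≫ u.f' ≫ v.f'
      rw [← Category.assoc, ← smulEnd_comm, Category.assoc]

/-- The structure sheaf as a module over itself. -/
def unitMod (X : Scheme.{u}) : X.Modules := SheafOfModules.unit X.ringCatSheaf

lemma qcoh_unitMod (X : Scheme.{u}) : qcoh X (unitMod X) :=
  qcoh_of_affine _ fun U hU => (qcoh _).prop_of_iso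
    (X := (tilde.functor _).obj (ModuleCat.of Γ(X, U) Γ(X, U)))
    (tildeSelf ≪≫ (Scheme.Modules.restrictUnitIso hU.fromSpec).symm) (qcoh_tilde _)

/-- The map `𝒪_X ⟶ g_* 𝒪_Y` of a morphism `g : Y ⟶ X`. -/
def unitToPushforward {X Y : Scheme.{u}} (g : Y ⟶ X) :
    unitMod X ⟶ (Scheme.Modules.pushforward g).obj (unitMod Y) :=
  SheafOfModules.unitToPushforwardObjUnit g.toRingCatSheafHom

lemma unitToPushforward_app {X Y : Scheme.{u}} (g : Y ⟶ X) (V : X.Opens) (s : Γ(X, V)) :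
    (unitToPushforward g).app V s = g.app V s := rfl

/-- The unit diagram `𝒪 ⟶ 𝒪 ⟵ τ^* 𝒪`, with `σ` the identity and `j` the canonical isomorphism. -/
def unitDiag (X : Scheme.{u}) (τ : X ⟶ X) : Diag X τ where
  M := unitMod X
  M' := unitMod X
  qcoh_M := qcoh_unitMod X
  qcoh_M' := qcoh_unitMod X
  σ := 𝟙 _
  j := ((Scheme.Modules.pullbackPushforwardAdjunction τ).homEquiv _ _).symm (unitToPushforward τ)

lemma unitDiag_jAdj (X : Scheme.{u}) (τ : X ⟶ X) :
    (unitDiag X τ).jAdj = unitToPushforward τ := Equiv.apply_symm_apply _ _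

end Lin

section TwoTerm
open HomologicalComplex
universe v w v' w'
variable {C : Type w} [Category.{v} C] [Preadditive C] [HasZeroObject C]
variable {D : Type w'} [Category.{v'} D] [Preadditive D] [HasZeroObject D]

lemma rel01 : (ComplexShape.up ℤ).Rel 0 1 := rfl

/-- The complex `X₀ ⟶ X₁` in degrees `0` and `1`. -/
abbrev two {X₀ X₁ : C} (f : X₀ ⟶ X₁) : CochainComplex C ℤ := double f rel01

/-- A map from a complex in degrees `0` and `1` to the image of such a complex under an additive
functor. -/
def twoMapTo {X₀ X₁ : D} {Y₀ Y₁ : C} {f : X₀ ⟶ X₁} {g : Y₀ ⟶ Y₁} (G : C ⥤ D) [G.Additive]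
    (a : X₀ ⟶ G.obj Y₀) (b : X₁ ⟶ G.obj Y₁) (h : a ≫ G.map g = f ≫ b) :
    two f ⟶ (G.mapHomologicalComplex (ComplexShape.up ℤ)).obj (two g) :=
  mkHomFromDouble rel01 zero_ne_one
    (a ≫ G.map (doubleXIso₀ g rel01).inv) (b ≫ G.map (doubleXIso₁ g rel01 zero_ne_one).inv)
    (by
      change (a ≫ G.map (doubleXIso₀ g rel01).inv) ≫ G.map ((double g rel01).d 0 1) = _
      rw [double_d _ _ zero_ne_one, Category.assoc, ← Functor.map_comp, Iso.inv_hom_id_assoc,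
        Functor.map_comp, reassoc_of% h]
      rfl)
    (fun i hi => by
      change _ ≫ G.map ((double g rel01).d 1 i) = 0
      rw [double_d_eq_zero₀ _ _ _ _ one_ne_zero, Functor.map_zero]
      exact comp_zero)

/-- A map between complexes in degrees `0` and `1`. -/
def twoMap {X₀ X₁ Y₀ Y₁ : C} {f : X₀ ⟶ X₁} {g : Y₀ ⟶ Y₁}
    (a : X₀ ⟶ Y₀) (b : X₁ ⟶ Y₁) (h : a ≫ g = f ≫ b) : two f ⟶ two g :=
  mkHomFromDouble rel01 zero_ne_one
    (a ≫ (doubleXIso₀ g rel01).inv) (b ≫ (doubleXIso₁ g rel01 zero_ne_one).inv)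
    (by
      change _ ≫ (double g rel01).d 0 1 = _
      rw [double_d _ _ zero_ne_one, Category.assoc, Iso.inv_hom_id_assoc, reassoc_of% h])
    (fun i hi => by
      change _ ≫ (double g rel01).d 1 i = 0
      rw [double_d_eq_zero₀ _ _ _ _ one_ne_zero, comp_zero])

lemma twoMap_f₀ {X₀ X₁ Y₀ Y₁ : C} {f : X₀ ⟶ X₁} {g : Y₀ ⟶ Y₁}
    (a : X₀ ⟶ Y₀) (b : X₁ ⟶ Y₁) (h : a ≫ g = f ≫ b) :
    (twoMap a b h).f 0 = (doubleXIso₀ f rel01).hom ≫ a ≫ (doubleXIso₀ g rel01).inv :=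
  mkHomFromDouble_f₀ _ _ _ _ _ _

lemma twoMap_f₁ {X₀ X₁ Y₀ Y₁ : C} {f : X₀ ⟶ X₁} {g : Y₀ ⟶ Y₁}
    (a : X₀ ⟶ Y₀) (b : X₁ ⟶ Y₁) (h : a ≫ g = f ≫ b) :
    (twoMap a b h).f 1 = (doubleXIso₁ f rel01 zero_ne_one).hom ≫ b ≫
      (doubleXIso₁ g rel01 zero_ne_one).inv :=
  mkHomFromDouble_f₁ _ _ _ _ _ _

lemma twoMap_id {X₀ X₁ : C} (f : X₀ ⟶ X₁) :
    twoMap (𝟙 X₀) (𝟙 X₁) (by simp) = 𝟙 (two f) := by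
  apply from_double_hom_ext
  · refine (twoMap_f₀ _ _ _).trans ?_
    rw [Category.id_comp, Iso.hom_inv_id]
    rfl
  · refine (twoMap_f₁ _ _ _).trans ?_
    rw [Category.id_comp, Iso.hom_inv_id]
    rfl

lemma twoMap_comp {X₀ X₁ Y₀ Y₁ Z₀ Z₁ : C} {f : X₀ ⟶ X₁} {g : Y₀ ⟶ Y₁} {e : Z₀ ⟶ Z₁}
    (a : X₀ ⟶ Y₀) (b : X₁ ⟶ Y₁) (h : a ≫ g = f ≫ b)
    (a' : Y₀ ⟶ Z₀) (b' : Y₁ ⟶ Z₁) (h' : a' ≫ e = g ≫ b') :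
    twoMap (a ≫ a') (b ≫ b') (by rw [Category.assoc, h', reassoc_of% h]) =
      twoMap a b h ≫ twoMap a' b' h' := by
  apply from_double_hom_ext
  · rw [comp_f, twoMap_f₀, twoMap_f₀, twoMap_f₀]
    simp
  · rw [comp_f, twoMap_f₁, twoMap_f₁, twoMap_f₁]
    simp

/-- The map from an object `Z` in degree `0` given by `a : Z ⟶ X₀` with `a ≫ f = 0`. -/
def singleToTwo {X₀ X₁ Z : C} {f : X₀ ⟶ X₁} (a : Z ⟶ X₀) (h : a ≫ f = 0) :
    (HomologicalComplex.single C (ComplexShape.up ℤ) 0).obj Z ⟶ two f :=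
  mkHomFromSingle (a ≫ (doubleXIso₀ f rel01).inv) (fun i hi => by
    obtain rfl : 1 = i := by simpa using hi
    change _ ≫ (double f rel01).d 0 1 = 0
    rw [double_d _ _ zero_ne_one, Category.assoc, Iso.inv_hom_id_assoc, reassoc_of% h, zero_comp])

end TwoTerm

section Shtukas
variable {k : Type u} [Field k] [Fintype k]
variable (S : Over (Spec (CommRingCat.of k)))

/-- The base change `S_A` of `S` to `Spec A`, where `A = k[t]`. -/
def XA : Scheme.{u} :=
  Limits.pullback S.hom (Spec.map (CommRingCat.ofHom (Polynomial.C (R := k))))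

/-- The projection `S_A ⟶ S`. -/
def prS : XA S ⟶ S.left := pullback.fst _ _

/-- The projection `S_A ⟶ Spec A`. -/
def prA : XA S ⟶ Spec (CommRingCat.of (Polynomial k)) := pullback.snd _ _

/-- The base change `τ_A` of the Frobenius endomorphism of `S`. -/
def frobA : XA S ⟶ XA S :=
  pullback.lift (prS S ≫ frob S) (prA S) (by
    rw [Category.assoc, frob_hom]
    exact pullback.condition)

lemma frobA_prS : frobA S ≫ prS S = prS S ≫ frob S := pullback.lift_fst _ _ _
lemma frobA_prA : frobA S ≫ prA S = prA S := pullback.lift_snd _ _ _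

lemma frobA_preimage (U : S.left.Opens) : frobA S ⁻¹ᵁ prS S ⁻¹ᵁ U = prS S ⁻¹ᵁ U := by
  rw [← Scheme.Hom.comp_preimage, frobA_prS, Scheme.Hom.comp_preimage, frob_preimage]

/-- Shtukas on `S`: diagrams `M ⟶ M' ⟵ τ_A^* M` of quasi-coherent `𝒪_{S_A}`-modules. -/
abbrev Shtuka := Diag (XA S) (frobA S)

instance : Linear (Polynomial k) (Shtuka S) := linearDiag (prA S) (frobA_prA S)

/-- The unit shtuka. -/
abbrev unitShtuka : Shtuka S := unitDiag (XA S) (frobA S)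

variable {S} in
/-- The sheaf `U ↦ Γ(pr⁻¹ U, F)` of `A`-modules on `S`, for an `𝒪`-module `F` on `S_A`,
where `pr` is the projection `S_A ⟶ S`. -/
def onS (F : (XA S).Modules) : TopCat.Sheaf (ModuleCat.{u} (Polynomial k)) S.left :=
  (TopCat.Sheaf.pushforward _ (prS S).base).obj (secSheaf (prA S) F)

variable {S} in
/-- Functoriality of `onS`. -/
def onSMap {F G : (XA S).Modules} (φ : F ⟶ G) : onS F ⟶ onS G :=
  (TopCat.Sheaf.pushforward _ (prS S).base).map (secSheafMap (prA S) φ)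

variable {S} in
/-- The canonical map `τ : F → τ_A^* F`, `s ↦ τ_A^* s`, on sections over the `τ_A`-stable open
subsets `pr⁻¹ U` of `S_A`. -/
def tau (F : (XA S).Modules) : onS F ⟶ onS ((Scheme.Modules.pullback (frobA S)).obj F) :=
  ⟨{ app U := secMap (frobA S) (frobA_prA S)
      ((Scheme.Modules.pullbackPushforwardAdjunction (frobA S)).unit.app F)
      (V := prS S ⁻¹ᵁ U.unop) (W := prS S ⁻¹ᵁ U.unop) (frobA_preimage S U.unop).ge
     naturality := fun U V i => secMap_naturality (frobA S) (frobA_prA S) _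
      (frobA_preimage S U.unop).ge (frobA_preimage S V.unop).ge
      ((Opens.map (prS S).base).map i.unop) ((Opens.map (prS S).base).map i.unop) }⟩

variable {S} in
/-- The differential `∂ = σ - j ∘ τ`. -/
def del (M : Shtuka S) : onS M.M ⟶ onS M.M' :=
  onSMap M.σ - tau M.M ≫ onSMap M.j


variable {S}

lemma onSMap_comp {F G H : (XA S).Modules} (φ : F ⟶ G) (ψ : G ⟶ H) :
    onSMap (φ ≫ ψ) = onSMap φ ≫ onSMap ψ := rfl

lemma tau_naturality {F G : (XA S).Modules} (φ : F ⟶ G) :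
    onSMap φ ≫ tau G = tau F ≫ onSMap ((Scheme.Modules.pullback (frobA S)).map φ) := by
  have h := (Scheme.Modules.pullbackPushforwardAdjunction (frobA S)).unit.naturality φ
  refine Sheaf.hom_ext (NatTrans.ext (funext fun U => ModuleCat.hom_ext (LinearMap.ext
    fun (s : Γ(F, prS S ⁻¹ᵁ U.unop)) => ?_)))
  have h1 := congr((Scheme.Modules.Hom.app $h (prS S ⁻¹ᵁ U.unop)).hom s)
  refine (congrArg (((Scheme.Modules.pullback (frobA S)).obj G).presheaf.map
    (homOfLE (frobA_preimage S U.unop).ge).op).hom h1).trans ?_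
  exact congr(($(((Scheme.Modules.pullback (frobA S)).map φ).mapPresheaf.naturality
    (homOfLE (frobA_preimage S U.unop).ge).op)).hom
      (((Scheme.Modules.pullbackPushforwardAdjunction (frobA S)).unit.app F).app _ s)).symm

lemma del_naturality {M N : Shtuka S} (a : M ⟶ N) :
    onSMap a.f ≫ del N = del M ≫ onSMap a.f' := by
  have hj : onSMap ((Scheme.Modules.pullback (frobA S)).map a.f) ≫ onSMap N.j =
      onSMap M.j ≫ onSMap a.f' :=
    (onSMap_comp _ _).symm.trans ((congrArg onSMap a.comm_j).trans (onSMap_comp _ _))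
  have hσ : onSMap a.f ≫ onSMap N.σ = onSMap M.σ ≫ onSMap a.f' :=
    (onSMap_comp _ _).symm.trans ((congrArg onSMap a.comm_σ).trans (onSMap_comp _ _))
  rw [del, del, Preadditive.comp_sub, Preadditive.sub_comp, hσ, ← Category.assoc,
    tau_naturality, Category.assoc, Category.assoc, hj]

/-- The complex `M ⟶ M'` in degrees `0` and `1`, with differential `∂ = σ - j ∘ τ`. -/
def cplx : Shtuka S ⥤ CochainComplex (TopCat.Sheaf (ModuleCat.{u} (Polynomial k)) S.left) ℤ where
  obj M := two (del M)
  map a := twoMap (onSMap a.f) (onSMap a.f') (del_naturality a)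
  map_id M := twoMap_id (del M)
  map_comp a b := twoMap_comp _ _ (del_naturality a) _ _ (del_naturality b)

end Shtukas

section Hyper
variable (A : Type u) [CommRing A] (X : TopCat.{u})

/-- Sheaves of `A`-modules on a topological space. -/
abbrev Shv := TopCat.Sheaf (ModuleCat.{u} A) X

instance : Linear A (Shv A X) :=
  inferInstanceAs (Linear A (ObjectProperty.FullSubcategory _))


instance : HasDerivedCategory.{u + 1} (Shv A X) := HasDerivedCategory.standard _

/-- The constant sheaf `A`. -/
def constA : Shv A X :=
  (constantSheaf (Opens.grothendieckTopology X) (ModuleCat.{u} A)).obj (ModuleCat.of A A)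

variable {A X} in
/-- The morphism from the constant sheaf `A` which sends `1` to a global section `s`. -/
def constHom {F : Shv A X} (s : F.obj.obj (op ⊤)) : constA A X ⟶ F :=
  ((constantSheafAdj (Opens.grothendieckTopology X) (ModuleCat.{u} A) (T := ⊤)
    isTerminalTop).homEquiv _ _).symm (ModuleCat.ofHom (LinearMap.toSpanSingleton A _ s))

/-- The object of the derived category given by the constant sheaf `A` in degree `0`. -/
abbrev dA : DerivedCategory (Shv A X) :=
  DerivedCategory.Q.obj ((HomologicalComplex.single _ (ComplexShape.up ℤ) 0).obj (constA A X))

variable {A X} in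
/-- The hypercohomology `ℍ^i(X, K)` of a complex of sheaves of `A`-modules: the derived functors
of global sections, `Hom(A, K[i])` in the derived category. -/
abbrev Hyp (K : CochainComplex (Shv A X) ℤ) (i : ℕ) : Type (u + 1) :=
  ShiftedHom (dA A X) (DerivedCategory.Q.obj K) (i : ℤ)


variable {Y : TopCat.{u}} (g : X ⟶ Y)

instance : PreservesFiniteLimits (TopCat.Sheaf.pullback (ModuleCat.{u} A) g) := by
  have : ReflectsLimits (forget (ModuleCat.{u} A)) := inferInstance
  have : PreservesFiniteLimits
      ((Opens.map g).op.lan : ((Opens Y)ᵒᵖ ⥤ ModuleCat.{u} A) ⥤ _) :=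
    lan_preservesFiniteLimits_of_flat _ _
  exact Functor.sheafPullbackConstruction.preservesFiniteLimits (Opens.map g) (ModuleCat.{u} A)
    (Opens.grothendieckTopology Y) (Opens.grothendieckTopology X)

instance : (TopCat.Sheaf.pullback (ModuleCat.{u} A) g).Additive :=
  Functor.additive_of_preserves_binary_products _

instance : (TopCat.Sheaf.pushforward (ModuleCat.{u} A) g).Additive where
  map_add := rfl

variable {A X} in
/-- The counit `g⁻¹ g_* K ⟶ K` for complexes of sheaves. -/
def counitCplx (K : CochainComplex (Shv A X) ℤ) :
    ((TopCat.Sheaf.pullback (ModuleCat.{u} A) g).mapHomologicalComplex (ComplexShape.up ℤ)).obj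
      (((TopCat.Sheaf.pushforward (ModuleCat.{u} A) g).mapHomologicalComplex
        (ComplexShape.up ℤ)).obj K) ⟶ K where
  f i := (TopCat.Sheaf.pullbackPushforwardAdjunction (ModuleCat.{u} A) g).counit.app (K.X i)
  comm' i j _ :=
    ((TopCat.Sheaf.pullbackPushforwardAdjunction (ModuleCat.{u} A) g).counit.naturality
      (K.d i j)).symm

/-- The canonical map `A ⟶ g⁻¹ A` between constant sheaves. -/
def constToPullback : constA A X ⟶ (TopCat.Sheaf.pullback (ModuleCat.{u} A) g).obj (constA A Y) :=
  constHom (((TopCat.Sheaf.pullbackPushforwardAdjunction (ModuleCat.{u} A) g).unit.app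
    (constA A Y)).hom.app (op ⊤) (((constantSheafAdj (Opens.grothendieckTopology Y)
      (ModuleCat.{u} A) (T := ⊤) isTerminalTop).unit.app (ModuleCat.of A A)).hom (1 : A)))

variable {A X} in
/-- The pullback `ℍ^i(Y, L) → ℍ^i(X, K)` along a continuous map `g : X ⟶ Y` and a morphism
of complexes `L ⟶ g_* K`: the composition
`A ⟶ g⁻¹ A ⟶ (g⁻¹ L)[i] ⟶ (g⁻¹ g_* K)[i] ⟶ K[i]`. -/
def hypPullback {K : CochainComplex (Shv A X) ℤ} {L : CochainComplex (Shv A Y) ℤ}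
    (φ : L ⟶ ((TopCat.Sheaf.pushforward (ModuleCat.{u} A) g).mapHomologicalComplex
        (ComplexShape.up ℤ)).obj K) {i : ℕ} (x : Hyp L i) : Hyp K i :=
  let F := TopCat.Sheaf.pullback (ModuleCat.{u} A) g
  (DerivedCategory.Q.map
      ((HomologicalComplex.single _ (ComplexShape.up ℤ) 0).map (constToPullback A X g) ≫
        (HomologicalComplex.singleMapHomologicalComplex F (ComplexShape.up ℤ) 0).inv.app _) ≫
      F.mapDerivedCategoryFactors.inv.app _) ≫
    ShiftedHom.map x F.mapDerivedCategory ≫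
    (F.mapDerivedCategoryFactors.hom.app _ ≫
      DerivedCategory.Q.map ((F.mapHomologicalComplex (ComplexShape.up ℤ)).map φ ≫
        counitCplx g K))⟦(i : ℤ)⟧'

end Hyper

section Over
variable {k : Type u} [Field k] [Fintype k]

instance (S : Over (Spec (CommRingCat.of k))) : HasExt.{u + 1} (Shtuka S) := HasExt.standard _

variable {S T : Over (Spec (CommRingCat.of k))} (g : S ⟶ T)

lemma frob_naturality : frob S ≫ g.left = g.left ≫ frob T := by
  refine Scheme.Hom.ext rfl fun U => ?_
  ext s
  rw [Scheme.Hom.comp_app, Scheme.Hom.comp_app]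
  change (S.left.presheaf.map (𝟙 (op (g.left ⁻¹ᵁ U)))).hom ((g.left.app U s) ^ Fintype.card k) =
    (g.left.app U).hom (s ^ Fintype.card k)
  rw [S.left.presheaf.map_id, map_pow (g.left.app U).hom]
  rfl

/-- The base change `g_A : S_A ⟶ T_A`. -/
def mapA : XA S ⟶ XA T :=
  pullback.lift (prS S ≫ g.left) (prA S) (by
    rw [Category.assoc, Over.w]
    exact pullback.condition)

lemma mapA_prS : mapA g ≫ prS T = prS S ≫ g.left := pullback.lift_fst _ _ _
lemma mapA_prA : mapA g ≫ prA T = prA S := pullback.lift_snd _ _ _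

lemma frobA_mapA : frobA S ≫ mapA g = mapA g ≫ frobA T := by
  refine pullback.hom_ext ?_ ?_
  · change (frobA S ≫ mapA g) ≫ prS T = (mapA g ≫ frobA T) ≫ prS T
    rw [Category.assoc, mapA_prS, ← Category.assoc, frobA_prS, Category.assoc, Category.assoc,
      frobA_prS, ← Category.assoc (mapA g), mapA_prS, Category.assoc, frob_naturality]
  · change (frobA S ≫ mapA g) ≫ prA T = (mapA g ≫ frobA T) ≫ prA T
    rw [Category.assoc, mapA_prA, Category.assoc, frobA_prA, frobA_prA, mapA_prA]

lemma mapA_preimage (U : T.left.Opens) : mapA g ⁻¹ᵁ prS T ⁻¹ᵁ U = prS S ⁻¹ᵁ g.left ⁻¹ᵁ U := by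
  rw [← Scheme.Hom.comp_preimage, mapA_prS, Scheme.Hom.comp_preimage]

lemma mapA_frobA_preimage (V : (XA T).Opens) :
    mapA g ⁻¹ᵁ frobA T ⁻¹ᵁ V = frobA S ⁻¹ᵁ mapA g ⁻¹ᵁ V :=
  congrArg (· ⁻¹ᵁ V) (frobA_mapA g).symm

lemma app_congr {X Y : Scheme.{u}} {f f' : X ⟶ Y} (h : f = f') (V : Y.Opens) :
    f.app V ≫ X.presheaf.map (eqToHom (h ▸ rfl : f' ⁻¹ᵁ V = f ⁻¹ᵁ V)).op = f'.app V := by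
  subst h
  simp

/-- A morphism over `g : S ⟶ T` from a shtuka `M` on `T` to a shtuka `N` on `S`: morphisms
`M ⟶ g_{A*} N` and `M' ⟶ g_{A*} N'` (equivalently `g_A^* M ⟶ N` and `g_A^* M' ⟶ N'`)
which are compatible with `σ` and with (the adjoints of) `j`. -/
@[ext]
structure HomOver (M : Shtuka T) (N : Shtuka S) where
  f : M.M ⟶ (Scheme.Modules.pushforward (mapA g)).obj N.M
  f' : M.M' ⟶ (Scheme.Modules.pushforward (mapA g)).obj N.M'
  comm_σ : f ≫ (Scheme.Modules.pushforward (mapA g)).map N.σ = M.σ ≫ f'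
  comm_j : f ≫ (Scheme.Modules.pushforward (mapA g)).map N.jAdj ≫
      (Scheme.Modules.pushforwardComp (frobA S) (mapA g)).hom.app N.M' ≫
      (Scheme.Modules.pushforwardCongr (frobA_mapA g)).hom.app N.M' =
    M.jAdj ≫ (Scheme.Modules.pushforward (frobA T)).map f' ≫
      (Scheme.Modules.pushforwardComp (mapA g) (frobA T)).hom.app _

/-- The canonical morphism over `g` between the unit shtukas, given by `g_A^♯`. -/
def unitOver : HomOver g (unitShtuka T) (unitShtuka S) where
  f := unitToPushforward (mapA g)
  f' := unitToPushforward (mapA g)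
  comm_σ := by
    ext V s
    rfl
  comm_j := by
    rw [unitDiag_jAdj, unitDiag_jAdj]
    ext V s
    have h1 := app_congr (frobA_mapA g) V
    exact congr(($h1).hom (s : Γ(XA T, V)))

variable {g}
/-- The map `pr_{T*} F ⟶ g_* pr_{S*} G` of sheaves on `T` induced by `F ⟶ g_{A*} G`. -/
def onSOver {F : (XA T).Modules} {G : (XA S).Modules}
    (φ : F ⟶ (Scheme.Modules.pushforward (mapA g)).obj G) :
    onS F ⟶ (TopCat.Sheaf.pushforward (ModuleCat.{u} (Polynomial k)) g.left.base).obj (onS G) :=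
  ⟨{ app U := secMap (mapA g) (mapA_prA g) φ (V := prS T ⁻¹ᵁ U.unop)
      (W := prS S ⁻¹ᵁ g.left ⁻¹ᵁ U.unop) (mapA_preimage g U.unop).ge
     naturality := fun U V i => secMap_naturality (mapA g) (mapA_prA g) φ
      (mapA_preimage g U.unop).ge (mapA_preimage g V.unop).ge
      ((Opens.map (prS T).base).map i.unop)
      ((Opens.map (prS S).base).map ((Opens.map g.left.base).map i.unop)) }⟩

lemma tau_j (M : Shtuka S) (U : S.left.Opens) :
    (tau M.M ≫ onSMap M.j).hom.app (op U) = secMap (frobA S) (frobA_prA S) M.jAdj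
      (frobA_preimage S U).ge := by
  refine ModuleCat.hom_ext (LinearMap.ext fun (s : Γ(M.M, prS S ⁻¹ᵁ U)) => ?_)
  have h : M.jAdj = (Scheme.Modules.pullbackPushforwardAdjunction (frobA S)).unit.app M.M ≫
      (Scheme.Modules.pushforward (frobA S)).map M.j := Adjunction.homEquiv_unit _ _ _ _
  rw [h]
  exact congr(($(M.j.mapPresheaf.naturality (homOfLE (frobA_preimage S U).ge).op)).hom
    (((Scheme.Modules.pullbackPushforwardAdjunction (frobA S)).unit.app M.M).app _ s))

lemma onSOver_comp {F F₂ : (XA T).Modules} {G G₂ : (XA S).Modules}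
    {φ : F ⟶ (Scheme.Modules.pushforward (mapA g)).obj G}
    {φ₂ : F₂ ⟶ (Scheme.Modules.pushforward (mapA g)).obj G₂} {a : F ⟶ F₂} {b : G ⟶ G₂}
    (h : φ ≫ (Scheme.Modules.pushforward (mapA g)).map b = a ≫ φ₂) :
    onSOver φ ≫ (TopCat.Sheaf.pushforward _ g.left.base).map (onSMap b) =
      onSMap a ≫ onSOver φ₂ := by
  refine Sheaf.hom_ext (NatTrans.ext (funext fun U => ModuleCat.hom_ext (LinearMap.ext
    fun (s : Γ(F, prS T ⁻¹ᵁ U.unop)) => ?_)))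
  have h1 := congr((Scheme.Modules.Hom.app $h (prS T ⁻¹ᵁ U.unop)).hom s)
  refine Eq.trans ?_ (congrArg (G₂.presheaf.map
    (homOfLE (mapA_preimage g U.unop).ge).op).hom h1)
  exact congr(($(b.mapPresheaf.naturality (homOfLE (mapA_preimage g U.unop).ge).op)).hom
    (φ.app _ s))

lemma onSOver_tau {M : Shtuka T} {N : Shtuka S} (φ : HomOver g M N) :
    onSOver φ.f ≫ (TopCat.Sheaf.pushforward _ g.left.base).map (tau N.M ≫ onSMap N.j) =
      (tau M.M ≫ onSMap M.j) ≫ onSOver φ.f' := by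
  refine Sheaf.hom_ext (NatTrans.ext (funext fun U => ?_))
  change secMap (mapA g) (mapA_prA g) φ.f (mapA_preimage g U.unop).ge ≫
    (tau N.M ≫ onSMap N.j).hom.app (op (g.left ⁻¹ᵁ U.unop)) =
    (tau M.M ≫ onSMap M.j).hom.app (op U.unop) ≫
      secMap (mapA g) (mapA_prA g) φ.f' (mapA_preimage g U.unop).ge
  rw [tau_j, tau_j]
  refine ModuleCat.hom_ext (LinearMap.ext fun (s : Γ(M.M, prS T ⁻¹ᵁ U.unop)) => ?_)
  have h1 := congr((Scheme.Modules.Hom.app $(φ.comm_j) (prS T ⁻¹ᵁ U.unop)).hom s)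
  let V := prS T ⁻¹ᵁ U.unop
  let W := prS S ⁻¹ᵁ g.left ⁻¹ᵁ U.unop
  have hW : W ≤ mapA g ⁻¹ᵁ V := (mapA_preimage g U.unop).ge
  have hτ : W ≤ frobA S ⁻¹ᵁ W := (frobA_preimage S _).ge
  have hτV : V ≤ frobA T ⁻¹ᵁ V := (frobA_preimage T _).ge
  have e1 := congr(($(N.jAdj.mapPresheaf.naturality (homOfLE hW).op)).hom (φ.f.app V s))
  have e2 := congr(($(φ.f'.mapPresheaf.naturality (homOfLE hτV).op)).hom (M.jAdj.app V s))
  refine (congrArg (N.M'.presheaf.map (homOfLE hτ).op).hom e1).trans ?_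
  refine Eq.trans ?_ (congrArg (N.M'.presheaf.map (homOfLE hW).op).hom e2).symm
  have h3 : mapA g ⁻¹ᵁ V ≤ mapA g ⁻¹ᵁ frobA T ⁻¹ᵁ V := fun x hx => hτV hx
  refine Eq.trans ?_ (congrArg (N.M'.presheaf.map (homOfLE hW).op).hom
    (congrArg (N.M'.presheaf.map (homOfLE h3).op).hom h1))
  have h4 : mapA g ⁻¹ᵁ frobA T ⁻¹ᵁ V = frobA S ⁻¹ᵁ mapA g ⁻¹ᵁ V :=
    mapA_frobA_preimage g V
  have h5 : N.M'.presheaf.map (((Opens.map (frobA S).base).map (homOfLE hW)).op ≫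
      (homOfLE hτ).op) = N.M'.presheaf.map ((eqToHom h4).op ≫ (homOfLE h3).op ≫
        (homOfLE hW).op) := rfl
  rw [Functor.map_comp, Functor.map_comp, Functor.map_comp] at h5
  exact congr(($h5).hom (N.jAdj.app _ (φ.f.app V s)))

lemma onSOver_del {M : Shtuka T} {N : Shtuka S} (φ : HomOver g M N) :
    onSOver φ.f ≫ (TopCat.Sheaf.pushforward _ g.left.base).map (del N) =
      del M ≫ onSOver φ.f' := by
  rw [del, del, Functor.map_sub, Preadditive.comp_sub, Preadditive.sub_comp,
    onSOver_comp φ.comm_σ, onSOver_tau]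

/-- The map of complexes `M^• ⟶ g_* N^•` induced by a morphism of shtukas over `g`. -/
def cplxOver {M : Shtuka T} {N : Shtuka S} (φ : HomOver g M N) :
    cplx.obj M ⟶ ((TopCat.Sheaf.pushforward (ModuleCat.{u} (Polynomial k))
      g.left.base).mapHomologicalComplex (ComplexShape.up ℤ)).obj (cplx.obj N) :=
  twoMapTo _ (onSOver φ.f) (onSOver φ.f') (onSOver_del φ)

/-- Compatibility of two morphisms over `g` with morphisms of shtukas on `T` and on `S`. -/
def HomOver.Compat {M₁ M₂ : Shtuka T} {N₁ N₂ : Shtuka S} (φ₁ : HomOver g M₁ N₁)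
    (φ₂ : HomOver g M₂ N₂) (a : M₁ ⟶ M₂) (b : N₁ ⟶ N₂) : Prop :=
  a.f ≫ φ₂.f = φ₁.f ≫ (Scheme.Modules.pushforward (mapA g)).map b.f ∧
  a.f' ≫ φ₂.f' = φ₁.f' ≫ (Scheme.Modules.pushforward (mapA g)).map b.f'

end Over

section Classes
variable {A : Type u} [CommRing A] {X : TopCat.{u}}

lemma constHom_comp {F G : Shv A X} (s : F.obj.obj (op ⊤)) (φ : F ⟶ G) :
    constHom s ≫ φ = constHom (φ.hom.app (op ⊤) s) := by
  refine (Adjunction.homEquiv_naturality_right_symm _ _ _).symm.trans ?_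
  refine congrArg ((constantSheafAdj (Opens.grothendieckTopology X) (ModuleCat.{u} A) (T := ⊤)
    isTerminalTop).homEquiv _ _).symm (ModuleCat.hom_ext (LinearMap.ext fun a => ?_))
  exact map_smul (φ.hom.app (op ⊤)).hom a s

lemma constHom_zero (F : Shv A X) : constHom (0 : F.obj.obj (op ⊤)) = 0 := by
  have h := constHom_comp (0 : F.obj.obj (op ⊤)) (0 : F ⟶ F)
  rw [comp_zero, map_zero] at h
  exact h.symm

/-- Functoriality of hypercohomology in the complex. -/
def Hyp.map {K L : CochainComplex (Shv A X) ℤ} (φ : K ⟶ L) {i : ℕ} (x : Hyp K i) : Hyp L i :=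
  x ≫ (shiftFunctor (DerivedCategory (Shv A X)) (i : ℤ)).map (DerivedCategory.Q.map φ)

/-- The connecting map `ℍ^i(X, K₃) → ℍ^{i+1}(X, K₁)` of a short exact sequence
`0 → K₁ → K₂ → K₃ → 0` of complexes. -/
def Hyp.connecting {E : ShortComplex (CochainComplex (Shv A X) ℤ)} (h : E.ShortExact) {i : ℕ}
    (x : Hyp E.X₃ i) : Hyp E.X₁ (i + 1) :=
  ShiftedHom.comp (b := (1 : ℤ)) x (DerivedCategory.triangleOfSESδ h)
    (by push_cast; exact add_comm _ _)

variable {k : Type u} [Field k] [Fintype k]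
variable (S : Over (Spec (CommRingCat.of k)))

instance : (cplx (S := S)).PreservesZeroMorphisms where
  map_zero M N := by
    apply HomologicalComplex.from_double_hom_ext
    · refine (twoMap_f₀ _ _ (del_naturality (0 : M ⟶ N))).trans ?_
      exact (congrArg (_ ≫ ·) zero_comp).trans comp_zero
    · refine (twoMap_f₁ _ _ (del_naturality (0 : M ⟶ N))).trans ?_
      exact (congrArg (_ ≫ ·) zero_comp).trans comp_zero

/-- The global section `1` of the structure sheaf of `S_A`. -/
def oneSec : (onS (unitShtuka S).M).obj.obj (op ⊤) :=
  show Γ(XA S, prS S ⁻¹ᵁ ⊤) from 1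

lemma del_oneSec : (del (unitShtuka S)).hom.app (op ⊤) (oneSec S) = 0 := by
  have h := tau_j (unitShtuka S) ⊤
  rw [unitDiag_jAdj] at h
  have h1 : (tau (unitShtuka S).M ≫ onSMap (unitShtuka S).j).hom.app (op ⊤) (oneSec S) =
      oneSec S := by
    rw [h]
    exact (congrArg ((XA S).presheaf.map (homOfLE (frobA_preimage S ⊤).ge).op).hom
      (map_one ((frobA S).app (prS S ⁻¹ᵁ ⊤)).hom)).trans (map_one _)
  have h2 : (onSMap (unitShtuka S).σ).hom.app (op ⊤) (oneSec S) = oneSec S := rfl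
  exact sub_eq_zero.2 (h2.trans h1.symm)

/-- The class of the section `1` in `ℍ^0` of the complex of the unit shtuka. -/
def oneClass : Hyp (cplx.obj (unitShtuka S)) 0 :=
  ShiftedHom.mk₀ _ rfl (DerivedCategory.Q.map
    (singleToTwo (f := del (unitShtuka S)) (constHom (oneSec S))
      (by rw [constHom_comp, del_oneSec, constHom_zero])))

variable {S} {T : Over (Spec (CommRingCat.of k))}
open Abelian

/-- A family of maps `Ext^i(𝟙_T, M) → Ext^i(𝟙_S, N)`, for all morphisms of shtukas `M → N` over
`g : S ⟶ T`, is the pullback of extensions along `g`: it is compatible with identities of unit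
shtukas, with morphisms of shtukas and with connecting homomorphisms. -/
structure IsExtPullback (g : S ⟶ T)
    (pb : ∀ {M : Shtuka T} {N : Shtuka S}, HomOver g M N → ∀ i : ℕ,
      Ext (unitShtuka T) M i →ₗ[Polynomial k] Ext (unitShtuka S) N i) : Prop where
  unit : pb (unitOver g) 0 (Ext.mk₀ (𝟙 (unitShtuka T))) = Ext.mk₀ (𝟙 (unitShtuka S))
  natural {M₁ M₂ : Shtuka T} {N₁ N₂ : Shtuka S} (φ₁ : HomOver g M₁ N₁) (φ₂ : HomOver g M₂ N₂)
    (a : M₁ ⟶ M₂) (b : N₁ ⟶ N₂) (h : φ₁.Compat φ₂ a b) (i : ℕ) (x : Ext (unitShtuka T) M₁ i) :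
    pb φ₂ i (x.comp (Ext.mk₀ a) (add_zero i)) = (pb φ₁ i x).comp (Ext.mk₀ b) (add_zero i)
  connecting {P : ShortComplex (Shtuka T)} {Q : ShortComplex (Shtuka S)} (hP : P.ShortExact)
    (hQ : Q.ShortExact) (φ₁ : HomOver g P.X₁ Q.X₁) (φ₂ : HomOver g P.X₂ Q.X₂)
    (φ₃ : HomOver g P.X₃ Q.X₃) (h₁ : φ₁.Compat φ₂ P.f Q.f) (h₂ : φ₂.Compat φ₃ P.g Q.g)
    (i : ℕ) (x : Ext (unitShtuka T) P.X₃ i) :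
    pb φ₁ (i + 1) (x.comp hP.extClass rfl) = (pb φ₃ i x).comp hQ.extClass rfl
end Classes

/-- The schemes for which quasi-coherent sheaf cohomology can be computed inside the category of
quasi-coherent modules: locally Noetherian schemes, and quasi-compact schemes with affine diagonal
(for instance quasi-compact separated schemes). -/
def Admissible (X : Scheme.{u}) : Prop :=
  IsLocallyNoetherian X ∨
    (CompactSpace X ∧ IsAffineHom (pullback.diagonal (terminal.from X)))

end Sht

end

/-! Both sides are cohomological δ-functors on the abelian category of shtukas. For `Ext^i(𝟙, -)`
this is `extDelta`. For hypercohomology it is `hypShtuka`, because `M ↦ M^•` is exact: the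
projection `S_A → S` is affine, so its direct image is exact on quasi-coherent modules
(`cplx_shortExact`). In degree `0` both sides are the global sections `s` with `σ(s) = j(τ s)`
(`hypMap_oneClass_bijective`). By Grothendieck's argument, a morphism in degree `0` out of an
effaceable δ-functor extends to all degrees (`DeltaFunctor.exists_extension`), and between two
effaceable ones it is bijective as soon as it is so in degree `0`
(`DeltaFunctor.bijective_of_effaceable`). Yoneda Ext is effaceable in every abelian category
(`exists_mono_comp_eq_zero`), so no injective or projective shtukas are needed.

It remains to efface hypercohomology. Given embeddings `M → I` and `M' → I'` into quasi-coherent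
modules, the shtuka embeds into `splitShtuka`, with modules `I ⊕ I' ⊕ τ_* I'` and `I'` and with
projections as structure maps. There `∂` has a section, so hypercohomology injects into the
cohomology of the degree `0` term, and `pr_* τ_* I'` is `pr_* I'`. Hence it suffices to embed each
quasi-coherent module on `S_A` into a quasi-coherent `I` with `pr_* I` acyclic. This is the only
place where admissibility enters.

If `S` is quasi-compact with affine diagonal, `I` is the finite sum of the direct images from the
preimages of affine opens of `S`. Acyclicity is Serre's vanishing theorem, proved in
`SerreClass.coh_eq_zero` by induction on the degree, from sheaf resolutions attached to affine
covers instead of Čech complexes.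

If `S` is locally Noetherian, `I` is chosen so that sections over quasi-compact opens extend
globally (`exists_mono_extends`), which forces acyclicity by the classical argument for flasque
sheaves. The key is `exists_ideal_of_section`: a section `s` of `F` over an open `U` comes from a
map `I → F` on a quasi-coherent ideal `I` which contains `1` over `U`. The ideal is found inside `F
⊕ 𝒪` by extending the graph of `s` to a quasi-coherent submodule which still meets the kernel of the
projection to `𝒪` trivially; this uses Zorn's lemma and the ascending chain condition on ideals.
Pushing out along `I → 𝒪` makes `s` global, and countably many rounds suffice.

For functoriality in `S`, the pullback of extensions is transported from hypercohomology through the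
isomorphisms. Its properties are those of pullback on hypercohomology: inverse image is exact, hence
compatible with connecting maps, and the class of `1` pulls back to the class of `1`. -/

noncomputable section

namespace Sht

/-! ### Effaceability of Yoneda extensions in an arbitrary abelian category -/

section Effaceable
universe v w t
variable {C : Type w} [Category.{v} C] [Abelian C]
open HomologicalComplex DerivedCategory

/-- A quasi-isomorphism from an object in degree `i` to a complex in degrees `≥ i` is a
monomorphism in degree `i`. -/
lemma mono_f_of_quasiIso {M : C} {L : CochainComplex C ℤ} {i : ℤ}
    (s : (single C (ComplexShape.up ℤ) i).obj M ⟶ L) [L.IsStrictlyGE i] [QuasiIsoAt s i] :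
    Mono (s.f i) := by
  have h0 : L.d (i - 1) i = 0 := (L.isZero_of_isStrictlyGE i (i - 1) (by simp)).eq_of_src _ _
  let e := L.pOpcyclesIso (i - 1) i (by simp) h0
  -- In the lowest degree nothing maps in, so `L.X i` is its own object of opcycles, into which the
  -- homology, here `M`, embeds.
  have h : s.f i ≫ e.hom = (singleObjXSelf (ComplexShape.up ℤ) i M).hom ≫
      (singleObjHomologySelfIso _ _ _).inv ≫ homologyMap s i ≫ L.homologyι i := by
    rw [homologyι_naturality, singleObjHomologySelfIso_inv_homologyι_assoc,
      ← pOpcycles_singleObjOpcyclesSelfIso_inv_assoc, Iso.inv_hom_id_assoc, p_opcyclesMap]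
    rfl
  have : Mono (s.f i ≫ e.hom) := by
    rw [h]
    infer_instance
  exact mono_of_mono _ e.hom

/-- Write the morphism as a fraction `g s⁻¹` through a complex `L` in degrees `≥ i`. Projecting `L`
onto its term in degree `i` turns `s` into a monomorphism `M ⟶ L.X i`, and kills `g` because `K`
vanishes in degree `i`. -/
lemma exists_mono_comp_single_eq_zero [HasDerivedCategory.{t} C] {K : CochainComplex C ℤ} {M : C}
    {i : ℤ} (n : ℤ) (hn : i < n) [K.IsStrictlyGE n]
    (φ : Q.obj K ⟶ Q.obj ((single C (ComplexShape.up ℤ) i).obj M)) :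
    ∃ (N : C) (f : M ⟶ N) (_ : Mono f),
      φ ≫ Q.map ((single C (ComplexShape.up ℤ) i).map f) = 0 := by
  have : CochainComplex.IsStrictlyGE ((single C (ComplexShape.up ℤ) i).obj M) i :=
    inferInstanceAs (CochainComplex.IsStrictlyGE ((CochainComplex.singleFunctor C i).obj M) i)
  obtain ⟨L, _, g, s, hs, rfl⟩ := left_fac_of_isStrictlyGE φ i
  rw [isIso_Q_map_iff_quasiIso] at hs
  have hm := mono_f_of_quasiIso s
  refine ⟨L.X i, (singleObjXSelf (ComplexShape.up ℤ) i M).inv ≫ s.f i, inferInstance, ?_⟩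
  let π : L ⟶ (single C (ComplexShape.up ℤ) i).obj (L.X i) := mkHomToSingle (𝟙 _) (by
    rintro j rfl
    exact (L.isZero_of_isStrictlyGE (j + 1) j (by simp)).eq_of_src _ _)
  have h1 : s ≫ π = (single C (ComplexShape.up ℤ) i).map
      ((singleObjXSelf (ComplexShape.up ℤ) i M).inv ≫ s.f i) := by
    apply to_single_hom_ext
    rw [comp_f, mkHomToSingle_f, single_map_f_self]
    simp [singleObjXSelf]
  have h2 : g ≫ π = 0 := by
    apply to_single_hom_ext
    exact (K.isZero_of_isStrictlyGE n i hn).eq_of_src _ _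
  rw [← h1, Q.map_comp, Category.assoc, IsIso.inv_hom_id_assoc, ← Q.map_comp, h2, Q.map_zero]

/-- Every element of a positive degree Yoneda extension group is killed by a monomorphism. -/
lemma exists_mono_comp_eq_zero [HasExt.{t} C] {X M : C} {n : ℕ} (x : Abelian.Ext X M (n + 1)) :
    ∃ (N : C) (f : M ⟶ N) (_ : Mono f), x.comp (Abelian.Ext.mk₀ f) (add_zero _) = 0 := by
  let K := (CochainComplex.singleFunctor C 0).obj X
  have := K.isStrictlyGE_of_ge (-n) 0 (by lia)
  let := HasDerivedCategory.standard C
  -- A class of degree `n + 1` is a morphism from `X` in degree `0` to `M` in degree `-(n + 1)`; the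
  -- bound `-n ≤ 0` is all that is needed of `X`.
  obtain ⟨N, f, hf, h⟩ := exists_mono_comp_single_eq_zero (K := K) (-n) (i := -(n + 1)) (by lia)
    (M := M) (x.hom ≫ ((singleFunctors C).shiftIso (n + 1) (-(n + 1)) 0 (by lia)).hom.app _)
  refine ⟨N, f, hf, Abelian.Ext.homEquiv.injective ?_⟩
  have e := ((singleFunctors C).shiftIso (n + 1) (-(n + 1)) 0 (by lia)).hom.naturality f
  have h3 : x.hom ≫ ((singleFunctor C 0).map f)⟦((n : ℤ) + 1)⟧' = 0 := by
    rw [← cancel_mono (((singleFunctors C).shiftIso (n + 1) (-(n + 1)) 0 (by lia)).hom.app N),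
      zero_comp, Category.assoc]
    refine Eq.trans ?_ ((Category.assoc _ _ _).symm.trans h)
    exact congrArg (x.hom ≫ ·) e
  refine ((Abelian.Ext.hom_comp_singleFunctor_map_shift x f).symm.trans ?_).trans
    (Abelian.Ext.zero_hom _ _ _).symm
  exact h3
end Effaceable

/-! ### Universality of effaceable δ-functors -/

section Delta
universe v w t
variable (A : Type u) [CommRing A] (C : Type w) [Category.{v} C] [Abelian C]

/-- Cohomological `δ`-functors with values in `A`-modules. -/
structure DeltaFunctor where
  /-- the functor in degree `i` -/
  H : ℕ → C ⥤ ModuleCat.{t} A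
  /-- the connecting homomorphisms -/
  δ {E : ShortComplex C} (hE : E.ShortExact) (i : ℕ) : (H i).obj E.X₃ ⟶ (H (i + 1)).obj E.X₁
  δ_naturality {E₁ E₂ : ShortComplex C} (h₁ : E₁.ShortExact) (h₂ : E₂.ShortExact) (φ : E₁ ⟶ E₂)
    (i : ℕ) : δ h₁ i ≫ (H (i + 1)).map φ.τ₁ = (H i).map φ.τ₃ ≫ δ h₂ i
  map_g_δ {E : ShortComplex C} (hE : E.ShortExact) (i : ℕ) : (H i).map E.g ≫ δ hE i = 0
  exact₃ {E : ShortComplex C} (hE : E.ShortExact) (i : ℕ) (x : (H i).obj E.X₃)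
    (hx : δ hE i x = 0) : ∃ y, (H i).map E.g y = x
  exact₁ {E : ShortComplex C} (hE : E.ShortExact) (i : ℕ) (x : (H (i + 1)).obj E.X₁)
    (hx : (H (i + 1)).map E.f x = 0) : ∃ y, δ hE i y = x

variable {A C}
namespace DeltaFunctor

/-- The elements of positive degree are killed by monomorphisms. -/
def Effaceable (T : DeltaFunctor.{u, v, w, t} A C) : Prop :=
  ∀ (i : ℕ) (M : C) (x : (T.H (i + 1)).obj M), ∃ (N : C) (f : M ⟶ N) (_ : Mono f),
    (T.H (i + 1)).map f x = 0

variable {T T' : DeltaFunctor.{u, v, w, t} A C}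

/-- The short exact sequence of a monomorphism and its cokernel. -/
abbrev cokerSeq {M N : C} (f : M ⟶ N) : ShortComplex C :=
  ShortComplex.mk f (cokernel.π f) (cokernel.condition f)

lemma cokerSeq_shortExact {M N : C} (f : M ⟶ N) [Mono f] : (cokerSeq f).ShortExact where
  exact := ShortComplex.exact_cokernel f

/-- The reduction of degree `i + 1` to degree `i` on which all induction below rests. -/
lemma exists_δ_eq (hT : T.Effaceable) {i : ℕ} {M : C} (x : (T.H (i + 1)).obj M) :
    ∃ (N : C) (f : M ⟶ N) (_ : Mono f) (y : (T.H i).obj (cokernel f)),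
      T.δ (cokerSeq_shortExact f) i y = x := by
  obtain ⟨N, f, hf, h⟩ := hT i M x
  obtain ⟨y, hy⟩ := T.exact₁ (cokerSeq_shortExact f) i x h
  exact ⟨N, f, hf, y, hy⟩

lemma δ_naturality_apply (T : DeltaFunctor.{u, v, w, t} A C) {E₁ E₂ : ShortComplex C}
    (h₁ : E₁.ShortExact) (h₂ : E₂.ShortExact) (φ : E₁ ⟶ E₂) (i : ℕ) (x : (T.H i).obj E₁.X₃) :
    (T.H (i + 1)).map φ.τ₁ (T.δ h₁ i x) = T.δ h₂ i ((T.H i).map φ.τ₃ x) :=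
  congr(($(T.δ_naturality h₁ h₂ φ i)).hom x)

/-- Two short exact sequences `E`, `E'` and a morphism `E.X₁ ⟶ E'.X₁` extend to a diagram
`E ⟶ E'' ⟵ E'` of short exact sequences in which `E'.X₁ ⟶ E''.X₁` is the identity. -/
lemma exists_shortExact_of_hom {E E' : ShortComplex C} (hE : E.ShortExact) (hE' : E'.ShortExact)
    (e : E.X₁ ⟶ E'.X₁) : ∃ (N : C) (f : E'.X₁ ⟶ N) (_ : Mono f) (a : E ⟶ cokerSeq f)
      (b : E' ⟶ cokerSeq f), a.τ₁ = e ∧ b.τ₁ = 𝟙 _ := by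
  have := hE.mono_f
  have := hE'.mono_f
  -- The middle term is the pushout of `E.X₂` and `E'.X₂` under `E.X₁`. It contains `E'.X₁` because
  -- pushouts of monomorphisms are monomorphisms.
  let f : E'.X₁ ⟶ pushout E.f (e ≫ E'.f) := E'.f ≫ pushout.inr _ _
  have : Mono (pushout.inr E.f (e ≫ E'.f)) := inferInstance
  have hf : Mono f := mono_comp _ _
  have := hE.epi_g
  have := hE'.epi_g
  have c : E.f ≫ pushout.inl E.f (e ≫ E'.f) = e ≫ f := by
    rw [pushout.condition, Category.assoc]
  refine ⟨_, f, hf,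
    { τ₁ := e
      τ₂ := pushout.inl _ _
      τ₃ := hE.exact.desc (pushout.inl _ _ ≫ cokernel.π f) (by
        rw [← Category.assoc, c, Category.assoc, cokernel.condition, comp_zero])
      comm₁₂ := c.symm
      comm₂₃ := (hE.exact.g_desc _ _).symm },
    { τ₁ := 𝟙 _
      τ₂ := pushout.inr _ _
      τ₃ := hE'.exact.desc (pushout.inr _ _ ≫ cokernel.π f) (by
        rw [← Category.assoc]
        exact cokernel.condition f)
      comm₁₂ := Category.id_comp _
      comm₂₃ := (hE'.exact.g_desc _ _).symm }, rfl, rfl⟩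

/-- Independence of the choices in the construction of a morphism out of an effaceable
`δ`-functor, and naturality. -/
lemma δ_app_congr {i : ℕ} (φ : T.H i ⟶ T'.H i) {E E' : ShortComplex C} (hE : E.ShortExact)
    (hE' : E'.ShortExact) (e : E.X₁ ⟶ E'.X₁) (y : (T.H i).obj E.X₃) (y' : (T.H i).obj E'.X₃)
    (h : (T.H (i + 1)).map e (T.δ hE i y) = T.δ hE' i y') :
    (T'.H (i + 1)).map e (T'.δ hE i (φ.app _ y)) = T'.δ hE' i (φ.app _ y') := by
  obtain ⟨N, f, hf, a, b, ha, hb⟩ := exists_shortExact_of_hom hE hE' e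
  have h1 := T.δ_naturality_apply hE (cokerSeq_shortExact f) a i y
  have h2 := T.δ_naturality_apply hE' (cokerSeq_shortExact f) b i y'
  rw [ha, h] at h1
  rw [hb, CategoryTheory.Functor.map_id] at h2
  -- In the common sequence the two classes have the same image under `δ`, so they differ by a class
  -- from the middle term, and `T'` kills the connecting image of such classes.
  have h3 : T.δ (cokerSeq_shortExact f) i ((T.H i).map a.τ₃ y - (T.H i).map b.τ₃ y') = 0 := by
    rw [map_sub, ← h1, ← h2]
    exact sub_self _
  obtain ⟨z, hz⟩ := T.exact₃ (cokerSeq_shortExact f) i _ h3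
  have h4 := T'.δ_naturality_apply hE (cokerSeq_shortExact f) a i (φ.app _ y)
  have h5 := T'.δ_naturality_apply hE' (cokerSeq_shortExact f) b i (φ.app _ y')
  rw [ha] at h4
  rw [hb, CategoryTheory.Functor.map_id] at h5
  refine h4.trans (Eq.trans ?_ h5.symm)
  rw [← sub_eq_zero, ← map_sub, ← NatTrans.naturality_apply, ← NatTrans.naturality_apply,
    ← map_sub, ← hz, NatTrans.naturality_apply]
  exact congr(($(T'.map_g_δ (cokerSeq_shortExact f) i)).hom _)

/-- The extension to degree `i + 1` of a morphism in degree `i` from an effaceable `δ`-functor. -/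
lemma exists_succ (hT : T.Effaceable) {i : ℕ} (φ : T.H i ⟶ T'.H i) :
    ∃ ψ : T.H (i + 1) ⟶ T'.H (i + 1), ∀ {E : ShortComplex C} (hE : E.ShortExact),
      T.δ hE i ≫ ψ.app _ = φ.app _ ≫ T'.δ hE i := by
  -- Each class is written as `δ y` for an arbitrarily chosen embedding, and its image is forced to
  -- be `δ (φ y)`. Independence of the choice, naturality and linearity all follow from
  -- `δ_app_congr`.
  choose N f hf y hy using fun (M : C) (x : (T.H (i + 1)).obj M) => exists_δ_eq hT x
  let p (M : C) (x : (T.H (i + 1)).obj M) : (T'.H (i + 1)).obj M :=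
    T'.δ (cokerSeq_shortExact (f M x)) i (φ.app _ (y M x))
  have key {E : ShortComplex C} (hE : E.ShortExact) {M : C} (e : E.X₁ ⟶ M)
      (z : (T.H i).obj E.X₃) :
      (T'.H (i + 1)).map e (T'.δ hE i (φ.app _ z)) = p M ((T.H (i + 1)).map e (T.δ hE i z)) :=
    δ_app_congr φ hE (cokerSeq_shortExact (f M ((T.H (i + 1)).map e (T.δ hE i z)))) e z _
      (hy M _).symm
  have key' {E : ShortComplex C} (hE : E.ShortExact) (z : (T.H i).obj E.X₃) :
      T'.δ hE i (φ.app _ z) = p _ (T.δ hE i z) := by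
    have := key hE (𝟙 _) z
    rw [CategoryTheory.Functor.map_id, CategoryTheory.Functor.map_id] at this
    exact this
  have nat {M M' : C} (e : M ⟶ M') (x : (T.H (i + 1)).obj M) :
      (T'.H (i + 1)).map e (p M x) = p M' ((T.H (i + 1)).map e x) := by
    conv_rhs => rw [← hy M x]
    exact key (cokerSeq_shortExact (f M x)) e _
  have smul (M : C) (a : A) (x : (T.H (i + 1)).obj M) : p M (a • x) = a • p M x := by
    conv_lhs => rw [← hy M x, ← map_smul, ← key' (cokerSeq_shortExact (f M x))]
    rw [map_smul, map_smul]
  have add (M : C) (x x' : (T.H (i + 1)).obj M) : p M (x + x') = p M x + p M x' := by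
    -- The embeddings chosen for `x` and `x'` may differ; both are pushed into one short exact
    -- sequence, where `δ` is additive.
    obtain ⟨N', f', hf', a, b, ha, hb⟩ := exists_shortExact_of_hom
      (cokerSeq_shortExact (f M x)) (cokerSeq_shortExact (f M x')) (𝟙 M)
    have h1 := T.δ_naturality_apply (cokerSeq_shortExact (f M x)) (cokerSeq_shortExact f') a i
      (y M x)
    have h2 := T.δ_naturality_apply (cokerSeq_shortExact (f M x')) (cokerSeq_shortExact f') b i
      (y M x')
    rw [ha, hy, CategoryTheory.Functor.map_id] at h1
    rw [hb, hy, CategoryTheory.Functor.map_id] at h2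
    replace h1 : x = _ := h1
    replace h2 : x' = _ := h2
    rw [h1, h2, ← map_add, ← key' (cokerSeq_shortExact f'), ← key' (cokerSeq_shortExact f'),
      ← key' (cokerSeq_shortExact f'), map_add, map_add]
  refine ⟨{ app M := ModuleCat.ofHom
              { toFun := p M
                map_add' := add M
                map_smul' := smul M }
            naturality := fun M M' e => ?_ }, fun {E} hE => ?_⟩
  · ext x
    exact (nat e x).symm
  · ext z
    exact (key' hE z).symm

/-- A morphism in degree `0` from an effaceable `δ`-functor extends to all degrees. -/
lemma exists_extension (hT : T.Effaceable) (φ : T.H 0 ⟶ T'.H 0) :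
    ∃ ψ : ∀ i, T.H i ⟶ T'.H i, ψ 0 = φ ∧ ∀ (i : ℕ) {E : ShortComplex C} (hE : E.ShortExact),
      T.δ hE i ≫ (ψ (i + 1)).app _ = (ψ i).app _ ≫ T'.δ hE i := by
  choose s hs using fun (i : ℕ) (φ : T.H i ⟶ T'.H i) => exists_succ hT φ
  exact ⟨fun i => Nat.rec φ (fun i ψ => s i ψ) i, rfl, fun i E hE => hs i _ hE⟩

/-- A morphism of effaceable `δ`-functors is bijective if it is so in degree `0`. -/
lemma bijective_of_effaceable (hT : T.Effaceable) (hT' : T'.Effaceable)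
    (ψ : ∀ i, T.H i ⟶ T'.H i) (hψ : ∀ (i : ℕ) {E : ShortComplex C} (hE : E.ShortExact),
      T.δ hE i ≫ (ψ (i + 1)).app _ = (ψ i).app _ ≫ T'.δ hE i)
    (h0 : ∀ M, Function.Bijective ((ψ 0).app M)) (i : ℕ) (M : C) :
    Function.Bijective ((ψ i).app M) := by
  induction i generalizing M with
  | zero => exact h0 M
  | succ i ih =>
    have hδ {E : ShortComplex C} (hE : E.ShortExact) (z : (T.H i).obj E.X₃) :
        (ψ (i + 1)).app _ (T.δ hE i z) = T'.δ hE i ((ψ i).app _ z) :=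
      congr(($(hψ i hE)).hom z)
    constructor
    · rw [injective_iff_map_eq_zero]
      intro x hx
      obtain ⟨N, f, hf, y, rfl⟩ := exists_δ_eq hT x
      rw [hδ (cokerSeq_shortExact f)] at hx
      obtain ⟨z, hz⟩ := T'.exact₃ (cokerSeq_shortExact f) i _ hx
      obtain ⟨z, rfl⟩ := (ih _).2 z
      rw [← NatTrans.naturality_apply] at hz
      rw [← (ih _).1 hz]
      exact congr(($(T.map_g_δ (cokerSeq_shortExact f) i)).hom _)
    · intro x
      obtain ⟨N, f, hf, y, rfl⟩ := exists_δ_eq hT' x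
      obtain ⟨y, rfl⟩ := (ih _).2 y
      exact ⟨_, hδ (cokerSeq_shortExact f) y⟩

end DeltaFunctor
end Delta

/-! ### Long exact sequences of morphisms in the derived category -/

section ShiftedHom
universe v w t
variable {D : Type w} [Category.{v} D] [Abelian D] [HasDerivedCategory.{t} D]
open DerivedCategory Pretriangulated

/-- Functoriality in the second argument of the morphisms `d ⟶ K⟦i⟧` in the derived category. -/
abbrev shMap {d X Y : DerivedCategory D} {i : ℤ} (x : ShiftedHom d X i) (f : X ⟶ Y) :
    ShiftedHom d Y i := x ≫ f⟦i⟧'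

variable {E : ShortComplex (CochainComplex D ℤ)} (h : E.ShortExact) (d : DerivedCategory D)

/-- The connecting homomorphism of the morphisms from `d` in the derived category. -/
def shConn {i j : ℤ} (hij : i + 1 = j) (x : ShiftedHom d (Q.obj E.X₃) i) :
    ShiftedHom d (Q.obj E.X₁) j :=
  ShiftedHom.comp (b := (1 : ℤ)) x (triangleOfSESδ h) (by lia)

lemma shConn_eq {i j : ℤ} (hij : i + 1 = j) (x : ShiftedHom d (Q.obj E.X₃) i) :
    (preadditiveCoyoneda.obj (op d)).homologySequenceδ (triangleOfSES h) i j hij x =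
      shConn h d hij x :=
  preadditiveCoyoneda_homologySequenceδ_apply (triangleOfSES h) i j hij (A := op d) x

lemma sh_exact₂ {E : ShortComplex (CochainComplex D ℤ)} (h : E.ShortExact) (d : DerivedCategory D)
    {i : ℤ} (x : ShiftedHom d (Q.obj E.X₂) i) (hx : shMap x (Q.map E.g) = 0) :
    ∃ y : ShiftedHom d (Q.obj E.X₁) i, shMap y (Q.map E.f) = x :=
  (ShortComplex.ab_exact_iff _).1 ((preadditiveCoyoneda.obj (op d)).homologySequence_exact₂ _
    (triangleOfSES_distinguished h) i) x hx

lemma sh_exact₃ {i j : ℤ} (hij : i + 1 = j) (x : ShiftedHom d (Q.obj E.X₃) i)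
    (hx : shConn h d hij x = 0) :
    ∃ y : ShiftedHom d (Q.obj E.X₂) i, shMap y (Q.map E.g) = x :=
  (ShortComplex.ab_exact_iff _).1 ((preadditiveCoyoneda.obj (op d)).homologySequence_exact₃ _
    (triangleOfSES_distinguished h) i j hij) x ((shConn_eq h d hij x).trans hx)

lemma sh_exact₁ {i j : ℤ} (hij : i + 1 = j) (x : ShiftedHom d (Q.obj E.X₁) j)
    (hx : shMap x (Q.map E.f) = 0) :
    ∃ y : ShiftedHom d (Q.obj E.X₃) i, shConn h d hij y = x := by
  obtain ⟨y, hy⟩ := (ShortComplex.ab_exact_iff _).1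
    ((preadditiveCoyoneda.obj (op d)).homologySequence_exact₁ _
      (triangleOfSES_distinguished h) i j hij) x hx
  exact ⟨y, (shConn_eq h d hij y).symm.trans hy⟩

lemma shConn_map_g {i j : ℤ} (hij : i + 1 = j) (x : ShiftedHom d (Q.obj E.X₂) i) :
    shConn h d hij (shMap x (Q.map E.g)) = 0 := by
  have h0 : Q.map E.g ≫ triangleOfSESδ h = 0 :=
    comp_distTriang_mor_zero₂₃ _ (triangleOfSES_distinguished h)
  rw [shConn, ShiftedHom.comp, Category.assoc, ← Functor.map_comp_assoc, h0, Functor.map_zero,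
    zero_comp, comp_zero]

lemma shConn_naturality {E₁ E₂ : ShortComplex (CochainComplex D ℤ)} (h₁ : E₁.ShortExact)
    (h₂ : E₂.ShortExact) (φ : E₁ ⟶ E₂) {i j : ℤ} (hij : i + 1 = j)
    (x : ShiftedHom d (Q.obj E₁.X₃) i) :
    shMap (shConn h₁ d hij x) (Q.map φ.τ₁) = shConn h₂ d hij (shMap x (Q.map φ.τ₃)) := by
  simp only [shMap, shConn]
  rw [← ShiftedHom.comp_mk₀ _ 0 rfl, ← ShiftedHom.comp_mk₀ _ 0 rfl,
    ShiftedHom.comp_assoc _ _ _ _ (zero_add (1 : ℤ)) (by lia),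
    ShiftedHom.comp_assoc _ _ _ _ (add_zero (1 : ℤ)) (by lia),
    ShiftedHom.comp_mk₀, ShiftedHom.mk₀_comp, triangleOfSESδ_naturality h₁ h₂ φ]

/-- The formal part of the compatibility of pullback with connecting maps: it isolates the one
commutative square `key` which has to be proved. -/
lemma shMap_comp_eq {d d' Y Z Y' Z' : DerivedCategory D} {a b : ℤ} (s : d ⟶ d')
    (x : ShiftedHom d' Y a) (e : ShiftedHom Y Z (1 : ℤ)) (e' : ShiftedHom Y' Z' (1 : ℤ))
    (t₁ : Z ⟶ Z') (t₃ : Y ⟶ Y') (key : e ≫ t₁⟦(1 : ℤ)⟧' = t₃ ≫ e') (h : 1 + a = b) :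
    s ≫ shMap (x.comp e h) t₁ = ShiftedHom.comp (s ≫ shMap x t₃) e' h := by
  have h1 : shMap (x.comp e h) t₁ = ShiftedHom.comp (shMap x t₃) e' h := by
    simp only [shMap]
    rw [← ShiftedHom.comp_mk₀ _ 0 rfl, ← ShiftedHom.comp_mk₀ _ 0 rfl,
      ShiftedHom.comp_assoc _ _ _ _ (zero_add (1 : ℤ)) (by lia),
      ShiftedHom.comp_assoc _ _ _ _ (add_zero (1 : ℤ)) (by lia),
      ShiftedHom.comp_mk₀, ShiftedHom.mk₀_comp, key]
  rw [h1, ShiftedHom.comp, ShiftedHom.comp, Category.assoc s]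

lemma comp_cancel_of_eq {C : Type w} [Category.{v} C] {X₀ X₁ X₂ X₃ X₄ Y₁ Y₂ : C}
    {e₀ : X₀ ⟶ X₄} {a : X₀ ⟶ X₁} {e : X₁ ⟶ X₂} {b : X₂ ⟶ X₃} {c : X₃ ⟶ X₄} {c' : X₄ ⟶ X₃}
    {b' : X₃ ⟶ X₂} {t : X₂ ⟶ Y₂} {t' : X₁ ⟶ Y₁} {e' : Y₁ ⟶ Y₂} (h : e₀ = a ≫ e ≫ b ≫ c)
    (hc : c ≫ c' = 𝟙 _) (hb : b ≫ b' = 𝟙 _) (n : e ≫ t = t' ≫ e') :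
    (e₀ ≫ c') ≫ b' ≫ t = (a ≫ t') ≫ e' := by
  rw [h, Category.assoc, Category.assoc, Category.assoc, Category.assoc, reassoc_of% hc,
    reassoc_of% hb, n, Category.assoc]

end ShiftedHom

/-! ### The two δ-functors: extensions and hypercohomology -/

section DeltaHyp
universe v w t v' w' t'
variable {A : Type u} [CommRing A]
variable {C : Type w} [Category.{v} C] [Abelian C] [Linear A C]

/-- The `δ`-functor `Ext^i(X, -)`. -/
def extDelta [HasExt.{t} C] (X : C) : DeltaFunctor.{u, v, w, t} A C where
  H i :=
    { obj M := ModuleCat.of A (Abelian.Ext X M i)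
      map {M N} f := ModuleCat.ofHom
        { toFun := fun x : Abelian.Ext X M i => x.comp (Abelian.Ext.mk₀ f) (add_zero i)
          map_add' := fun x y => Abelian.Ext.add_comp _ _ _ _
          map_smul' := fun a x => Abelian.Ext.smul_comp _ _ _ _ }
      map_id M := by
        ext x
        exact Abelian.Ext.comp_mk₀_id x
      map_comp {M N P} f g := by
        ext (x : Abelian.Ext X M i)
        change x.comp (Abelian.Ext.mk₀ (f ≫ g)) (add_zero i) =
          (x.comp (Abelian.Ext.mk₀ f) (add_zero i)).comp (Abelian.Ext.mk₀ g) (add_zero i)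
        rw [Abelian.Ext.comp_assoc_of_third_deg_zero, Abelian.Ext.mk₀_comp_mk₀] }
  δ {E} hE i := ModuleCat.ofHom (X := Abelian.Ext X E.X₃ i) (Y := Abelian.Ext X E.X₁ (i + 1))
    { toFun := fun x => x.comp hE.extClass rfl
      map_add' := fun x y => Abelian.Ext.add_comp _ _ _ _
      map_smul' := fun a x => Abelian.Ext.smul_comp _ _ _ _ }
  δ_naturality {E₁ E₂} h₁ h₂ φ i := by
    ext (x : Abelian.Ext X E₁.X₃ i)
    change (x.comp h₁.extClass rfl).comp (Abelian.Ext.mk₀ φ.τ₁) (add_zero _) =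
      (x.comp (Abelian.Ext.mk₀ φ.τ₃) (add_zero i)).comp h₂.extClass rfl
    rw [Abelian.Ext.comp_assoc_of_third_deg_zero, Abelian.Ext.comp_assoc_of_second_deg_zero,
      ShortComplex.ShortExact.extClass_naturality h₁ h₂ φ]
  map_g_δ {E} hE i := by
    ext (x : Abelian.Ext X E.X₂ i)
    change (x.comp (Abelian.Ext.mk₀ E.g) (add_zero i)).comp hE.extClass rfl = 0
    rw [Abelian.Ext.comp_assoc_of_second_deg_zero, ShortComplex.ShortExact.comp_extClass,
      Abelian.Ext.comp_zero]
  exact₃ {E} hE i x hx := Abelian.Ext.covariant_sequence_exact₃ X hE x rfl hx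
  exact₁ {E} hE i x hx := Abelian.Ext.covariant_sequence_exact₁ X hE x hx rfl

lemma extDelta_effaceable [HasExt.{t} C] (X : C) :
    (extDelta (A := A) X).Effaceable :=
  fun _ _ x => exists_mono_comp_eq_zero (X := X) x

variable {D : Type w'} [Category.{v'} D] [Abelian D] [HasDerivedCategory.{t'} D] [Linear A D]
open DerivedCategory

/-- The `δ`-functor `Hom(d, K(-)[i])` of a functor `K` with values in complexes which
preserves short exact sequences. -/
def hypDelta (K : C ⥤ CochainComplex D ℤ) [K.PreservesZeroMorphisms]
    (hK : ∀ E : ShortComplex C, E.ShortExact → (E.map K).ShortExact) (d : DerivedCategory D) :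
    DeltaFunctor.{u, v, w, t'} A C where
  H i :=
    { obj M := ModuleCat.of A (ShiftedHom d (Q.obj (K.obj M)) (i : ℤ))
      map {M N} f := ModuleCat.ofHom
        { toFun := fun x : ShiftedHom d (Q.obj (K.obj M)) (i : ℤ) => shMap x (Q.map (K.map f))
          map_add' := fun x y => Preadditive.add_comp _ _ _ _ _ _
          map_smul' := fun a x => Linear.smul_comp _ _ _ _ _ _ }
      map_id M := by
        ext (x : ShiftedHom d (Q.obj (K.obj M)) (i : ℤ))
        change shMap x (Q.map (K.map (𝟙 M))) = x
        simp [shMap]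
      map_comp {M N P} f g := by
        ext (x : ShiftedHom d (Q.obj (K.obj M)) (i : ℤ))
        change shMap x (Q.map (K.map (f ≫ g))) = shMap (shMap x (Q.map (K.map f))) _
        simp [shMap] }
  δ {E} hE i := ModuleCat.ofHom (X := ShiftedHom d (Q.obj (K.obj E.X₃)) (i : ℤ))
    (Y := ShiftedHom d (Q.obj (K.obj E.X₁)) ((i + 1 : ℕ) : ℤ))
    { toFun := fun x => shConn (hK E hE) d (by push_cast; rfl) x
      map_add' := fun x y => ShiftedHom.add_comp _ _ _ _
      map_smul' := fun a x => ShiftedHom.smul_comp _ _ _ _ }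
  δ_naturality {E₁ E₂} h₁ h₂ φ i := by
    ext x
    exact shConn_naturality d (hK E₁ h₁) (hK E₂ h₂) (K.mapShortComplex.map φ)
      (by push_cast; rfl) x
  map_g_δ {E} hE i := by
    ext x
    exact shConn_map_g (hK E hE) d (by push_cast; rfl) x
  exact₃ {E} hE i x hx := sh_exact₃ (hK E hE) d (by push_cast; rfl) x hx
  exact₁ {E} hE i x hx := sh_exact₁ (hK E hE) d (by push_cast; rfl) x hx

end DeltaHyp

/-! ### Pullback on hypercohomology: linearity, naturality, connecting maps -/

section Pullback
variable {A : Type u} [CommRing A] {X Y : TopCat.{u}} (g : X ⟶ Y)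
open DerivedCategory

instance : (TopCat.Sheaf.pushforward (ModuleCat.{u} A) g).Linear A where
  map_smul _ _ := rfl

instance : (TopCat.Sheaf.pullback (ModuleCat.{u} A) g).Linear A where
  map_smul {F G} f a := by
    let adj := TopCat.Sheaf.pullbackPushforwardAdjunction (ModuleCat.{u} A) g
    -- Under adjunction `g⁻¹ f` becomes `f` followed by the unit, and this expression is visibly
    -- linear in `f`.
    apply (adj.homEquiv _ _).injective
    have h (f : F ⟶ G) : adj.homEquiv _ _ ((TopCat.Sheaf.pullback (ModuleCat.{u} A) g).map f) =
        f ≫ adj.unit.app G := by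
      rw [Adjunction.homEquiv_unit]
      exact (adj.unit.naturality f).symm
    rw [h, Linear.smul_comp, ← h, Adjunction.homEquiv_unit, Adjunction.homEquiv_unit,
      Functor.map_smul, Linear.comp_smul]

/-- The first part of the pullback on hypercohomology. -/
def hypSrc : dA A X ⟶
    (TopCat.Sheaf.pullback (ModuleCat.{u} A) g).mapDerivedCategory.obj (dA A Y) :=
  Q.map
      ((HomologicalComplex.single _ (ComplexShape.up ℤ) 0).map (constToPullback A X g) ≫
        (HomologicalComplex.singleMapHomologicalComplex
          (TopCat.Sheaf.pullback (ModuleCat.{u} A) g) (ComplexShape.up ℤ) 0).inv.app _) ≫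
    (TopCat.Sheaf.pullback (ModuleCat.{u} A) g).mapDerivedCategoryFactors.inv.app _

variable {g}

/-- The morphism of complexes `g⁻¹ L ⟶ K` adjoint to `L ⟶ g_* K`. -/
def adjCplx {K : CochainComplex (Shv A X) ℤ} {L : CochainComplex (Shv A Y) ℤ}
    (φ : L ⟶ ((TopCat.Sheaf.pushforward (ModuleCat.{u} A) g).mapHomologicalComplex
        (ComplexShape.up ℤ)).obj K) :
    ((TopCat.Sheaf.pullback (ModuleCat.{u} A) g).mapHomologicalComplex
      (ComplexShape.up ℤ)).obj L ⟶ K :=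
  ((TopCat.Sheaf.pullback (ModuleCat.{u} A) g).mapHomologicalComplex
    (ComplexShape.up ℤ)).map φ ≫ counitCplx g K

lemma adjCplx_naturality {K₁ K₂ : CochainComplex (Shv A X) ℤ} {L₁ L₂ : CochainComplex (Shv A Y) ℤ}
    (φ₁ : L₁ ⟶ ((TopCat.Sheaf.pushforward (ModuleCat.{u} A) g).mapHomologicalComplex
        (ComplexShape.up ℤ)).obj K₁)
    (φ₂ : L₂ ⟶ ((TopCat.Sheaf.pushforward (ModuleCat.{u} A) g).mapHomologicalComplex
        (ComplexShape.up ℤ)).obj K₂) (a : L₁ ⟶ L₂) (b : K₁ ⟶ K₂)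
    (h : a ≫ φ₂ = φ₁ ≫ ((TopCat.Sheaf.pushforward (ModuleCat.{u} A) g).mapHomologicalComplex
        (ComplexShape.up ℤ)).map b) :
    ((TopCat.Sheaf.pullback (ModuleCat.{u} A) g).mapHomologicalComplex
      (ComplexShape.up ℤ)).map a ≫ adjCplx φ₂ = adjCplx φ₁ ≫ b := by
  have h1 : ((TopCat.Sheaf.pullback (ModuleCat.{u} A) g).mapHomologicalComplex
      (ComplexShape.up ℤ)).map (((TopCat.Sheaf.pushforward (ModuleCat.{u} A) g).mapHomologicalComplex
        (ComplexShape.up ℤ)).map b) ≫ counitCplx g K₂ = counitCplx g K₁ ≫ b := by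
    ext1 i
    exact (TopCat.Sheaf.pullbackPushforwardAdjunction (ModuleCat.{u} A) g).counit.naturality (b.f i)
  rw [adjCplx, adjCplx, ← Functor.map_comp_assoc, h, Functor.map_comp_assoc, h1, Category.assoc]

/-- The second part of the pullback on hypercohomology. -/
def hypTgt {K : CochainComplex (Shv A X) ℤ} {L : CochainComplex (Shv A Y) ℤ}
    (φ : L ⟶ ((TopCat.Sheaf.pushforward (ModuleCat.{u} A) g).mapHomologicalComplex
        (ComplexShape.up ℤ)).obj K) :
    (TopCat.Sheaf.pullback (ModuleCat.{u} A) g).mapDerivedCategory.obj (Q.obj L) ⟶ Q.obj K :=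
  (TopCat.Sheaf.pullback (ModuleCat.{u} A) g).mapDerivedCategoryFactors.hom.app _ ≫
    Q.map (adjCplx (A := A) (X := X) (Y := Y) (g := g) (K := K) (L := L) φ)

lemma hypPullback_eq {K : CochainComplex (Shv A X) ℤ} {L : CochainComplex (Shv A Y) ℤ}
    (φ : L ⟶ ((TopCat.Sheaf.pushforward (ModuleCat.{u} A) g).mapHomologicalComplex
        (ComplexShape.up ℤ)).obj K) {i : ℕ} (x : Hyp L i) :
    hypPullback g φ x = hypSrc g ≫ shMap (ShiftedHom.map x
      (TopCat.Sheaf.pullback (ModuleCat.{u} A) g).mapDerivedCategory) (hypTgt φ) := rfl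

/-- The pullback on hypercohomology is linear. -/
def hypPullbackₗ {K : CochainComplex (Shv A X) ℤ} {L : CochainComplex (Shv A Y) ℤ}
    (φ : L ⟶ ((TopCat.Sheaf.pushforward (ModuleCat.{u} A) g).mapHomologicalComplex
        (ComplexShape.up ℤ)).obj K) (i : ℕ) : Hyp L i →ₗ[A] Hyp K i where
  toFun := hypPullback g φ
  map_add' x y := by
    rw [hypPullback_eq, hypPullback_eq, hypPullback_eq, ShiftedHom.map_add, shMap,
      Preadditive.add_comp, Preadditive.comp_add]
  map_smul' a x := by
    rw [hypPullback_eq, hypPullback_eq, ShiftedHom.map_smul, shMap,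
      Linear.smul_comp, Linear.comp_smul]
    rfl

lemma hypTgt_naturality {K₁ K₂ : CochainComplex (Shv A X) ℤ} {L₁ L₂ : CochainComplex (Shv A Y) ℤ}
    (φ₁ : L₁ ⟶ ((TopCat.Sheaf.pushforward (ModuleCat.{u} A) g).mapHomologicalComplex
        (ComplexShape.up ℤ)).obj K₁)
    (φ₂ : L₂ ⟶ ((TopCat.Sheaf.pushforward (ModuleCat.{u} A) g).mapHomologicalComplex
        (ComplexShape.up ℤ)).obj K₂) (a : L₁ ⟶ L₂) (b : K₁ ⟶ K₂)
    (h : a ≫ φ₂ = φ₁ ≫ ((TopCat.Sheaf.pushforward (ModuleCat.{u} A) g).mapHomologicalComplex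
        (ComplexShape.up ℤ)).map b) :
    (TopCat.Sheaf.pullback (ModuleCat.{u} A) g).mapDerivedCategory.map (Q.map a) ≫ hypTgt φ₂ =
      hypTgt φ₁ ≫ Q.map b := by
  rw [hypTgt, hypTgt, Functor.mapDerivedCategoryFactors_hom_naturality_assoc, ← Functor.map_comp,
    adjCplx_naturality φ₁ φ₂ a b h, Functor.map_comp, Category.assoc]

lemma hypPullback_map {K₁ K₂ : CochainComplex (Shv A X) ℤ} {L₁ L₂ : CochainComplex (Shv A Y) ℤ}
    (φ₁ : L₁ ⟶ ((TopCat.Sheaf.pushforward (ModuleCat.{u} A) g).mapHomologicalComplex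
        (ComplexShape.up ℤ)).obj K₁)
    (φ₂ : L₂ ⟶ ((TopCat.Sheaf.pushforward (ModuleCat.{u} A) g).mapHomologicalComplex
        (ComplexShape.up ℤ)).obj K₂) (a : L₁ ⟶ L₂) (b : K₁ ⟶ K₂)
    (h : a ≫ φ₂ = φ₁ ≫ ((TopCat.Sheaf.pushforward (ModuleCat.{u} A) g).mapHomologicalComplex
        (ComplexShape.up ℤ)).map b) {i : ℕ} (x : Hyp L₁ i) :
    hypPullback g φ₂ (Hyp.map a x) = Hyp.map b (hypPullback g φ₁ x) := by
  rw [hypPullback_eq, hypPullback_eq, Hyp.map, Hyp.map, ← ShiftedHom.comp_mk₀ _ 0 rfl,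
    ShiftedHom.map_comp, ShiftedHom.map_mk₀, ShiftedHom.comp_mk₀, shMap, shMap, Category.assoc,
    ← Functor.map_comp, hypTgt_naturality φ₁ φ₂ a b h, Functor.map_comp, Category.assoc,
    Category.assoc]

/-- The adjoints `g⁻¹ E' ⟶ E` of the three given maps form a morphism of short exact sequences,
since `g⁻¹` is exact. So the claim combines the compatibility of connecting morphisms with exact
functors and their naturality. -/
lemma hypPullback_connecting {E : ShortComplex (CochainComplex (Shv A X) ℤ)}
    {E' : ShortComplex (CochainComplex (Shv A Y) ℤ)} (hE : E.ShortExact) (hE' : E'.ShortExact)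
    (φ₁ : E'.X₁ ⟶ ((TopCat.Sheaf.pushforward (ModuleCat.{u} A) g).mapHomologicalComplex
        (ComplexShape.up ℤ)).obj E.X₁)
    (φ₂ : E'.X₂ ⟶ ((TopCat.Sheaf.pushforward (ModuleCat.{u} A) g).mapHomologicalComplex
        (ComplexShape.up ℤ)).obj E.X₂)
    (φ₃ : E'.X₃ ⟶ ((TopCat.Sheaf.pushforward (ModuleCat.{u} A) g).mapHomologicalComplex
        (ComplexShape.up ℤ)).obj E.X₃)
    (h₁ : E'.f ≫ φ₂ = φ₁ ≫ ((TopCat.Sheaf.pushforward (ModuleCat.{u} A) g).mapHomologicalComplex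
        (ComplexShape.up ℤ)).map E.f)
    (h₂ : E'.g ≫ φ₃ = φ₂ ≫ ((TopCat.Sheaf.pushforward (ModuleCat.{u} A) g).mapHomologicalComplex
        (ComplexShape.up ℤ)).map E.g) {i : ℕ} (x : Hyp E'.X₃ i) :
    hypPullback g φ₁ (Hyp.connecting hE' x) = Hyp.connecting hE (hypPullback g φ₃ x) := by
  let F := TopCat.Sheaf.pullback (ModuleCat.{u} A) g
  let ψ : E'.map (F.mapHomologicalComplex (ComplexShape.up ℤ)) ⟶ E :=
    { τ₁ := adjCplx φ₁
      τ₂ := adjCplx φ₂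
      τ₃ := adjCplx φ₃
      comm₁₂ := (adjCplx_naturality φ₁ φ₂ _ _ h₁).symm
      comm₂₃ := (adjCplx_naturality φ₂ φ₃ _ _ h₂).symm }
  have key : ShiftedHom.map (a := (1 : ℤ)) (triangleOfSESδ hE') F.mapDerivedCategory ≫
      (hypTgt φ₁)⟦(1 : ℤ)⟧' = hypTgt φ₃ ≫ triangleOfSESδ hE := by
    have h := DerivedCategory.map_triangleOfSESδ F hE'
    have n := triangleOfSESδ_naturality (hE'.map_of_exact
      (F.mapHomologicalComplex (ComplexShape.up ℤ))) hE ψ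
    rw [hypTgt, hypTgt, Functor.map_comp]
    exact comp_cancel_of_eq h (Iso.inv_hom_id_app _ _)
      ((Functor.map_comp _ _ _).symm.trans
        ((congrArg _ (Iso.inv_hom_id_app _ _)).trans (CategoryTheory.Functor.map_id _ _))) n
  rw [hypPullback_eq, hypPullback_eq, Hyp.connecting, Hyp.connecting, ShiftedHom.map_comp]
  exact shMap_comp_eq _ _ _ _ _ _ key _

end Pullback

/-! ### Restriction and gluing of sections of modules -/

section Restriction
variable {X Y : Scheme.{u}}

/-- Restriction of functions. -/
def rres {U V : X.Opens} (h : V ≤ U) : Γ(X, U) →+* Γ(X, V) := (X.presheaf.map (homOfLE h).op).hom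

/-- Restriction of sections of a module. -/
def mres (M : X.Modules) {U V : X.Opens} (h : V ≤ U) : Γ(M, U) →+ Γ(M, V) :=
  (M.presheaf.map (homOfLE h).op).hom

lemma rres_rres {U V W : X.Opens} (h : V ≤ U) (h' : W ≤ V) (r : Γ(X, U)) :
    rres h' (rres h r) = rres (h'.trans h) r :=
  congr(($(X.presheaf.map_comp (homOfLE h).op (homOfLE h').op)).hom r).symm

lemma rres_self {U : X.Opens} (h : U ≤ U) (r : Γ(X, U)) : rres h r = r :=
  congr(($(X.presheaf.map_id (op U))).hom r)

lemma mres_mres (M : X.Modules) {U V W : X.Opens} (h : V ≤ U) (h' : W ≤ V) (s : Γ(M, U)) :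
    mres M h' (mres M h s) = mres M (h'.trans h) s :=
  congr(($(M.presheaf.map_comp (homOfLE h).op (homOfLE h').op)).hom s).symm

lemma mres_self (M : X.Modules) {U : X.Opens} (h : U ≤ U) (s : Γ(M, U)) : mres M h s = s :=
  congr(($(M.presheaf.map_id (op U))).hom s)

lemma mres_smul (M : X.Modules) {U V : X.Opens} (h : V ≤ U) (r : Γ(X, U)) (s : Γ(M, U)) :
    mres M h (r • s) = rres h r • mres M h s :=
  M.map_smul (homOfLE h) r s

lemma app_mres {M N : X.Modules} (f : M ⟶ N) {U V : X.Opens} (h : V ≤ U) (s : Γ(M, U)) :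
    f.app V (mres M h s) = mres N h (f.app U s) :=
  congr(($(f.mapPresheaf.naturality (homOfLE h).op)).hom s)

lemma mres_bijective_of_eq (M : X.Modules) {U V : X.Opens} (e : V = U) :
    Function.Bijective (mres M e.le) := by
  subst e
  exact ⟨fun a b h => by rwa [mres_self, mres_self] at h, fun a => ⟨a, mres_self _ _ _⟩⟩

lemma mres_eq_of_cover (M : X.Modules) {ι : Type*} {U : X.Opens} (V : ι → X.Opens)
    (hV : ∀ i, V i ≤ U) (hU : U ≤ ⨆ i, V i) (s t : Γ(M, U))
    (h : ∀ i, mres M (hV i) s = mres M (hV i) t) : s = t := by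
  refine TopCat.Presheaf.IsSheaf.section_ext M.isSheaf fun x hx => ?_
  obtain ⟨i, hi⟩ := Opens.mem_iSup.1 (hU hx)
  exact ⟨V i, hV i, hi, h i⟩

lemma mres_glue (M : X.Modules) {ι : Type u} {U : X.Opens} (V : ι → X.Opens)
    (hV : ∀ i, V i ≤ U) (hU : U ≤ ⨆ i, V i) (s : ∀ i, Γ(M, V i))
    (h : ∀ i j, mres M (inf_le_left : V i ⊓ V j ≤ V i) (s i) =
      mres M (inf_le_right : V i ⊓ V j ≤ V j) (s j)) :
    ∃ t : Γ(M, U), ∀ i, mres M (hV i) t = s i := by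
  obtain ⟨t, ht, -⟩ := TopCat.Sheaf.existsUnique_gluing' ⟨M.presheaf, M.isSheaf⟩ V U
    (fun i => homOfLE (hV i)) hU s h
  exact ⟨t, ht⟩

end Restriction

/-! ### Quasi-coherence through localization of sections -/

section Localizing
variable {X Y : Scheme.{u}}

lemma fromSpec_ring {U : X.Opens} (hU : IsAffineOpen U) (V : (Spec Γ(X, U)).Opens)
    (h : hU.fromSpec ''ᵁ V ≤ U) (r : Γ(X, U)) :
    (hU.fromSpec.appIso V).inv ((Spec Γ(X, U)).presheaf.map V.leTop.op
      ((Scheme.ΓSpecIso Γ(X, U)).inv r)) = rres h r := by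
  have e : (Scheme.ΓSpecIso Γ(X, U)).inv ≫ (Spec Γ(X, U)).presheaf.map V.leTop.op ≫
      (hU.fromSpec.appIso V).inv = X.presheaf.map (homOfLE h).op := by
    rw [← Category.assoc, Iso.comp_inv_eq, Scheme.Hom.appIso_hom, Scheme.Hom.naturality_assoc,
      hU.fromSpec_app_self, Category.assoc, ← Functor.map_comp, ← Functor.map_comp]
    rfl
  exact congr(($e).hom r)

lemma fromSpec_smul {U : X.Opens} (hU : IsAffineOpen U) (M : X.Modules) (V : (Spec Γ(X, U)).Opens)
    (h : hU.fromSpec ''ᵁ V ≤ U) (r : Γ(X, U)) (s : Γ(M.restrict hU.fromSpec, V)) :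
    r • s = (rres h r • (show Γ(M, hU.fromSpec ''ᵁ V) from s) : Γ(M, hU.fromSpec ''ᵁ V)) :=
  congrArg (· • (show Γ(M, hU.fromSpec ''ᵁ V) from s)) (fromSpec_ring hU V h r)

/-- For `f : Γ(X, U)` and `V ⊆ U`, the restriction `Γ(M, U) → Γ(M, V)` has the properties of the
localization at the powers of `f`. -/
def LocAt (M : X.Modules) {U V : X.Opens} (h : V ≤ U) (f : Γ(X, U)) : Prop :=
  (∀ s : Γ(M, U), mres M h s = 0 → ∃ n : ℕ, f ^ n • s = 0) ∧
    ∀ t : Γ(M, V), ∃ (n : ℕ) (s : Γ(M, U)), mres M h s = rres h f ^ n • t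

lemma locAt_congr (M : X.Modules) {U V U' V' : X.Opens} (h : V ≤ U) (f : Γ(X, U)) (eU : U' = U)
    (eV : V' = V) (h' : V' ≤ U') : LocAt M h' (rres eU.le f) ↔ LocAt M h f := by
  subst eU eV
  rw [rres_self]

/-- The invertibility of `f` on sections over the basic open set is automatic, so only the kernel
and the denominators are left as conditions. Stating them on `X` itself avoids transporting sections
to `Spec Γ(X, U)` later on. -/
lemma locAt_iff_isLocalizedModule {U : X.Opens} (hU : IsAffineOpen U) (M : X.Modules)
    (f : Γ(X, U)) : LocAt M (X.basicOpen_le f) f ↔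
      IsLocalizedModule (.powers f) ((modulesSpecToSheaf.obj (M.restrict hU.fromSpec)).obj.map
        (PrimeSpectrum.basicOpen f).leTop.op).hom := by
  have eU : hU.fromSpec ''ᵁ ⊤ = U := by
    rw [Scheme.Hom.image_top_eq_opensRange, hU.opensRange_fromSpec]
  have eV : hU.fromSpec ''ᵁ PrimeSpectrum.basicOpen f = X.basicOpen f :=
    hU.fromSpec_image_basicOpen f
  have hle : hU.fromSpec ''ᵁ PrimeSpectrum.basicOpen f ≤ hU.fromSpec ''ᵁ ⊤ :=
    Scheme.Hom.image_mono _ le_top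
  rw [← locAt_congr M (X.basicOpen_le f) f eU eV hle]
  let N := M.restrict hU.fromSpec
  let D : (Spec Γ(X, U)).Opens := PrimeSpectrum.basicOpen f
  have e1 (n : ℕ) (s : Γ(M, hU.fromSpec ''ᵁ ⊤)) :
      (rres eU.le f) ^ n • s = (f ^ n • (show Γ(N, ⊤) from s) : Γ(N, ⊤)) := by
    rw [← map_pow]
    exact (fromSpec_smul hU M ⊤ eU.le (f ^ n) s).symm
  have e2 (n : ℕ) (s : Γ(M, hU.fromSpec ''ᵁ PrimeSpectrum.basicOpen f)) :
      (rres hle (rres eU.le f)) ^ n • s =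
        (f ^ n • (show Γ(N, D) from s) : Γ(N, D)) := by
    rw [rres_rres, ← map_pow]
    exact (fromSpec_smul hU M _ (hle.trans eU.le) (f ^ n) s).symm
  let L := ((modulesSpecToSheaf.obj N).obj.map (PrimeSpectrum.basicOpen f).leTop.op).hom
  have eL (s : Γ(N, ⊤)) : L s = mres M hle s := rfl
  constructor
  · rintro ⟨h1, h2⟩
    refine ⟨?_, ?_, ?_⟩
    · rintro ⟨x, n, rfl⟩
      change IsUnit (algebraMap _ _ (f ^ n))
      rw [map_pow]
      exact (N.isUnit_algebraMap_end_of_le_basicOpen f le_rfl).pow n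
    · intro y
      obtain ⟨n, s, hs⟩ := h2 y
      exact ⟨(s, ⟨f ^ n, n, rfl⟩), (e2 n y).symm.trans hs.symm⟩
    · intro x y hxy
      obtain ⟨n, hn⟩ := h1 (x - y) (by
        refine (map_sub (mres M hle) x y).trans (sub_eq_zero.2 hxy))
      refine ⟨⟨f ^ n, n, rfl⟩, ?_⟩
      rw [e1 n (x - y)] at hn
      exact sub_eq_zero.1 ((smul_sub (f ^ n) _ _).symm.trans hn)
  · intro h
    constructor
    · intro s hs
      obtain ⟨⟨_, n, rfl⟩, hc⟩ := h.exists_of_eq (x₁ := s) (x₂ := 0)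
        (hs.trans (map_zero L).symm)
      exact ⟨n, (e1 n s).trans (hc.trans (smul_zero _))⟩
    · intro t
      obtain ⟨⟨s, ⟨_, n, rfl⟩⟩, hs⟩ := h.surj t
      exact ⟨n, s, hs.symm.trans (e2 n t).symm⟩

lemma qcoh_iff_locAt (M : X.Modules) :
    qcoh X M ↔ ∀ (U : X.Opens) (_ : IsAffineOpen U) (f : Γ(X, U)),
      LocAt M (X.basicOpen_le f) f := by
  constructor
  · intro h U hU f
    exact (locAt_iff_isLocalizedModule hU M f).2
      ((qcoh_iff_localizing _).1 (qcoh_restrict hU.fromSpec M h) f)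
  · intro h
    refine qcoh_of_affine M fun U hU => (qcoh_iff_localizing _).2 fun f => ?_
    exact (locAt_iff_isLocalizedModule hU M f).1 (h U hU f)

/-- The preimages of an affine `U` and of the basic open of `f` are an affine open and the basic
open of the pulled back function, so the criterion over `U` is the criterion for `M` over the
preimage. -/
lemma qcoh_pushforward (g : Y ⟶ X) [IsAffineHom g] {M : Y.Modules} (hM : qcoh Y M) :
    qcoh X ((Scheme.Modules.pushforward g).obj M) := by
  rw [qcoh_iff_locAt]
  intro U hU f
  have h := (qcoh_iff_locAt M).1 hM (g ⁻¹ᵁ U) (hU.preimage g) (g.app U f)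
  have e : g ⁻¹ᵁ X.basicOpen f = Y.basicOpen (g.app U f) := Scheme.preimage_basicOpen g f
  have h' := (locAt_congr M (Y.basicOpen_le _) (g.app U f) rfl e
    (fun x hx => X.basicOpen_le f hx)).2 h
  rw [rres_self] at h'
  constructor
  · intro s hs
    obtain ⟨n, hn⟩ := h'.1 s hs
    refine ⟨n, ?_⟩
    rw [← map_pow (g.app U).hom] at hn
    exact hn
  · intro t
    obtain ⟨n, s, hs⟩ := h'.2 t
    refine ⟨n, s, ?_⟩
    have : rres (fun x hx => X.basicOpen_le f hx : g ⁻¹ᵁ X.basicOpen f ≤ g ⁻¹ᵁ U) (g.app U f) =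
        (g.app (X.basicOpen f)) (rres (X.basicOpen_le f) f) :=
      congr(($(g.naturality (homOfLE (X.basicOpen_le f)).op)).hom f).symm
    rw [this, ← map_pow (g.app (X.basicOpen f)).hom] at hs
    exact hs

end Localizing

/-! ### Sections over affine opens as an exact functor on quasi-coherent modules -/

section AffineSections
universe v w
variable {X Y : Scheme.{u}}

/-- The sections over `U` as a functor to `Γ(X, U)`-modules. -/
def secU (U : X.Opens) : X.Modules ⥤ ModuleCat.{u} Γ(X, U) where
  obj M := ModuleCat.of Γ(X, U) Γ(M, U)
  map {M N} f := ModuleCat.ofHom (X := Γ(M, U)) (Y := Γ(N, U))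
    { toFun := f.app U
      map_add' := map_add (f.app U).hom
      map_smul' := fun r s => f.app_smul r s }

/-- Sections over an affine open subset `U` in terms of the restriction to `Spec Γ(X, U)`. -/
def secAffineIso {U : X.Opens} (hU : IsAffineOpen U) :
    Scheme.Modules.restrictFunctor hU.fromSpec ⋙ moduleSpecΓFunctor ≅ secU U :=
  have eU : hU.fromSpec ''ᵁ ⊤ = U := by
    rw [Scheme.Hom.image_top_eq_opensRange, hU.opensRange_fromSpec]
  Iso.symm <| NatIso.ofComponents (fun M => LinearEquiv.toModuleIso
    (X₁ := Γ(M, U)) (X₂ := moduleSpecΓFunctor.obj (M.restrict hU.fromSpec))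
    (LinearEquiv.ofBijective
      { toFun := fun s => show moduleSpecΓFunctor.obj (M.restrict hU.fromSpec) from mres M eU.le s
        map_add' := map_add (mres M eU.le)
        map_smul' := fun r s =>
          (mres_smul M eU.le r s).trans (fromSpec_smul hU M ⊤ eU.le r _).symm }
      (mres_bijective_of_eq M eU))) (fun {M N} f => by
        ext s
        exact (app_mres f eU.le s).symm)

/-- The functor `tilde.functor R` is fully faithful, hence reflects colimits, and applied to the
global sections of quasi-coherent modules it gives back the original cocone. -/
lemma nonempty_isColimit_spec {R : CommRingCat.{u}} {J : Type w} [Category.{v} J]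
    {F : J ⥤ (Spec R).Modules} (hF : ∀ j, qcoh _ (F.obj j)) {c : Cocone F} (hc : IsColimit c)
    (hq : qcoh _ c.pt) : Nonempty (IsColimit (moduleSpecΓFunctor.mapCocone c)) := by
  let e : (F ⋙ moduleSpecΓFunctor) ⋙ tilde.functor R ≅ F :=
    NatIso.ofComponents (fun j => @asIso _ _ _ _ (Scheme.Modules.fromTildeΓ (F.obj j))
      ((qcoh_spec_iff _).1 (hF j)))
      (fun f => tilde.adjunction (R := R).counit.naturality (F.map f))
  have hi : IsIso c.pt.fromTildeΓ := (qcoh_spec_iff _).1 hq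
  have := fullyFaithful_reflectsColimits.{v, w} (tilde.functor R)
  refine ⟨isColimitOfReflects (tilde.functor R) ?_⟩
  refine (IsColimit.equivOfNatIsoOfIso e
    ((tilde.functor R).mapCocone (moduleSpecΓFunctor.mapCocone c)) c
      (Cocone.ext (@asIso _ _ _ _ (Scheme.Modules.fromTildeΓ c.pt) hi) fun j => ?_)).symm hc
  have h := tilde.adjunction (R := R).counit.naturality (c.ι.app j)
  have h1 : e.inv.app j ≫ Scheme.Modules.fromTildeΓ (F.obj j) = 𝟙 _ := e.inv_hom_id_app j
  refine (Category.assoc _ _ _).trans ((congrArg (e.inv.app j ≫ ·) h).trans ?_)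
  exact (Category.assoc _ _ _).symm.trans
    ((congrArg (· ≫ c.ι.app j) h1).trans (Category.id_comp _))

/-- The sections over an affine open subset commute with colimits of quasi-coherent modules. -/
lemma nonempty_isColimit_secU {J : Type w} [Category.{v} J] {F : J ⥤ X.Modules}
    (hF : ∀ j, qcoh _ (F.obj j)) {c : Cocone F} (hc : IsColimit c) (hq : qcoh _ c.pt)
    {U : X.Opens} (hU : IsAffineOpen U) : Nonempty (IsColimit ((secU U).mapCocone c)) := by
  have := (Scheme.Modules.restrictAdjunction hU.fromSpec).leftAdjoint_preservesColimits.{v, w}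
  obtain ⟨h⟩ := nonempty_isColimit_spec (F := F ⋙ Scheme.Modules.restrictFunctor hU.fromSpec)
    (fun j => qcoh_restrict hU.fromSpec _ (hF j))
    (isColimitOfPreserves (Scheme.Modules.restrictFunctor hU.fromSpec) hc)
    (qcoh_restrict hU.fromSpec _ hq)
  exact ⟨IsColimit.mapCoconeEquiv (secAffineIso hU) h⟩

/-- A morphism is epi exactly when its cokernel pair is given by two identities, a statement about a
colimit of quasi-coherent modules, which sections over an affine open preserve. -/
lemma app_surjective_of_epi {M N : X.Modules} (f : M ⟶ N) [Epi f] (hM : qcoh _ M) (hN : qcoh _ N)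
    {U : X.Opens} (hU : IsAffineOpen U) : Function.Surjective (f.app U) := by
  have h0 : IsColimit (PushoutCocone.mk (𝟙 N) (𝟙 N) (f := f) (g := f) rfl) :=
    PushoutCocone.isColimitMkIdId f
  obtain ⟨h⟩ := nonempty_isColimit_secU (fun j => by
    rcases j with _ | _ | _
    exacts [hM, hN, hN]) h0 hN hU
  have h1 : Epi ((secU U).map f) := PushoutCocone.epi_of_isColimitMkIdId _
    ((isColimitMapCoconePushoutCoconeEquiv (secU U) rfl h).ofIsoColimit
      (PushoutCocone.ext (Iso.refl _)))
  exact (ModuleCat.epi_iff_surjective _).1 h1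

lemma eq_of_mres_affine {M : X.Modules} {U : X.Opens} {s t : Γ(M, U)}
    (h : ∀ (V : X.Opens) (hV : V ≤ U), IsAffineOpen V → mres M hV s = mres M hV t) : s = t := by
  refine TopCat.Presheaf.IsSheaf.section_ext M.isSheaf fun x hx => ?_
  obtain ⟨V, hV, hxV, hVU⟩ := exists_isAffineOpen_mem_and_subset (U := U) hx
  exact ⟨V, hVU, hxV, h V hVU hV⟩

lemma mono_of_app_injective {M N : X.Modules} (f : M ⟶ N)
    (h : ∀ U : X.Opens, IsAffineOpen U → Function.Injective (f.app U)) : Mono f := by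
  refine ⟨fun {K} a b hab => ?_⟩
  ext U s
  refine eq_of_mres_affine fun V hV hVa => h V hVa ?_
  rw [← app_mres a, ← app_mres b]
  exact congr((Scheme.Modules.Hom.app $hab V).hom (mres K hV s))

lemma app_injective_of_mono {M N : X.Modules} (f : M ⟶ N) [Mono f] (U : X.Opens) :
    Function.Injective (f.app U) := by
  refine (injective_iff_map_eq_zero (f.app U).hom).2 fun m hm => ?_
  obtain ⟨x, rfl⟩ := (kernel_sections (kernel.ι f) f (kernel.condition f)
    (kernelIsKernel f) U).2 m hm
  rw [kernel.ι_of_mono f]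
  rfl

end AffineSections

/-! ### Exactness of sheaves of modules in terms of sections -/

section SheafSections
variable {A : Type u} [CommRing A] {X : TopCat.{u}}

/-- The sections of a sheaf of `A`-modules. -/
abbrev Sec (F : Shv A X) (U : Opens X) : Type u := F.obj.obj (op U)

/-- Restriction of sections. -/
def sres (F : Shv A X) {U V : Opens X} (h : V ≤ U) : Sec F U →ₗ[A] Sec F V :=
  (F.obj.map (homOfLE h).op).hom

/-- The map on sections of a morphism of sheaves. -/
def sapp {F G : Shv A X} (f : F ⟶ G) (U : Opens X) : Sec F U →ₗ[A] Sec G U :=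
  (f.hom.app (op U)).hom

lemma sres_sres (F : Shv A X) {U V W : Opens X} (h : V ≤ U) (h' : W ≤ V) (s : Sec F U) :
    sres F h' (sres F h s) = sres F (h'.trans h) s :=
  congr(($(F.obj.map_comp (homOfLE h).op (homOfLE h').op)).hom s).symm

lemma sres_self (F : Shv A X) {U : Opens X} (h : U ≤ U) (s : Sec F U) : sres F h s = s :=
  congr(($(F.obj.map_id (op U))).hom s)

lemma sapp_sres {F G : Shv A X} (f : F ⟶ G) {U V : Opens X} (h : V ≤ U) (s : Sec F U) :
    sapp f V (sres F h s) = sres G h (sapp f U s) :=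
  congr(($(f.hom.naturality (homOfLE h).op)).hom s)

lemma sapp_comp {F G H : Shv A X} (f : F ⟶ G) (g : G ⟶ H) (U : Opens X) (s : Sec F U) :
    sapp (f ≫ g) U s = sapp g U (sapp f U s) := rfl

lemma shv_hom_ext {F G : Shv A X} {f g : F ⟶ G} (h : ∀ U s, sapp f U s = sapp g U s) : f = g :=
  Sheaf.hom_ext (NatTrans.ext (funext fun U => ModuleCat.hom_ext (LinearMap.ext (h U.unop))))

/-- Morphisms of sheaves from linear maps on sections. -/
def shvHom {F G : Shv A X} (f : ∀ U, Sec F U →ₗ[A] Sec G U)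
    (h : ∀ (U V : Opens X) (i : V ≤ U) (s : Sec F U), f V (sres F i s) = sres G i (f U s)) :
    F ⟶ G :=
  ⟨{ app U := ModuleCat.ofHom (f U.unop)
     naturality := fun U V i => by
      ext s
      exact h U.unop V.unop (leOfHom i.unop) s }⟩

lemma sec_ext (F : Shv A X) {ι : Type*} {U : Opens X} (V : ι → Opens X)
    (hV : ∀ i, V i ≤ U) (hU : U ≤ ⨆ i, V i) (s t : Sec F U)
    (h : ∀ i, sres F (hV i) s = sres F (hV i) t) : s = t := by
  refine TopCat.Presheaf.IsSheaf.section_ext F.property fun x hx => ?_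
  obtain ⟨i, hi⟩ := Opens.mem_iSup.1 (hU hx)
  exact ⟨V i, hV i, hi, h i⟩

lemma sec_glue (F : Shv A X) {ι : Type u} {U : Opens X} (V : ι → Opens X)
    (hV : ∀ i, V i ≤ U) (hU : U ≤ ⨆ i, V i) (s : ∀ i, Sec F (V i))
    (h : ∀ i j, sres F (inf_le_left : V i ⊓ V j ≤ V i) (s i) =
      sres F (inf_le_right : V i ⊓ V j ≤ V j) (s j)) :
    ∃ t : Sec F U, ∀ i, sres F (hV i) t = s i := by
  obtain ⟨t, ht, -⟩ := TopCat.Sheaf.existsUnique_gluing' F V U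
    (fun i => homOfLE (hV i)) hU s h
  exact ⟨t, ht⟩

lemma epi_iff_sapp {F G : Shv A X} (f : F ⟶ G) :
    Epi f ↔ ∀ (U : Opens X) (t : Sec G U), ∀ x ∈ U, ∃ (V : Opens X) (h : V ≤ U),
      (∃ s : Sec F V, sapp f V s = sres G h t) ∧ x ∈ V := by
  rw [← TopCat.Sheaf.isLocallySurjective_iff_epi]
  exact TopCat.Presheaf.isLocallySurjective_iff f.hom

/-- A morphism whose values on sections lie in a subsheaf factors through the subsheaf. -/
lemma exists_lift {F G W : Shv A X} (f : F ⟶ G) (hf : ∀ U, Function.Injective (sapp f U))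
    (k : W ⟶ G) (hk : ∀ U w, ∃ x, sapp f U x = sapp k U w) : ∃ l : W ⟶ F, l ≫ f = k := by
  choose l hl using hk
  refine ⟨shvHom (fun U =>
    { toFun := l U
      map_add' := fun x y => hf U ?_
      map_smul' := fun a x => hf U ?_ }) fun U V i s => hf V ?_, shv_hom_ext fun U s => ?_⟩
  · rw [map_add, hl, hl, hl, map_add]
  · rw [map_smul, hl, hl, map_smul]
    rfl
  · change sapp f V (l V _) = sapp f V (sres F i (l U s))
    rw [hl, sapp_sres, sapp_sres, hl]
  · exact hl U s

lemma mono_of_sapp_injective {F G : Shv A X} (f : F ⟶ G)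
    (hf : ∀ U, Function.Injective (sapp f U)) : Mono f :=
  ⟨fun _ _ h => shv_hom_ext fun U s => hf U (congr(sapp $h U s))⟩

/-- Sections are left exact, so a morphism killed by `E.g` lifts to `E.X₁` outright and the
refinement in the exactness criterion can be the identity. -/
lemma shortExact_of_sections {E : ShortComplex (Shv A X)}
    (hf : ∀ U, Function.Injective (sapp E.f U))
    (hfg : ∀ U y, sapp E.g U y = 0 → ∃ x, sapp E.f U x = y) (hg : Epi E.g) : E.ShortExact where
  mono_f := mono_of_sapp_injective _ hf
  epi_g := hg
  exact := by
    rw [ShortComplex.exact_iff_exact_up_to_refinements]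
    intro W k hk
    obtain ⟨l, hl⟩ := exists_lift E.f hf k fun U w => hfg U _ (congr(sapp $hk U w))
    exact ⟨W, 𝟙 W, inferInstance, l, by rw [Category.id_comp, hl]⟩

end SheafSections

/-! ### Free sheaves on open sets, which corepresent sections -/

section FreeSheaf
variable (A : Type u) [CommRing A] {X : TopCat.{u}}

/-- The free presheaf of `A`-modules on an open subset. -/
def freePsh : Opens X ⥤ ((Opens X)ᵒᵖ ⥤ ModuleCat.{u} A) :=
  yoneda ⋙ (Functor.whiskeringRight _ _ _).obj (ModuleCat.free A)

/-- The sheaf of `A`-modules which corepresents the sections over `U`. -/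
def fr (U : Opens X) : Shv A X :=
  (presheafToSheaf (Opens.grothendieckTopology X) (ModuleCat.{u} A)).obj ((freePsh A).obj U)

/-- The inclusion between free sheaves. -/
def frMap {U V : Opens X} (h : V ≤ U) : fr A V ⟶ fr A U :=
  (presheafToSheaf (Opens.grothendieckTopology X) (ModuleCat.{u} A)).map
    ((freePsh A).map (homOfLE h))

instance {U V : Opens X} (h : V ≤ U) : Mono (frMap A h) := by
  -- Injectivity is clear for the free presheaves, and sheafification preserves monomorphisms.
  have h1 : Mono ((freePsh A).map (homOfLE h)) := by
    refine @NatTrans.mono_of_mono_app _ _ _ _ _ _ _ fun W => ?_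
    rw [ModuleCat.mono_iff_injective]
    exact Finsupp.mapDomain_injective fun a b _ =>  Subsingleton.elim (α := W.unop ⟶ V) a b
  exact (presheafToSheaf (Opens.grothendieckTopology X) (ModuleCat.{u} A)).map_mono _

/-- Morphisms from the free sheaf on `U` are sections over `U`. -/
def frEquiv (U : Opens X) (F : Shv A X) : (fr A U ⟶ F) ≃ Sec F U :=
  ((sheafificationAdjunction (Opens.grothendieckTopology X) (ModuleCat.{u} A)).homEquiv _ _).trans
    ((((ModuleCat.adj A).whiskerRight (Opens X)ᵒᵖ).homEquiv (yoneda.obj U) F.obj).trans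
      yonedaEquiv)

variable {A}

lemma frEquiv_comp {U : Opens X} {F G : Shv A X} (φ : fr A U ⟶ F) (f : F ⟶ G) :
    frEquiv A U G (φ ≫ f) = sapp f U (frEquiv A U F φ) := by
  let e₁ := (sheafificationAdjunction (Opens.grothendieckTopology X) (ModuleCat.{u} A)).homEquiv
    ((freePsh A).obj U)
  let e₂ := ((ModuleCat.adj A).whiskerRight (Opens X)ᵒᵖ).homEquiv (yoneda.obj U)
  have h1 : e₁ G (φ ≫ f) = e₁ F φ ≫ f.hom := Adjunction.homEquiv_naturality_right _ _ _
  have h2 : e₂ G.obj (e₁ F φ ≫ f.hom) = e₂ F.obj (e₁ F φ) ≫ _ :=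
    Adjunction.homEquiv_naturality_right _ _ _
  exact congrArg yonedaEquiv ((congrArg (e₂ G.obj) h1).trans h2)

lemma frEquiv_frMap {U V : Opens X} (h : V ≤ U) {F : Shv A X} (φ : fr A U ⟶ F) :
    frEquiv A V F (frMap A h ≫ φ) = sres F h (frEquiv A U F φ) := by
  let adj := sheafificationAdjunction (Opens.grothendieckTopology X) (ModuleCat.{u} A)
  let adj' := (ModuleCat.adj A).whiskerRight (Opens X)ᵒᵖ
  have h1 : adj.homEquiv _ F (frMap A h ≫ φ) =
      (freePsh A).map (homOfLE h) ≫ adj.homEquiv _ F φ :=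
    Adjunction.homEquiv_naturality_left _ _ _
  have h2 : adj'.homEquiv (yoneda.obj V) F.obj ((freePsh A).map (homOfLE h) ≫ adj.homEquiv _ F φ) =
      yoneda.map (homOfLE h) ≫ adj'.homEquiv (yoneda.obj U) F.obj (adj.homEquiv _ F φ) :=
    Adjunction.homEquiv_naturality_left _ _ _
  exact (congrArg yonedaEquiv ((congrArg (adj'.homEquiv (yoneda.obj V) F.obj) h1).trans h2)).trans
    (yonedaEquiv_naturality _ _).symm

lemma sapp_injective {F G : Shv A X} (f : F ⟶ G) [Mono f] (U : Opens X) :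
    Function.Injective (sapp f U) := fun x y h => by
  apply (frEquiv A U F).symm.injective
  rw [← cancel_mono f]
  apply (frEquiv A U G).injective
  rw [frEquiv_comp, frEquiv_comp, Equiv.apply_symm_apply, Equiv.apply_symm_apply, h]

lemma exists_sapp_eq {E : ShortComplex (Shv A X)} (hE : E.Exact) [Mono E.f] {U : Opens X}
    (y : Sec E.X₂ U) (hy : sapp E.g U y = 0) : ∃ x, sapp E.f U x = y := by
  have h : (frEquiv A U _).symm y ≫ E.g = 0 := by
    apply (frEquiv A U _).injective
    rw [frEquiv_comp, Equiv.apply_symm_apply, hy, ← comp_zero (f := (frEquiv A U _).symm y),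
      frEquiv_comp]
    rfl
  refine ⟨frEquiv A U _ (hE.lift _ h), ?_⟩
  rw [← frEquiv_comp, ShortComplex.Exact.lift_f, Equiv.apply_symm_apply]

/-- Injective sheaves are flasque: a section over `V` is a map from the free sheaf on `V`, which is
a subsheaf of the one on `U`. -/
lemma sres_surjective_of_injective (J : Shv A X) [Injective J] {U V : Opens X} (h : V ≤ U) :
    Function.Surjective (sres J h) := fun y => by
  refine ⟨frEquiv A U J (Injective.factorThru ((frEquiv A V J).symm y) (frMap A h)), ?_⟩
  rw [← frEquiv_frMap, Injective.comp_factorThru, Equiv.apply_symm_apply]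

variable (A X) in
/-- The section `1` of the constant sheaf. -/
def constOne : Sec (constA A X) ⊤ :=
  ((constantSheafAdj (Opens.grothendieckTopology X)
    (ModuleCat.{u} A) (T := ⊤) isTerminalTop).unit.app (ModuleCat.of A A)).hom (1 : A)

lemma constHom_sapp {F : Shv A X} (s : Sec F ⊤) : sapp (constHom s) ⊤ (constOne A X) = s := by
  let adj := constantSheafAdj (Opens.grothendieckTopology X) (ModuleCat.{u} A) (T := ⊤)
    isTerminalTop
  have h := (adj.homEquiv (ModuleCat.of A A) F).apply_symm_apply
      (ModuleCat.ofHom (LinearMap.toSpanSingleton A (Sec F ⊤) s))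
  have h' := (adj.homEquiv_unit _ _ _).symm.trans h
  exact congr(($h').hom (1 : A)).trans (one_smul A s)

lemma constHom_surjective {F : Shv A X} (φ : constA A X ⟶ F) : ∃ s : Sec F ⊤, constHom s = φ := by
  let e := (constantSheafAdj (Opens.grothendieckTopology X) (ModuleCat.{u} A) (T := ⊤)
    isTerminalTop).homEquiv (ModuleCat.of A A) F
  refine ⟨(e φ).hom (1 : A), ?_⟩
  refine (Equiv.symm_apply_eq e).2 (ModuleCat.hom_ext (LinearMap.ext_ring ?_))
  exact one_smul A _

lemma constHom_injective {F : Shv A X} :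
    Function.Injective (constHom : Sec F ⊤ → (constA A X ⟶ F)) := fun s t h => by
  rw [← constHom_sapp s, h, constHom_sapp]

variable (A X) in
/-- The constant sheaf corepresents global sections. -/
def constIso : constA A X ≅ fr A (⊤ : Opens X) where
  hom := constHom (frEquiv A ⊤ _ (𝟙 _))
  inv := (frEquiv A ⊤ _).symm (constOne A X)
  hom_inv_id := by
    obtain ⟨s, hs⟩ := constHom_surjective (𝟙 (constA A X))
    have h := constHom_sapp s
    rw [hs] at h
    rw [constHom_comp]
    refine Eq.trans (congrArg constHom ?_) hs
    refine (frEquiv_comp _ _).symm.trans ?_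
    rw [Category.id_comp]
    exact (Equiv.apply_symm_apply _ _).trans h
  inv_hom_id := by
    apply (frEquiv A ⊤ _).injective
    rw [frEquiv_comp]
    exact (congrArg _ (Equiv.apply_symm_apply _ _)).trans (constHom_sapp _)

end FreeSheaf

/-! ### Sheaf cohomology on open sets as Ext from free sheaves -/

section Cohomology
variable {A : Type u} [CommRing A] {X : TopCat.{u}}
open Abelian

/-- The cohomology of a sheaf on an open subset. -/
abbrev Coh (U : Opens X) (F : Shv A X) (p : ℕ) : Type u := Ext.{u} (fr A U) F p

/-- Functoriality of cohomology in the sheaf. -/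
def cmap {U : Opens X} {F G : Shv A X} (f : F ⟶ G) {p : ℕ} (x : Coh U F p) : Coh U G p :=
  x.comp (Ext.mk₀ f) (add_zero p)

/-- Restriction of cohomology classes. -/
def cres {U V : Opens X} (h : V ≤ U) {F : Shv A X} {p : ℕ} (x : Coh U F p) : Coh V F p :=
  (Ext.mk₀ (frMap A h)).comp x (zero_add p)

/-- The connecting homomorphism in cohomology. -/
def cδ {E : ShortComplex (Shv A X)} (hE : E.ShortExact) {U : Opens X} {p : ℕ}
    (x : Coh U E.X₃ p) : Coh U E.X₁ (p + 1) := x.comp hE.extClass rfl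

/-- Cohomology in degree `0`. -/
def sec₀ {U : Opens X} {F : Shv A X} (s : Sec F U) : Coh U F 0 :=
  Ext.mk₀ ((frEquiv A U F).symm s)

lemma sec₀_surjective {U : Opens X} {F : Shv A X} (x : Coh U F 0) : ∃ s : Sec F U, sec₀ s = x := by
  obtain ⟨f, rfl⟩ := Ext.mk₀_bijective _ _ |>.2 x
  exact ⟨frEquiv A U F f, by rw [sec₀, Equiv.symm_apply_apply]⟩

lemma sec₀_injective {U : Opens X} {F : Shv A X} :
    Function.Injective (sec₀ : Sec F U → Coh U F 0) := fun _ _ h =>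
  (frEquiv A U F).symm.injective (Ext.mk₀_bijective _ _ |>.1 h)

lemma cmap_sec₀ {U : Opens X} {F G : Shv A X} (f : F ⟶ G) (s : Sec F U) :
    cmap f (sec₀ s) = sec₀ (sapp f U s) := by
  rw [cmap, sec₀, sec₀, Ext.mk₀_comp_mk₀]
  congr 1
  apply (frEquiv A U G).injective
  rw [frEquiv_comp, Equiv.apply_symm_apply, Equiv.apply_symm_apply]

lemma cres_sec₀ {U V : Opens X} (h : V ≤ U) {F : Shv A X} (s : Sec F U) :
    cres h (sec₀ s) = sec₀ (sres F h s) := by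
  rw [cres, sec₀, sec₀, Ext.mk₀_comp_mk₀]
  congr 1
  apply (frEquiv A V F).injective
  rw [frEquiv_frMap, Equiv.apply_symm_apply, Equiv.apply_symm_apply]

lemma frMap_comp {U V W : Opens X} (h : V ≤ U) (h' : W ≤ V) :
    frMap A h' ≫ frMap A h = frMap A (h'.trans h) := by
  refine (Functor.map_comp _ _ _).symm.trans (congrArg
    (presheafToSheaf (Opens.grothendieckTopology X) (ModuleCat.{u} A)).map ?_)
  exact ((freePsh A).map_comp _ _).symm

lemma cres_cres {U V W : Opens X} (h : V ≤ U) (h' : W ≤ V) {F : Shv A X} {p : ℕ} (x : Coh U F p) :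
    cres h' (cres h x) = cres (h'.trans h) x := by
  rw [cres, cres, cres, Ext.mk₀_comp_mk₀_assoc, frMap_comp]

lemma cmap_cmap {U : Opens X} {F G H : Shv A X} (f : F ⟶ G) (g : G ⟶ H) {p : ℕ} (x : Coh U F p) :
    cmap g (cmap f x) = cmap (f ≫ g) x := by
  rw [cmap, cmap, cmap, Ext.comp_assoc_of_third_deg_zero, Ext.mk₀_comp_mk₀]

lemma cres_cδ {U V : Opens X} (h : V ≤ U) {E : ShortComplex (Shv A X)} (hE : E.ShortExact) {p : ℕ}
    (x : Coh U E.X₃ p) : cres h (cδ hE x) = cδ hE (cres h x) := by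
  rw [cres, cδ, cres, cδ, Ext.comp_assoc _ _ _ (zero_add p) rfl (by lia)]

lemma cδ_naturality {U : Opens X} {E₁ E₂ : ShortComplex (Shv A X)} (h₁ : E₁.ShortExact)
    (h₂ : E₂.ShortExact) (φ : E₁ ⟶ E₂) {p : ℕ} (x : Coh U E₁.X₃ p) :
    cmap φ.τ₁ (cδ h₁ x) = cδ h₂ (cmap φ.τ₃ x) := by
  rw [cmap, cδ, cδ, cmap, Ext.comp_assoc_of_third_deg_zero, Ext.comp_assoc_of_second_deg_zero,
    ShortComplex.ShortExact.extClass_naturality h₁ h₂ φ]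

lemma cδ_cmap {U : Opens X} {E : ShortComplex (Shv A X)} (hE : E.ShortExact) {p : ℕ}
    (x : Coh U E.X₂ p) : cδ hE (cmap E.g x) = 0 := by
  rw [cδ, cmap, Ext.comp_assoc_of_second_deg_zero, ShortComplex.ShortExact.comp_extClass,
    Ext.comp_zero]

lemma cmap_zero {U : Opens X} {F G : Shv A X} (f : F ⟶ G) {p : ℕ} :
    cmap f (0 : Coh U F p) = 0 := Ext.zero_comp _ _ _ _ _

lemma cmap_sub {U : Opens X} {F G : Shv A X} (f : F ⟶ G) {p : ℕ} (x y : Coh U F p) :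
    cmap f (x - y) = cmap f x - cmap f y := by
  rw [cmap, cmap, cmap, sub_eq_add_neg, sub_eq_add_neg, Ext.add_comp, Ext.neg_comp]

lemma cδ_zero {U : Opens X} {E : ShortComplex (Shv A X)} (hE : E.ShortExact) {p : ℕ} :
    cδ hE (0 : Coh U E.X₃ p) = 0 := Ext.zero_comp _ _ _ _ _

lemma cres_zero {U V : Opens X} (h : V ≤ U) {F : Shv A X} {p : ℕ} :
    cres h (0 : Coh U F p) = 0 := Ext.comp_zero _ _ _ _ _

/-- The short exact sequence of a monomorphism. -/
abbrev cokSeq {F G : Shv A X} (f : F ⟶ G) : ShortComplex (Shv A X) :=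
  ShortComplex.mk f (cokernel.π f) (cokernel.condition f)

lemma cokSeq_shortExact {F G : Shv A X} (f : F ⟶ G) [Mono f] : (cokSeq f).ShortExact where
  exact := ShortComplex.exact_cokernel f

/-- The short exact sequence of an embedding into an injective sheaf. -/
abbrev injSeq (F : Shv A X) : ShortComplex (Shv A X) := cokSeq (Injective.ι F)

lemma injSeq_shortExact (F : Shv A X) : (injSeq F).ShortExact := cokSeq_shortExact _

/-- Dimension shifting; positive degree cohomology of the injective middle term vanishes. -/
lemma exists_cδ_injSeq {U : Opens X} {F : Shv A X} {p : ℕ} (x : Coh U F (p + 1)) :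
    ∃ q : Coh U (injSeq F).X₃ p, cδ (injSeq_shortExact F) q = x :=
  Ext.covariant_sequence_exact₁ _ (injSeq_shortExact F) x (Ext.eq_zero_of_injective _) rfl

lemma exists_of_cδ_eq_zero {U : Opens X} {E : ShortComplex (Shv A X)} (hE : E.ShortExact) {p : ℕ}
    (q : Coh U E.X₃ p) (h : cδ hE q = 0) : ∃ j : Coh U E.X₂ p, cmap E.g j = q :=
  Ext.covariant_sequence_exact₃ _ hE q rfl h

lemma exists_cδ_of_cmap_eq_zero {U : Opens X} {E : ShortComplex (Shv A X)} (hE : E.ShortExact)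
    {p : ℕ} (x : Coh U E.X₁ (p + 1)) (h : cmap E.f x = 0) : ∃ q : Coh U E.X₃ p, cδ hE q = x :=
  Ext.covariant_sequence_exact₁ _ hE x h rfl

/-- Cohomology classes of positive degree are locally trivial. -/
lemma exists_cres_eq_zero {p : ℕ} {U : Opens X} {F : Shv A X} (x : Coh U F (p + 1)) (a : X)
    (ha : a ∈ U) : ∃ (V : Opens X) (h : V ≤ U), a ∈ V ∧ cres h x = 0 := by
  induction p generalizing F with
  | zero =>
    obtain ⟨q, rfl⟩ := exists_cδ_injSeq x
    obtain ⟨t, rfl⟩ := sec₀_surjective q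
    -- A class of degree `1` is the obstruction to lifting a section of the quotient sheaf, and such
    -- a lift exists locally.
    obtain ⟨V, h, ⟨s, hs⟩, haV⟩ := (epi_iff_sapp (injSeq F).g).1 inferInstance U t a ha
    refine ⟨V, h, haV, ?_⟩
    rw [cres_cδ, cres_sec₀, ← hs, ← cmap_sec₀, cδ_cmap]
  | succ p ih =>
    obtain ⟨q, rfl⟩ := exists_cδ_injSeq x
    obtain ⟨V, h, haV, hq⟩ := ih q
    exact ⟨V, h, haV, by rw [cres_cδ, hq, cδ_zero]⟩

end Cohomology

/-! ### Vanishing of cohomology for sheaves whose sections extend -/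

section Flasque
variable {A : Type u} [CommRing A] {X : TopCat.{u}}

/-- Sections over open subsets of members of `B` extend to `X`. -/
def ExtendsFrom (B : Set (Opens X)) (G : Shv A X) : Prop :=
  ∀ V ∈ B, ∀ U ≤ V, Function.Surjective (sres G (le_top : U ≤ ⊤))

lemma sec_glue₂ (F : Shv A X) {U V : Opens X} (s : Sec F U) (t : Sec F V)
    (h : sres F (inf_le_left : U ⊓ V ≤ U) s = sres F inf_le_right t) :
    ∃ r : Sec F (U ⊔ V), sres F le_sup_left r = s ∧ sres F le_sup_right r = t := by
  let c : ULift.{u} Bool → Opens X := fun b => bif b.down then U else V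
  let d : ∀ b, Sec F (c b)
    | ⟨true⟩ => s
    | ⟨false⟩ => t
  have hle (b) : c b ≤ U ⊔ V := by
    rcases b with ⟨_ | _⟩
    exacts [le_sup_right, le_sup_left]
  obtain ⟨r, hr⟩ := sec_glue F c hle (sup_le (le_iSup c ⟨true⟩) (le_iSup c ⟨false⟩)) d (by
    rintro ⟨_ | _⟩ ⟨_ | _⟩
    · rfl
    · have := congrArg (sres F (inf_comm V U).le) h
      rw [sres_sres, sres_sres] at this
      exact this.symm
    · exact h
    · rfl)
  exact ⟨r, hr ⟨true⟩, hr ⟨false⟩⟩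

lemma sec_ext₂ (F : Shv A X) {U V : Opens X} (s t : Sec F (U ⊔ V))
    (h : sres F le_sup_left s = sres F le_sup_left t)
    (h' : sres F le_sup_right s = sres F le_sup_right t) : s = t := by
  refine sec_ext F (fun b : Bool => bif b then U else V) (fun b => ?_) (sup_le
    (le_iSup (fun b : Bool => bif b then U else V) true)
    (le_iSup (fun b : Bool => bif b then U else V) false)) s t fun b => ?_
  · cases b
    exacts [le_sup_right, le_sup_left]
  · cases b
    exacts [h', h]

/-- A lift of a section on an open subset. -/
structure PartialLift {F G : Shv A X} (g : F ⟶ G) {W : Opens X} (t : Sec G W) where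
  /-- The open subset. -/
  V : Opens X
  le : V ≤ W
  /-- The lift. -/
  s : Sec F V
  eq : sapp g V s = sres G le t

/-- Extension of partial lifts. -/
def PartialLift.Ext {F G : Shv A X} {g : F ⟶ G} {W : Opens X} {t : Sec G W}
    (p q : PartialLift g t) : Prop := ∃ h : p.V ≤ q.V, sres F h q.s = p.s

/-- Zorn's lemma: the lifts in a chain agree on overlaps and glue over the union of their domains.
-/
lemma PartialLift.exists_maximal {F G : Shv A X} (g : F ⟶ G) {W : Opens X} (t : Sec G W) :
    ∃ m : PartialLift g t, ∀ p, m.Ext p → p.Ext m := by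
  refine exists_maximal_of_chains_bounded (fun c hc => ?_) ?_
  · let V : c → Opens X := fun p => p.1.V
    have hcomp (p q : c) : sres F (inf_le_left : V p ⊓ V q ≤ _) p.1.s =
        sres F (inf_le_right : V p ⊓ V q ≤ _) q.1.s := by
      by_cases hpq : p.1 = q.1
      · obtain rfl : p = q := Subtype.ext hpq
        rfl
      rcases hc p.2 q.2 hpq with ⟨h1, h2⟩ | ⟨h1, h2⟩
      · rw [← h2, sres_sres]
      · rw [← h2, sres_sres]
    obtain ⟨s, hs⟩ := sec_glue F V (le_iSup V) le_rfl (fun p => p.1.s) hcomp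
    refine ⟨⟨iSup V, iSup_le fun p => p.1.le, s, ?_⟩, fun p hp =>
      ⟨le_iSup V ⟨p, hp⟩, hs ⟨p, hp⟩⟩⟩
    refine sec_ext G V (le_iSup V) le_rfl _ _ fun p => ?_
    rw [← sapp_sres, sres_sres, hs p]
    exact p.1.eq
  · rintro p q s ⟨h1, h2⟩ ⟨h3, h4⟩
    exact ⟨h1.trans h3, by rw [← h2, ← h4, sres_sres]⟩

/-- The classical argument for flasque sheaves. A maximal lift is enlarged at a point outside its
domain `V` by a local lift over a basic `V₂`, after correcting the latter by a section of `E.X₁`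
over `V ⊓ V₂`. As this set lies in `V₂`, extension from open subsets of members of the basis is
enough; full flasqueness is not needed. -/
lemma ExtendsFrom.exists_lift_section {B : Set (Opens X)} (hB : Opens.IsBasis B)
    {E : ShortComplex (Shv A X)} (hE : E.ShortExact) (h : ExtendsFrom B E.X₁) {W : Opens X}
    (t : Sec E.X₃ W) : ∃ s : Sec E.X₂ W, sapp E.g W s = t := by
  have := hE.mono_f
  obtain ⟨⟨V, hVW, s, hs⟩, hm⟩ := PartialLift.exists_maximal E.g t
  suffices hWV : W ≤ V by
    obtain rfl := le_antisymm hVW hWV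
    exact ⟨s, hs.trans (sres_self _ _ _)⟩
  intro x hx
  obtain ⟨V₁, h₁, ⟨s₁, hs₁⟩, hx₁⟩ := (epi_iff_sapp E.g).1 hE.epi_g W t x hx
  obtain ⟨V₂, hB₂, hx₂, h₂⟩ := Opens.isBasis_iff_nbhd.1 hB hx₁
  obtain ⟨s₂, hs₂⟩ : ∃ s₂, sapp E.g V₂ s₂ = sres _ (h₂.trans h₁) t :=
    ⟨sres _ h₂ s₁, by rw [sapp_sres, hs₁, sres_sres]⟩
  obtain ⟨d, hd⟩ := exists_sapp_eq hE.exact (U := V ⊓ V₂)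
    (sres _ inf_le_left s - sres _ inf_le_right s₂) (by
      rw [map_sub, sapp_sres, sapp_sres, hs, hs₂, sres_sres, sres_sres, sub_self])
  obtain ⟨e, rfl⟩ := h V₂ hB₂ (V ⊓ V₂) inf_le_right d
  obtain ⟨s', hs', hs''⟩ := sec_glue₂ E.X₂ s (s₂ + sapp E.f V₂ (sres _ le_top e)) (by
    rw [map_add, ← sapp_sres, sres_sres, hd, add_sub_cancel])
  have key := hm ⟨V ⊔ V₂, sup_le hVW (h₂.trans h₁), s', by
    apply sec_ext₂
    · rw [← sapp_sres, sres_sres, hs', hs]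
    · have h0 : sapp E.g V₂ (sapp E.f V₂ (sres _ le_top e)) = 0 := by
        rw [← sapp_comp, E.zero]
        rfl
      rw [← sapp_sres, sres_sres, hs'', map_add, h0, add_zero, hs₂]⟩ ⟨le_sup_left, hs'⟩
  exact key.1 (le_sup_right (a := V) hx₂)

/-- Lift the section to the flasque middle term, extend it there, and project; this carries
dimension shifting along an injective embedding. -/
lemma ExtendsFrom.quotient {B : Set (Opens X)} (hB : Opens.IsBasis B)
    {E : ShortComplex (Shv A X)} (hE : E.ShortExact) (h : ExtendsFrom B E.X₁)
    (h₂ : ∀ U : Opens X, Function.Surjective (sres E.X₂ (le_top : U ≤ ⊤))) :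
    ExtendsFrom B E.X₃ := by
  intro V hV U hU t
  obtain ⟨s, rfl⟩ := h.exists_lift_section hB hE t
  obtain ⟨s', rfl⟩ := h₂ U s
  exact ⟨sapp E.g ⊤ s', (sapp_sres _ _ _).symm⟩

/-- If sections over open subsets of the members of a basis extend to `X`, the cohomology
vanishes. -/
lemma ExtendsFrom.coh_eq_zero {B : Set (Opens X)} (hB : Opens.IsBasis B) {p : ℕ} {G : Shv A X}
    (h : ExtendsFrom B G) {W : Opens X} (x : Coh W G (p + 1)) : x = 0 := by
  induction p generalizing G with
  | zero =>
    obtain ⟨q, rfl⟩ := exists_cδ_injSeq x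
    obtain ⟨t, rfl⟩ := sec₀_surjective q
    obtain ⟨s, rfl⟩ := h.exists_lift_section hB (injSeq_shortExact G) t
    rw [← cmap_sec₀, cδ_cmap]
  | succ p ih =>
    obtain ⟨q, rfl⟩ := exists_cδ_injSeq x
    rw [ih (h.quotient hB (injSeq_shortExact G)
      fun U => sres_surjective_of_injective (Injective.under G) _) q, cδ_zero]

end Flasque

/-! ### Direct images from open sets and a Serre vanishing theorem -/

section OpenPushforward
variable {A : Type u} [CommRing A] {X : TopCat.{u}}

/-- The presheaf `V ↦ G(D ∩ V)`. -/
def gdPresheaf (D : Opens X) (G : Shv A X) : TopCat.Presheaf (ModuleCat.{u} A) X where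
  obj V := G.obj.obj (op (D ⊓ V.unop))
  map {V W} i := ModuleCat.ofHom (sres G (inf_le_inf_left D (leOfHom i.unop)))
  map_id V := by
    ext s
    exact sres_self G _ s
  map_comp i j := by
    ext s
    exact (sres_sres G _ _ s).symm

/-- The sheaf `V ↦ G(D ∩ V)`. -/
def gd (D : Opens X) (G : Shv A X) : Shv A X :=
  ⟨gdPresheaf D G, by
    refine (TopCat.Presheaf.isSheaf_iff_isSheafUniqueGluing _).2 fun ι U sf hsf => ?_
    have hcov : D ⊓ iSup U ≤ ⨆ i, D ⊓ U i := by rw [inf_iSup_eq]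
    have hle (i) : D ⊓ U i ≤ D ⊓ iSup U := inf_le_inf_left D (le_iSup U i)
    obtain ⟨t, ht⟩ := sec_glue G (fun i => D ⊓ U i) hle hcov sf (fun i j => by
      have h := congrArg (sres G (le_inf (inf_le_left.trans inf_le_left)
        (inf_le_inf inf_le_right inf_le_right) : (D ⊓ U i) ⊓ (D ⊓ U j) ≤ D ⊓ (U i ⊓ U j)))
        (hsf i j)
      exact (sres_sres G _ _ _).symm.trans (h.trans (sres_sres G _ _ _)))
    exact ⟨t, ht, fun s hs => sec_ext G (fun i => D ⊓ U i) hle hcov s t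
      fun i => (hs i).trans (ht i).symm⟩⟩

/-- Functoriality of `gd`. -/
def gdMap (D : Opens X) {F G : Shv A X} (f : F ⟶ G) : gd D F ⟶ gd D G :=
  shvHom (F := gd D F) (G := gd D G) (fun U => sapp f (D ⊓ U)) fun _ _ _ s => sapp_sres f _ s

/-- The restriction map `G ⟶ gd D G`. -/
def toGd (D : Opens X) (G : Shv A X) : G ⟶ gd D G :=
  shvHom (F := G) (G := gd D G) (fun _ => sres G inf_le_right) fun _ _ _ s =>
    (sres_sres G _ _ s).trans (sres_sres G _ _ s).symm

lemma toGd_naturality (D : Opens X) {F G : Shv A X} (f : F ⟶ G) :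
    toGd D F ≫ gdMap D f = f ≫ toGd D G :=
  shv_hom_ext fun _ s => sapp_sres f _ s

lemma gdMap_zero (D : Opens X) (F G : Shv A X) : gdMap D (0 : F ⟶ G) = 0 :=
  shv_hom_ext fun _ _ => rfl

lemma gdMap_comp (D : Opens X) {F G H : Shv A X} (f : F ⟶ G) (g : G ⟶ H) :
    gdMap D (f ≫ g) = gdMap D f ≫ gdMap D g := rfl

instance (D : Opens X) {F G : Shv A X} (f : F ⟶ G) [Mono f] : Mono (gdMap D f) :=
  mono_of_sapp_injective _ fun U => sapp_injective f (D ⊓ U)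

lemma gdMap_injSeq (D : Opens X) (G : Shv A X) :
    gdMap D (injSeq G).f ≫ gdMap D (injSeq G).g = 0 := by
  rw [← gdMap_comp, (injSeq G).zero, gdMap_zero]

/-- The image of the sequence `injSeq G` under `gd D`, with the third term replaced by the
cokernel. -/
abbrev gdSeq (D : Opens X) (G : Shv A X) : ShortComplex (Shv A X) := cokSeq (gdMap D (injSeq G).f)

lemma gdSeq_shortExact (D : Opens X) (G : Shv A X) : (gdSeq D G).ShortExact := cokSeq_shortExact _

/-- The map of sequences induced by `toGd`. -/
def toGdSeq (D : Opens X) (G : Shv A X) : injSeq G ⟶ gdSeq D G where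
  τ₁ := toGd D G
  τ₂ := toGd D _
  τ₃ := cokernel.desc _ (toGd D _ ≫ cokernel.π _) (by
    rw [← Category.assoc, ← toGd_naturality, Category.assoc, cokernel.condition, comp_zero])
  comm₁₂ := toGd_naturality D _
  comm₂₃ := (cokernel.π_desc _ _ _).symm

/-- The comparison from the cokernel to `gd D`. -/
def gdCompare (D : Opens X) (G : Shv A X) : (gdSeq D G).X₃ ⟶ gd D (injSeq G).X₃ :=
  cokernel.desc _ (gdMap D (injSeq G).g) (gdMap_injSeq D G)

lemma gdSeq_g_gdCompare (D : Opens X) (G : Shv A X) :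
    (gdSeq D G).g ≫ gdCompare D G = gdMap D (injSeq G).g := cokernel.π_desc _ _ _

lemma toGdSeq_gdCompare (D : Opens X) (G : Shv A X) :
    (toGdSeq D G).τ₃ ≫ gdCompare D G = toGd D _ := by
  rw [← cancel_epi (injSeq G).g, ← Category.assoc, ← (toGdSeq D G).comm₂₃, Category.assoc,
    gdSeq_g_gdCompare, ← toGd_naturality]
  rfl

instance (D : Opens X) (G : Shv A X) : Mono (gdCompare D G) := by
  refine mono_of_sapp_injective _ fun U => (injective_iff_map_eq_zero _).2 fun t ht => ?_
  have h (x : U) : ∃ (V : Opens X) (h : V ≤ U), x.1 ∈ V ∧ sres _ h t = 0 := by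
    obtain ⟨V, h, ⟨s, hs⟩, hx⟩ := (epi_iff_sapp (gdSeq D G).g).1 inferInstance U t x.1 x.2
    refine ⟨V, h, hx, ?_⟩
    -- This is left exactness of `gd`: a local lift of the given section dies in the quotient over
    -- `D ⊓ V`, so it comes from `G` over `D ⊓ V` and vanishes in the cokernel.
    have h1 : sapp (injSeq G).g (D ⊓ V) s = 0 := by
      have h2 := congrArg (sapp (gdCompare D G) V) hs
      rw [← sapp_comp, gdSeq_g_gdCompare, sapp_sres, ht, map_zero] at h2
      exact h2
    obtain ⟨r, rfl⟩ := exists_sapp_eq (injSeq_shortExact G).exact s h1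
    rw [← hs]
    exact congr(sapp $((gdSeq D G).zero) V r)
  choose V hV hx h0 using h
  refine sec_ext _ V hV (fun x hx' => Opens.mem_iSup.2 ⟨⟨x, hx'⟩, hx ⟨x, hx'⟩⟩) t 0 fun x => ?_
  rw [h0, map_zero]

/-- The direct image of a flasque sheaf is flasque; the basis of all open sets is used. -/
lemma gd_flasque (D : Opens X) (J : Shv A X) [Injective J] {p : ℕ} {W : Opens X}
    (x : Coh W (gd D J) (p + 1)) : x = 0 := by
  refine ExtendsFrom.coh_eq_zero (B := Set.univ) ?_ (fun V _ U _ => ?_) x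
  · exact Opens.isBasis_iff_nbhd.2 fun {U x} hx => ⟨U, trivial, hx, le_rfl⟩
  · exact sres_surjective_of_injective J (inf_le_inf_left D le_top)

lemma sapp_toGd_injective (W : Opens X) (G : Shv A X) :
    Function.Injective (sapp (toGd W G) W) := fun a b h => by
  have h1 : sres G inf_le_right a = sres G (inf_le_right : W ⊓ W ≤ W) b := h
  have h2 := congrArg (sres G (le_inf le_rfl le_rfl : W ≤ W ⊓ W)) h1
  rwa [sres_sres, sres_sres, sres_self, sres_self] at h2

lemma sapp_toGd_surjective (W : Opens X) (G : Shv A X) :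
    Function.Surjective (sapp (toGd W G) W) := fun (s : Sec G (W ⊓ W)) => by
  refine ⟨sres G (le_inf le_rfl le_rfl) s, ?_⟩
  exact (sres_sres G _ _ s).trans (sres_self G _ s)

/-- The cohomology over `W` of `G` injects into that of `gd W G`. -/
lemma eq_zero_of_cmap_toGd {p : ℕ} {W : Opens X} {G : Shv A X} (x : Coh W G p)
    (h : cmap (toGd W G) x = 0) : x = 0 := by
  induction p generalizing G with
  | zero =>
    obtain ⟨s, rfl⟩ := sec₀_surjective x
    obtain ⟨s₀, hs₀⟩ := sec₀_surjective (0 : Coh W G 0)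
    rw [← cmap_zero (toGd W G), ← hs₀, cmap_sec₀, cmap_sec₀] at h
    rw [← hs₀, sapp_toGd_injective W G (sec₀_injective h)]
  | succ p ih =>
    obtain ⟨q, rfl⟩ := exists_cδ_injSeq x
    have h1 : cδ (gdSeq_shortExact W G) (cmap (toGdSeq W G).τ₃ q) = 0 := by
      rw [← cδ_naturality (injSeq_shortExact G)]
      exact h
    obtain ⟨j, hj⟩ := exists_of_cδ_eq_zero _ _ h1
    -- In degree `0` the sections over `W` of the injective sheaf and of its direct image coincide;
    -- in positive degree `j` is zero.
    obtain ⟨j₀, rfl⟩ : ∃ j₀ : Coh W (injSeq G).X₂ p, cmap (toGd W _) j₀ = j := by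
      cases p with
      | zero =>
        obtain ⟨s, rfl⟩ := sec₀_surjective j
        obtain ⟨s₀, rfl⟩ := sapp_toGd_surjective W _ s
        exact ⟨sec₀ s₀, cmap_sec₀ _ _⟩
      | succ p => exact ⟨0, by rw [cmap_zero]; exact (gd_flasque W _ j).symm⟩
    have h2 : q - cmap (injSeq G).g j₀ = 0 := by
      apply ih
      rw [← toGdSeq_gdCompare, ← cmap_cmap, cmap_sub, ← hj, cmap_cmap, cmap_cmap]
      have h3 : (injSeq G).g ≫ (toGdSeq W G).τ₃ = toGd W _ ≫ (gdSeq W G).g :=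
        (toGdSeq W G).comm₂₃.symm
      rw [h3, sub_self, cmap_zero]
    rw [sub_eq_zero.1 h2, cδ_cmap]

/-- The hypothesis is the vanishing of the first higher direct image of `G` from `D`, checked on a
basis; it makes the last map locally surjective. -/
lemma gd_shortExact {B : Set (Opens X)} (hB : Opens.IsBasis B) (D : Opens X) (G : Shv A X)
    (h : ∀ V ∈ B, ∀ y : Coh (D ⊓ V) G 1, y = 0) :
    (ShortComplex.mk (gdMap D (injSeq G).f) (gdMap D (injSeq G).g)
      (gdMap_injSeq D G)).ShortExact := by
  refine shortExact_of_sections (fun U => sapp_injective (injSeq G).f (D ⊓ U))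
    (fun U y hy => exists_sapp_eq (injSeq_shortExact G).exact y hy) ?_
  refine (epi_iff_sapp _).2 fun U t x hx => ?_
  obtain ⟨V, hVB, hxV, hVU⟩ := Opens.isBasis_iff_nbhd.1 hB hx
  obtain ⟨j, hj⟩ := exists_of_cδ_eq_zero (injSeq_shortExact G)
    (sec₀ (sres (injSeq G).X₃ (inf_le_inf_left D hVU) t)) (h V hVB _)
  obtain ⟨s, rfl⟩ := sec₀_surjective j
  rw [cmap_sec₀] at hj
  have hs := sec₀_injective hj
  exact ⟨V, hVU, ⟨s, hs⟩, hxV⟩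

/-- A class on `W` which vanishes on `D ∩ W` vanishes in the cohomology of `gd D G`, if `G` has
no cohomology in lower degrees on the intersections of `D` with members of a basis. -/
lemma cmap_toGd_eq_zero {B : Set (Opens X)} (hB : Opens.IsBasis B) (D : Opens X) {i : ℕ}
    {G : Shv A X} (h : ∀ V ∈ B, ∀ p < i, ∀ y : Coh (D ⊓ V) G (p + 1), y = 0) {W : Opens X}
    (x : Coh W G (i + 1)) (hx : cres (inf_le_right : D ⊓ W ≤ W) x = 0) :
    cmap (toGd D G) x = 0 := by
  induction i generalizing G with
  | zero =>
    obtain ⟨q, rfl⟩ := exists_cδ_injSeq x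
    rw [cres_cδ] at hx
    obtain ⟨j, hj⟩ := exists_of_cδ_eq_zero _ _ hx
    obtain ⟨s, rfl⟩ := sec₀_surjective j
    obtain ⟨t, rfl⟩ := sec₀_surjective q
    rw [cres_sec₀, cmap_sec₀] at hj
    have hj := sec₀_injective hj
    refine (cδ_naturality (injSeq_shortExact G) (gdSeq_shortExact D G) (toGdSeq D G) _).trans ?_
    let s' : Sec (gdSeq D G).X₂ W := s
    have : cmap (toGdSeq D G).τ₃ (sec₀ t) = cmap (gdSeq D G).g (sec₀ s') := by
      refine (cmap_sec₀ _ _).trans (Eq.trans (congrArg sec₀ ?_) (cmap_sec₀ _ _).symm)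
      -- No vanishing of the first direct image is available here, so the cokernel is only a
      -- subsheaf of the direct image of the quotient; injectivity of the comparison suffices.
      apply sapp_injective (gdCompare D G)
      rw [← sapp_comp, ← sapp_comp, toGdSeq_gdCompare, gdSeq_g_gdCompare]
      exact hj.symm
    rw [this, cδ_cmap]
  | succ i ih =>
    obtain ⟨q, rfl⟩ := exists_cδ_injSeq x
    rw [cres_cδ] at hx
    obtain ⟨j, hj⟩ := exists_of_cδ_eq_zero _ _ hx
    have hj0 : j = 0 := Abelian.Ext.eq_zero_of_injective (I := Injective.under G) j
    rw [hj0, cmap_zero] at hj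
    -- The quotient sheaf inherits the vanishing hypothesis with degrees lowered by one, and the
    -- restriction of `q` to `D ⊓ W` is zero because the injective sheaf has no cohomology in its
    -- degree.
    have hq := ih (G := (injSeq G).X₃) (fun V hV p hp y => by
      obtain ⟨z, rfl⟩ := exists_of_cδ_eq_zero (injSeq_shortExact G) y (h V hV (p + 1) (by lia) _)
      have hz : z = 0 := Abelian.Ext.eq_zero_of_injective (I := Injective.under G) z
      rw [hz, cmap_zero]) q hj.symm
    let φ : injSeq G ⟶ ShortComplex.mk (gdMap D (injSeq G).f) (gdMap D (injSeq G).g)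
      (gdMap_injSeq D G) :=
      { τ₁ := toGd D _, τ₂ := toGd D _, τ₃ := toGd D _, comm₁₂ := toGd_naturality D _,
        comm₂₃ := toGd_naturality D _ }
    refine (cδ_naturality (injSeq_shortExact G) (gd_shortExact hB D G fun V hV => h V hV 0 (by lia))
      φ q).trans ?_
    exact (congrArg _ hq).trans (cδ_zero _)

/-- A basis of open subsets and a class of sheaves for which coverings by members of the basis
give resolutions inside the class. -/
structure SerreClass (B : Set (Opens X)) (Q : Shv A X → Prop) : Prop where
  isBasis : Opens.IsBasis B
  inf_mem : ∀ U ∈ B, ∀ V ∈ B, U ⊓ V ∈ B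
  isCompact : ∀ U ∈ B, IsCompact (U : Set X)
  exists_resolution : ∀ G, Q G → ∀ W ∈ B, ∀ (κ : Type u) [Fintype κ] (D : κ → Opens X),
    (∀ k, D k ∈ B) → (∀ k, D k ≤ W) → W ≤ ⨆ k, D k →
    ∃ (E : ShortComplex (Shv A X)) (_ : E.ShortExact) (f : gd W G ≅ E.X₁)
      (π : ∀ k, E.X₂ ⟶ gd (D k) G) (ι : ∀ k, gd (D k) G ⟶ E.X₂),
      Q E.X₃ ∧ Function.Surjective (sapp E.g W) ∧ ∑ k, π k ≫ ι k = 𝟙 _ ∧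
        ∀ k, toGd W G ≫ f.hom ≫ E.f ≫ π k = toGd (D k) G

lemma eq_zero_of_cmap_iso {U : Opens X} {F G : Shv A X} (e : F ≅ G) {p : ℕ} (x : Coh U F p)
    (h : cmap e.hom x = 0) : x = 0 := by
  have h1 := congrArg (cmap e.inv) h
  rw [cmap_cmap, Iso.hom_inv_id, cmap_zero] at h1
  exact (Abelian.Ext.comp_mk₀_id x).symm.trans h1

/-- Additivity of cohomology in finite sums, stated through a decomposition of the identity so that
no biproduct of sheaves has to be formed. -/
lemma eq_zero_of_cmap_components {U : Opens X} {I : Shv A X} {κ : Type u} [Fintype κ]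
    {G : κ → Shv A X} (π : ∀ k, I ⟶ G k) (ι : ∀ k, G k ⟶ I) (h : ∑ k, π k ≫ ι k = 𝟙 _) {p : ℕ}
    (x : Coh U I p) (hx : ∀ k, cmap (π k) x = 0) : x = 0 := by
  rw [← Abelian.Ext.comp_mk₀_id x, ← h, Abelian.Ext.mk₀_sum, Abelian.Ext.comp_sum]
  refine Finset.sum_eq_zero fun k _ => ?_
  have h1 : cmap (π k ≫ ι k) x = 0 := by rw [← cmap_cmap, hx, cmap_zero]
  exact h1

variable {B : Set (Opens X)} {Q : Shv A X → Prop}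

/-- Vanishing of the cohomology on the members of the basis. -/
theorem SerreClass.coh_eq_zero (hQ : SerreClass B Q) {i : ℕ} {G : Shv A X} (hG : Q G)
    {W : Opens X} (hW : W ∈ B) (x : Coh W G (i + 1)) : x = 0 := by
  induction i using Nat.strong_induction_on generalizing G W with
  | _ i ih =>
  -- Since `x` dies locally, finitely many members of the basis cover `W` and kill it. The
  -- resolution for this cover then trades `x` for a class of one degree less with values in another
  -- sheaf of the class.
  have hloc (a : W) : ∃ V ∈ B, ∃ h : V ≤ W, a.1 ∈ V ∧ cres h x = 0 := by
    obtain ⟨V, h, ha, hx⟩ := exists_cres_eq_zero x a.1 a.2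
    obtain ⟨V', hB, ha', hV'⟩ := Opens.isBasis_iff_nbhd.1 hQ.isBasis ha
    exact ⟨V', hB, hV'.trans h, ha', by rw [← cres_cres h hV', hx, cres_zero]⟩
  choose V hVB hVW haV hxV using hloc
  obtain ⟨t, ht⟩ := (hQ.isCompact W hW).elim_finite_subcover (fun a => (V a : Set X))
    (fun a => (V a).isOpen) fun a ha => Set.mem_iUnion.2 ⟨⟨a, ha⟩, haV ⟨a, ha⟩⟩
  obtain ⟨E, hE, f, π, ι, hE₃, hsurj, hπι, hf⟩ := hQ.exists_resolution G hG W hW t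
    (fun k => V k.1) (fun k => hVB k.1) (fun k => hVW k.1) (fun a ha => by
      obtain ⟨k, hk, hak⟩ := Set.mem_iUnion₂.1 (ht ha)
      exact Opens.mem_iSup.2 ⟨⟨k, hk⟩, hak⟩)
  apply eq_zero_of_cmap_toGd
  apply eq_zero_of_cmap_iso f
  have h0 : cmap E.f (cmap f.hom (cmap (toGd W G) x)) = 0 := by
    refine eq_zero_of_cmap_components π ι hπι _ fun k => ?_
    rw [cmap_cmap, cmap_cmap, cmap_cmap, hf]
    -- Vanishing on `V k` passes to the direct image from `V k`; the lower degree vanishing this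
    -- needs is the induction hypothesis on intersections, which stay in the basis.
    refine cmap_toGd_eq_zero hQ.isBasis (V k.1) (fun V' hV' p hp y =>
      ih p hp hG (hQ.inf_mem _ (hVB k.1) _ hV') y) x ?_
    rw [← cres_cres (hVW k.1) inf_le_left, hxV, cres_zero]
  obtain ⟨q, hq⟩ := exists_cδ_of_cmap_eq_zero hE _ h0
  rw [← hq]
  cases i with
  | zero =>
    obtain ⟨t, rfl⟩ := sec₀_surjective q
    obtain ⟨s, rfl⟩ := hsurj t
    rw [← cmap_sec₀, cδ_cmap]
  | succ i => rw [ih i (by lia) hE₃ hW q, cδ_zero]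

instance (U : Opens X) (G : Shv A X) : IsIso (toGd U (gd U G)) := by
  have h (V : Opens X) : U ⊓ V ≤ U ⊓ (U ⊓ V) := le_inf inf_le_left le_rfl
  refine ⟨⟨shvHom (F := gd U (gd U G)) (G := gd U G) (fun V => sres G (h V)) fun V W i s => ?_,
    ?_, ?_⟩⟩
  · exact (sres_sres G _ _ s).trans (sres_sres G _ _ s).symm
  · exact shv_hom_ext fun V s => (sres_sres G _ _ s).trans (sres_self G _ s)
  · exact shv_hom_ext fun V s => (sres_sres G _ _ s).trans (sres_self G _ s)

/-- The sheaf `gd U G` is its own direct image from `U`, and each of its classes vanishes on `U` by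
the previous theorem; hence its cohomology vanishes on every larger open set. -/
theorem SerreClass.coh_gd_eq_zero (hQ : SerreClass B Q) {i : ℕ} {G : Shv A X} {U : Opens X}
    (hG : Q (gd U G)) (hU : U ∈ B) {W : Opens X} (hUW : U ≤ W) (x : Coh W (gd U G) (i + 1)) :
    x = 0 := by
  apply eq_zero_of_cmap_iso (asIso (toGd U (gd U G)))
  refine cmap_toGd_eq_zero hQ.isBasis U (fun V hV p _ y =>
    hQ.coh_eq_zero hG (hQ.inf_mem _ hU _ hV) y) x ?_
  rw [← cres_cres hUW inf_le_left, hQ.coh_eq_zero hG hU (cres hUW x), cres_zero]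

end OpenPushforward

/-! ### Exactness of the direct image from `S_A` to `S` -/

section OnS
variable {k : Type u} [Field k] [Fintype k] {S : Over (Spec (CommRingCat.of k))}

variable (S) in
instance : IsAffineHom (prS S) := by
  have h : IsAffineHom (Spec.map (CommRingCat.ofHom (Polynomial.C (R := k)))) := inferInstance
  exact MorphismProperty.of_isPullback (P := @IsAffineHom) (IsPullback.of_hasPullback S.hom
    (Spec.map (CommRingCat.ofHom (Polynomial.C (R := k))))).flip h

variable (S) in
/-- The functor `onS`. -/
def onSF : (XA S).Modules ⥤ Shv (Polynomial k) S.left where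
  obj F := onS F
  map f := onSMap f

instance : (onSF S).Additive where

lemma onS_surjective {F G : (XA S).Modules} (f : F ⟶ G) [Epi f] (hF : qcoh _ F) (hG : qcoh _ G)
    {U : S.left.Opens} (hU : IsAffineOpen U) : Function.Surjective (sapp (onSMap f) U) :=
  app_surjective_of_epi f hF hG (hU.preimage (prS S))

/-- Exactness on the right is checked on affine opens of `S`, whose preimages in `S_A` are affine.
-/
lemma onS_shortExact {E : ShortComplex (XA S).Modules} (hE : E.ShortExact) (h₂ : qcoh _ E.X₂)
    (h₃ : qcoh _ E.X₃) : (E.map (onSF S)).ShortExact := by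
  have := hE.mono_f
  have := hE.epi_g
  refine shortExact_of_sections (fun U => app_injective_of_mono E.f (prS S ⁻¹ᵁ U))
    (fun U y hy => (kernel_sections E.f E.g E.zero hE.fIsKernel (prS S ⁻¹ᵁ U)).2 y hy) ?_
  refine (epi_iff_sapp _).2 fun U t x hx => ?_
  obtain ⟨V, hV, hxV, hVU⟩ := exists_isAffineOpen_mem_and_subset (U := U) hx
  obtain ⟨s, hs⟩ := onS_surjective E.g h₂ h₃ hV (sres (onS E.X₃) hVU t)
  exact ⟨V, hVU, ⟨s, hs⟩, hxV⟩

end OnS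

/-! ### Direct images of modules from open subschemes -/

section ModuleOpenPushforward
variable {X : Scheme.{u}}

/-- The module `V ↦ F(D ∩ V)`. -/
def mgd (D : X.Opens) (F : X.Modules) : X.Modules :=
  (Scheme.Modules.pushforward D.ι).obj (F.restrict D.ι)

/-- The restriction map `F ⟶ mgd D F`. -/
def toMgd (D : X.Opens) (F : X.Modules) : F ⟶ mgd D F :=
  (Scheme.Modules.restrictAdjunction D.ι).unit.app F

lemma ι_image_preimage (D V : X.Opens) : D.ι ''ᵁ D.ι ⁻¹ᵁ V = D ⊓ V := by
  rw [Scheme.Hom.image_preimage_eq_opensRange_inf, Scheme.Opens.opensRange_ι]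

lemma toMgd_app (D : X.Opens) (F : X.Modules) (V : X.Opens) (s : Γ(F, V)) :
    (toMgd D F).app V s = mres F ((ι_image_preimage D V).le.trans inf_le_right) s := rfl

lemma qcoh_mgd (D : X.Opens) [IsAffineHom D.ι] {F : X.Modules} (hF : qcoh _ F) :
    qcoh _ (mgd D F) := by
  have h : qcoh D.toScheme (F.restrict D.ι) := qcoh_restrict D.ι F hF
  exact qcoh_pushforward D.ι h

lemma toMgd_injective_of_cover {κ : Type*} (D : κ → X.Opens) (F : X.Modules) {V : X.Opens}
    (hV : V ≤ ⨆ k, D k) (s : Γ(F, V)) (h : ∀ k, (toMgd (D k) F).app V s = 0) : s = 0 := by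
  refine mres_eq_of_cover F (fun k => D k ⊓ V) (fun k => inf_le_right) ?_ s 0 fun k => ?_
  · rw [← iSup_inf_eq]
    exact le_inf hV le_rfl
  · have h1 := congrArg (mres F (ι_image_preimage (D k) V).ge) (h k)
    rw [toMgd_app, mres_mres] at h1
    rw [h1, map_zero]
    exact map_zero _

instance : HasFiniteBiproducts X.Modules := HasFiniteBiproducts.of_hasFiniteProducts

lemma qcoh_biproduct {κ : Type u} [Fintype κ] (F : κ → X.Modules) (hF : ∀ k, qcoh _ (F k)) :
    qcoh _ (⨁ F) :=
  qcoh_colimit (fun j => hF j.as) (biproduct.isColimit F)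

/-- The sections of `mgd D F`. -/
def mgdId (D : X.Opens) (F : X.Modules) (V : X.Opens) :
    Γ(mgd D F, V) →+ Γ(F, D.ι ''ᵁ D.ι ⁻¹ᵁ V) :=
  AddMonoidHom.id Γ(F, D.ι ''ᵁ D.ι ⁻¹ᵁ V)

lemma ι_image_preimage_mono (D : X.Opens) {U V : X.Opens} (h : V ≤ U) :
    D.ι ''ᵁ D.ι ⁻¹ᵁ V ≤ D.ι ''ᵁ D.ι ⁻¹ᵁ U := by
  rw [ι_image_preimage, ι_image_preimage]
  exact inf_le_inf_left D h

lemma mgdId_mres (D : X.Opens) (F : X.Modules) {U V : X.Opens} (h : V ≤ U)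
    (s : Γ(mgd D F, U)) : mgdId D F V (mres (mgd D F) h s) =
      mres F (ι_image_preimage_mono D h) (mgdId D F U s) :=
  rfl

lemma mgdId_toMgd (D : X.Opens) (F : X.Modules) (V : X.Opens) (s : Γ(F, V)) :
    mgdId D F V ((toMgd D F).app V s) =
      mres F ((ι_image_preimage D V).le.trans inf_le_right) s := rfl

lemma mgdId_injective (D : X.Opens) (F : X.Modules) (V : X.Opens) :
    Function.Injective (mgdId D F V) := fun _ _ h => h

lemma mgdId_surjective (D : X.Opens) (F : X.Modules) (V : X.Opens) :
    Function.Surjective (mgdId D F V) := fun x => ⟨x, rfl⟩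

/-- The canonical map from sections of `mgd D F` to sections of `F`. -/
def mgdSec (D : X.Opens) (F : X.Modules) (V : X.Opens) : Γ(mgd D F, V) →+ Γ(F, D ⊓ V) :=
  (mres F (ι_image_preimage D V).ge).comp (mgdId D F V)

lemma mgdSec_apply (D : X.Opens) (F : X.Modules) (V : X.Opens) (s : Γ(mgd D F, V)) :
    mgdSec D F V s = mres F (ι_image_preimage D V).ge (mgdId D F V s) := rfl

lemma mgdSec_bijective (D : X.Opens) (F : X.Modules) (V : X.Opens) :
    Function.Bijective (mgdSec D F V) :=
  (mres_bijective_of_eq F (ι_image_preimage D V).symm).comp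
    ⟨mgdId_injective D F V, mgdId_surjective D F V⟩

lemma toMgd_injective (D : X.Opens) (F : X.Modules) {V : X.Opens} (h : V ≤ D) :
    Function.Injective ((toMgd D F).app V) := fun a b hab => by
  have e : D.ι ''ᵁ D.ι ⁻¹ᵁ V = V := by rw [ι_image_preimage, inf_eq_right.2 h]
  have h1 := congrArg (mgdId D F V) hab
  rw [mgdId_toMgd, mgdId_toMgd] at h1
  exact (mres_bijective_of_eq F e).1 h1

lemma toMgd_mgdSec (D : X.Opens) (F : X.Modules) (V : X.Opens) (s : Γ(mgd D F, V)) :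
    (toMgd D F).app (D ⊓ V) (mgdSec D F V s) = mres (mgd D F) inf_le_right s := by
  apply mgdId_injective D F
  rw [mgdId_toMgd, mgdSec_apply, mgdId_mres, mres_mres]

lemma mgdSec_smul (D : X.Opens) (F : X.Modules) (V : X.Opens) (r : Γ(X, V)) (s : Γ(mgd D F, V)) :
    mgdSec D F V (r • s) = rres (inf_le_right : D ⊓ V ≤ V) r • mgdSec D F V s := by
  apply toMgd_injective D F inf_le_left
  rw [toMgd_mgdSec, Scheme.Modules.Hom.app_smul, toMgd_mgdSec, mres_smul]

lemma mgdSec_mres (D : X.Opens) (F : X.Modules) {U V : X.Opens} (h : V ≤ U)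
    (s : Γ(mgd D F, U)) : mgdSec D F V (mres (mgd D F) h s) =
      mres F (inf_le_inf_left D h) (mgdSec D F U s) := by
  rw [mgdSec_apply, mgdSec_apply, mgdId_mres, mres_mres, mres_mres]

lemma mgdSec_toMgd (D : X.Opens) (F : X.Modules) (V : X.Opens) (s : Γ(F, V)) :
    mgdSec D F V ((toMgd D F).app V s) = mres F inf_le_right s := by
  rw [mgdSec_apply, mgdId_toMgd, mres_mres]

end ModuleOpenPushforward

/-! ### Compatibility of the two direct images; open immersions which are affine -/

section GdOnS
variable {k : Type u} [Field k] [Fintype k] {S : Over (Spec (CommRingCat.of k))}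

/-- The comparison between `mgd` and `gd`. -/
def onSMgdHom (D : S.left.Opens) (F : (XA S).Modules) :
    onS (mgd (prS S ⁻¹ᵁ D) F) ⟶ gd D (onS F) :=
  shvHom (F := onS (mgd (prS S ⁻¹ᵁ D) F)) (G := gd D (onS F)) (fun V =>
    { toFun := mgdSec (prS S ⁻¹ᵁ D) F (prS S ⁻¹ᵁ V)
      map_add' := map_add (mgdSec (prS S ⁻¹ᵁ D) F (prS S ⁻¹ᵁ V))
      map_smul' := fun a s =>
        (mgdSec_smul (prS S ⁻¹ᵁ D) F (prS S ⁻¹ᵁ V) (aScalars (prA S) _ a) s).trans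
        (congrArg (fun r : Γ(XA S, prS S ⁻¹ᵁ D ⊓ prS S ⁻¹ᵁ V) => r •
          mgdSec (prS S ⁻¹ᵁ D) F (prS S ⁻¹ᵁ V) s) (aScalars_map (prA S) (homOfLE inf_le_right) a)) })
    fun _ _ h s => mgdSec_mres (prS S ⁻¹ᵁ D) F (fun _ hx => h hx) s

instance (D : S.left.Opens) (F : (XA S).Modules) : IsIso (onSMgdHom D F) := by
  refine @isIso_of_mono_of_epi _ _ _ _ _ _ (mono_of_sapp_injective _ fun V =>
    (mgdSec_bijective (prS S ⁻¹ᵁ D) F (prS S ⁻¹ᵁ V)).1) ((epi_iff_sapp _).2 fun U t x hx =>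
      ⟨U, le_rfl, ?_, hx⟩)
  obtain ⟨s, hs⟩ := (mgdSec_bijective (prS S ⁻¹ᵁ D) F (prS S ⁻¹ᵁ U)).2 t
  exact ⟨s, hs.trans (sres_self _ _ t).symm⟩

lemma onSMap_toMgd (D : S.left.Opens) (F : (XA S).Modules) :
    onSMap (toMgd (prS S ⁻¹ᵁ D) F) ≫ onSMgdHom D F = toGd D (onS F) :=
  shv_hom_ext fun _ s => mgdSec_toMgd _ F _ s

lemma isAffineHom_ι {X : Scheme.{u}} [IsAffineHom (pullback.diagonal (terminal.from X))]
    {W : X.Opens} (hW : IsAffineOpen W) : IsAffineHom W.ι where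
  isAffine_preimage U hU := by
    rw [← Scheme.Hom.isAffineOpen_iff_of_isOpenImmersion W.ι, ι_image_preimage]
    exact hW.inf hU

lemma isAffineHom_preimage_ι {X Y : Scheme.{u}} (f : X ⟶ Y) (W : Y.Opens) [IsAffineHom W.ι] :
    IsAffineHom (f ⁻¹ᵁ W).ι :=
  MorphismProperty.of_isPullback (P := @IsAffineHom) (isPullback_morphismRestrict f W)
    inferInstance

end GdOnS

/-! ### Acyclic embeddings on quasi-compact schemes with affine diagonal -/

section AffineDiagonal
variable {k : Type u} [Field k] [Fintype k] {S : Over (Spec (CommRingCat.of k))}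

variable (S) in
/-- The sheaves on `S` which come from quasi-coherent modules on `S_A`. -/
def IsOnS (G : Shv (Polynomial k) S.left) : Prop :=
  ∃ F : (XA S).Modules, qcoh _ F ∧ Nonempty (onS F ≅ G)

/-- Sections of a direct image from `W` are determined inside `W`, so a cover of `W` alone is enough
to test them. -/
lemma mres_mgd_injective {X : Scheme.{u}} (W : X.Opens) (F : X.Modules) (V : X.Opens) :
    Function.Injective (mres (mgd W F) (inf_le_right : W ⊓ V ≤ V)) := fun x y h => by
  apply (mgdSec_bijective W F V).1
  have h1 := congrArg (mgdSec W F (W ⊓ V)) h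
  rw [mgdSec_mres, mgdSec_mres] at h1
  have e : W ⊓ (W ⊓ V) = W ⊓ V := by rw [← inf_assoc, inf_idem]
  exact (mres_bijective_of_eq F e).1 h1

lemma isIso_gdMap_toGd {A : Type u} [CommRing A] {X : TopCat.{u}} {D W : Opens X} (h : D ≤ W)
    (G : Shv A X) : IsIso (gdMap D (toGd W G)) := by
  have h1 (V : Opens X) : W ⊓ (D ⊓ V) = D ⊓ V := inf_eq_right.2 (inf_le_left.trans h)
  refine @isIso_of_mono_of_epi _ _ _ _ _ _ (mono_of_sapp_injective _ fun V (x y : Sec G (D ⊓ V)) hxy => ?_)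
    ((epi_iff_sapp _).2 fun U t x hx => ⟨U, le_rfl, ?_, hx⟩)
  · have h2 : sres G (inf_le_right : W ⊓ (D ⊓ V) ≤ _) x = sres G inf_le_right y := hxy
    have h3 := congrArg (sres G (h1 V).ge) h2
    rwa [sres_sres, sres_sres, sres_self, sres_self] at h3
  · let t' : Sec G (W ⊓ (D ⊓ U)) := t
    refine ⟨(sres G (h1 U).ge t' : Sec G (D ⊓ U)), ?_⟩
    refine ((sres_sres G _ _ t').trans (sres_self G _ t')).trans (sres_self (gd D (gd W G)) _ t).symm

variable [IsAffineHom (pullback.diagonal (terminal.from S.left))]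

lemma qcoh_mgd_preimage {W : S.left.Opens} (hW : IsAffineOpen W) {F : (XA S).Modules}
    (hF : qcoh _ F) : qcoh _ (mgd (prS S ⁻¹ᵁ W) F) := by
  have := isAffineHom_ι hW
  have := isAffineHom_preimage_ι (prS S) W
  exact qcoh_mgd _ hF

/-- The map to the sum of the direct images from the members of a cover. -/
def toCover {κ : Type u} [Fintype κ] (D : κ → S.left.Opens) (F : (XA S).Modules) :
    F ⟶ ⨁ fun i => mgd (prS S ⁻¹ᵁ D i) F :=
  biproduct.lift fun i => toMgd (prS S ⁻¹ᵁ D i) F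

lemma mono_toCover {κ : Type u} [Fintype κ] (D : κ → S.left.Opens) (F : (XA S).Modules)
    (h : ∀ V (s : Γ(F, V)), (∀ i, (toMgd (prS S ⁻¹ᵁ D i) F).app V s = 0) → s = 0) :
    Mono (toCover D F) := by
  refine mono_of_app_injective _ fun V _ => (injective_iff_map_eq_zero _).2 fun s hs => h V s ?_
  intro i
  have h1 : toCover D F ≫ biproduct.π _ i = toMgd (prS S ⁻¹ᵁ D i) F := biproduct.lift_π _ _
  rw [← h1]
  have h2 := congrArg ((biproduct.π (fun i => mgd (prS S ⁻¹ᵁ D i) F) i).app V) hs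
  exact h2.trans (map_zero _)

lemma qcoh_cover {κ : Type u} [Fintype κ] {D : κ → S.left.Opens} (hD : ∀ i, IsAffineOpen (D i))
    {F : (XA S).Modules} (hF : qcoh _ F) : qcoh _ (⨁ fun i => mgd (prS S ⁻¹ᵁ D i) F) :=
  qcoh_biproduct _ fun i => qcoh_mgd_preimage (hD i) hF

lemma qcoh_cokernel {X : Scheme.{u}} {F G : X.Modules} (f : F ⟶ G) (hF : qcoh _ F)
    (hG : qcoh _ G) : qcoh _ (cokernel f) :=
  ObjectProperty.IsClosedUnderCokernels.cokernels_le (P := qcoh X) _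
    ⟨f, CokernelCofork.ofπ (cokernel.π f) (cokernel.condition f), cokernelIsCokernel f, hF, hG⟩

lemma sum_π_ι {X : Scheme.{u}} {κ : Type u} [Fintype κ] (F : κ → X.Modules) :
    ∑ i, biproduct.π F i ≫ biproduct.ι F i = 𝟙 (⨁ F) := by
  classical
  refine biproduct.hom_ext' _ _ fun j => ?_
  rw [Preadditive.comp_sum, Finset.sum_eq_single j]
  · rw [← Category.assoc, biproduct.ι_π_self, Category.id_comp, Category.comp_id]
  · intro i _ hi
    rw [← Category.assoc, biproduct.ι_π_ne _ hi.symm, zero_comp]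
  · exact fun h => (h (Finset.mem_univ j)).elim

lemma onSMap_sum_π_ι {κ : Type u} [Fintype κ] (F : κ → (XA S).Modules) :
    ∑ i, onSMap (biproduct.π F i) ≫ onSMap (biproduct.ι F i) = 𝟙 (onS (⨁ F)) := by
  refine Eq.trans ?_ (congrArg (onSF S).map (sum_π_ι F))
  rw [Functor.map_sum]
  rfl

lemma comp_iso_cancel {C : Type*} [Category C] {X Y Z T X' : C} (p : X ⟶ Y) (m : Y ⟶ Z) [IsIso m]
    (r : Z ≅ T) (i : Y ⟶ X') : (p ≫ m ≫ r.hom) ≫ r.inv ≫ inv m ≫ i = p ≫ i := by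
  simp

/-- The resolution is built from modules: the direct image `M` of `F` from the preimage of `W`
embeds into the sum of the direct images for the members of the cover, and the cokernel is again
quasi-coherent. Affineness of the diagonal makes these direct images quasi-coherent and keeps
intersections affine. -/
lemma serreClass_isOnS : SerreClass {U : Opens S.left | IsAffineOpen (X := S.left) U} (IsOnS S) where
  isBasis := S.left.isBasis_affineOpens
  inf_mem U hU V hV := IsAffineOpen.inf hU hV
  isCompact U hU := IsAffineOpen.isCompact hU
  exists_resolution := by
    rintro G ⟨F, hF, ⟨e⟩⟩ W hW κ _ D hD hDW hWD
    let M := mgd (prS S ⁻¹ᵁ W) F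
    have hM : qcoh _ M := qcoh_mgd_preimage hW hF
    let a : onS M ≅ gd W G := asIso (onSMgdHom W F) ≪≫
      { hom := gdMap W e.hom
        inv := gdMap W e.inv
        hom_inv_id := by rw [← gdMap_comp, e.hom_inv_id]; rfl
        inv_hom_id := by rw [← gdMap_comp, e.inv_hom_id]; rfl }
    have hI := qcoh_cover hD hM
    have hm : Mono (toCover D M) := by
      refine mono_toCover D M fun V s hs => ?_
      refine mres_mgd_injective _ F V ?_
      rw [map_zero]
      refine toMgd_injective_of_cover (fun i => prS S ⁻¹ᵁ D i) M (fun x hx => ?_) _ fun i => ?_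
      · obtain ⟨i, hi⟩ := Opens.mem_iSup.1 (hWD hx.1)
        exact Opens.mem_iSup.2 ⟨i, hi⟩
      · rw [app_mres]
        exact (congrArg _ (hs i)).trans (map_zero _)
    have hE : (ShortComplex.mk (toCover D M) (cokernel.π _) (cokernel.condition _)).ShortExact :=
      { exact := ShortComplex.exact_cokernel _ }
    have hC := qcoh_cokernel (toCover D M) hM hI
    have hi (i) := isIso_gdMap_toGd (hDW i) G
    -- As `D i ≤ W`, taking direct images first from `W` and then from `D i` changes nothing.
    let ρ (i) : gd (D i) (onS M) ≅ gd (D i) G :=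
      { hom := gdMap (D i) a.hom ≫ inv (gdMap (D i) (toGd W G))
        inv := gdMap (D i) (toGd W G) ≫ gdMap (D i) a.inv
        hom_inv_id := by
          rw [Category.assoc, IsIso.inv_hom_id_assoc, ← gdMap_comp, a.hom_inv_id]; rfl
        inv_hom_id := by
          rw [Category.assoc, ← Category.assoc (gdMap _ a.inv), ← gdMap_comp, a.inv_hom_id]
          change _ ≫ 𝟙 _ ≫ _ = _
          rw [Category.id_comp, IsIso.hom_inv_id] }
    refine ⟨_, onS_shortExact hE hI hC, a.symm,
      fun i => onSMap (biproduct.π (fun i => mgd (prS S ⁻¹ᵁ D i) M) i) ≫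
        onSMgdHom (D i) M ≫ (ρ i).hom,
      fun i => (ρ i).inv ≫ inv (onSMgdHom (D i) M) ≫ 
        onSMap (biproduct.ι (fun i => mgd (prS S ⁻¹ᵁ D i) M) i), ?_, ?_, ?_, ?_⟩
    · exact ⟨_, hC, ⟨Iso.refl _⟩⟩
    · have : Epi (cokernel.π (toCover D M)) := inferInstance
      exact onS_surjective (cokernel.π (toCover D M)) hI hC hW
    · refine (Finset.sum_congr rfl fun i _ => ?_).trans
        (onSMap_sum_π_ι fun i => mgd (prS S ⁻¹ᵁ D i) M)
      let N (i) := mgd (prS S ⁻¹ᵁ D i) M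
      exact comp_iso_cancel (onSMap (biproduct.π N i)) (onSMgdHom (D i) M) (ρ i)
        (onSMap (biproduct.ι N i))
    · intro i
      change toGd W G ≫ a.inv ≫ onSMap (toCover D M) ≫ onSMap (biproduct.π _ i) ≫
        onSMgdHom (D i) M ≫ (ρ i).hom = _
      rw [← Category.assoc (onSMap (toCover D M)), ← onSMap_comp, toCover, biproduct.lift_π,
        ← Category.assoc (onSMap _), onSMap_toMgd]
      change toGd W G ≫ a.inv ≫ toGd (D i) (onS M) ≫ gdMap (D i) a.hom ≫
        inv (gdMap (D i) (toGd W G)) = _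
      rw [← Category.assoc (toGd (D i) (onS M)), toGd_naturality, Category.assoc,
        Iso.inv_hom_id_assoc, ← Category.assoc, ← toGd_naturality, Category.assoc,
        IsIso.hom_inv_id, Category.comp_id]

/-- Quasi-coherent modules embed into quasi-coherent modules with vanishing cohomology. -/
lemma exists_mono_acyclic_of_affineDiagonal [CompactSpace S.left] (F : (XA S).Modules)
    (hF : qcoh _ F) : ∃ (I : (XA S).Modules) (f : F ⟶ I), qcoh _ I ∧ Mono f ∧
      ∀ (p : ℕ) (x : Coh ⊤ (onS I) (p + 1)), x = 0 := by
  obtain ⟨κ, _, D, hD, hDT⟩ : ∃ (κ : Type u) (_ : Fintype κ) (D : κ → S.left.Opens),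
      (∀ i, IsAffineOpen (D i)) ∧ ⨆ i, D i = ⊤ := by
    -- Quasi-compactness makes the cover finite, so that the product of the direct images is a
    -- finite direct sum and stays quasi-coherent.
    let C := S.left.affineCover.finiteSubcover
    refine ⟨C.I₀, inferInstance, fun i => (C.f i).opensRange, fun i => isAffineOpen_opensRange _, ?_⟩
    exact C.iSup_opensRange
  have hm : Mono (toCover D F) := by
    refine mono_toCover D F fun V s hs => toMgd_injective_of_cover _ F (fun x hx => ?_) s hs
    have h : prS S x ∈ (⨆ i, D i) := hDT ▸ trivial
    obtain ⟨i, hi⟩ := Opens.mem_iSup.1 h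
    exact Opens.mem_iSup.2 ⟨i, hi⟩
  refine ⟨_, toCover D F, qcoh_cover hD hF, hm, fun p x => ?_⟩
  refine eq_zero_of_cmap_components
    (π := fun i => onSMap (biproduct.π (fun i => mgd (prS S ⁻¹ᵁ D i) F) i))
    (ι := fun i => onSMap (biproduct.ι (fun i => mgd (prS S ⁻¹ᵁ D i) F) i)) ?_ x fun i => ?_
  · exact onSMap_sum_π_ι fun i => mgd (prS S ⁻¹ᵁ D i) F
  · apply eq_zero_of_cmap_iso (asIso (onSMgdHom (D i) F))
    exact serreClass_isOnS.coh_gd_eq_zero ⟨_, qcoh_mgd_preimage (hD i) hF,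
      ⟨asIso (onSMgdHom (D i) F)⟩⟩ (hD i) le_top _

end AffineDiagonal

/-! ### Quasi-coherent extension of a submodule of the sections over an affine open -/

section LocalMembership
variable {X : Scheme.{u}} {E : X.Modules}

lemma isUnit_rres {V V' : X.Opens} (g : Γ(X, V)) (h : V' ≤ X.basicOpen g) :
    IsUnit (rres (h.trans (X.basicOpen_le g)) g) := by
  rw [← rres_rres (X.basicOpen_le g) h]
  exact (X.toRingedSpace.isUnit_res_basicOpen g).map (rres h)

lemma exists_rres_eq {V : X.Opens} (hV : IsAffineOpen V) (g : Γ(X, V)) (r : Γ(X, X.basicOpen g)) :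
    ∃ (n : ℕ) (a : Γ(X, V)), rres (X.basicOpen_le g) a = rres (X.basicOpen_le g) g ^ n * r :=
  ((qcoh_iff_locAt (unitMod X)).1 (qcoh_unitMod X) V hV g).2 r

lemma exists_pow_mul_eq_zero {V : X.Opens} (hV : IsAffineOpen V) (g a : Γ(X, V))
    (h : rres (X.basicOpen_le g) a = 0) : ∃ n : ℕ, g ^ n * a = 0 :=
  ((qcoh_iff_locAt (unitMod X)).1 (qcoh_unitMod X) V hV g).1 a h

/-- A prime ideal containing `J` but not `g` would be a point of the basic open set of `g` outside
all those of elements of `J`; so `g` lies in the radical. -/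
lemma mem_of_forall_point {V : X.Opens} (hV : IsAffineOpen V) (J : Ideal Γ(X, V)) (g : Γ(X, V))
    (h : ∀ x ∈ X.basicOpen g, ∃ g' ∈ J, x ∈ X.basicOpen g') : ∃ n : ℕ, g ^ n ∈ J := by
  by_contra hg
  have hg' : g ∉ J.radical := hg
  rw [Ideal.radical_eq_sInf, Ideal.mem_sInf] at hg'
  push Not at hg'
  obtain ⟨P, ⟨hJP, hP⟩, hgP⟩ := hg'
  have key (f : Γ(X, V)) : hV.fromSpec ⟨P, hP⟩ ∈ X.basicOpen f ↔ f ∉ P := by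
    have := hV.fromSpec_preimage_basicOpen f
    have h2 : (⟨P, hP⟩ : PrimeSpectrum Γ(X, V)) ∈ (hV.fromSpec ⁻¹ᵁ X.basicOpen f) ↔
      (⟨P, hP⟩ : PrimeSpectrum Γ(X, V)) ∈ PrimeSpectrum.basicOpen f := by rw [this]; rfl
    exact h2
  obtain ⟨g', hg'J, hx⟩ := h _ ((key g).2 hgP)
  exact (key g').1 hx (hJP hg'J)

variable {V₀ : X.Opens} (Y : Submodule Γ(X, V₀) Γ(E, V₀))

/-- Sections which locally on `V₀` belong to `Y`. -/
def LocMem (V : X.Opens) (e : Γ(E, V)) : Prop :=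
  ∀ (g : Γ(X, V₀)) (h : X.basicOpen g ≤ V), ∃ c : Γ(X, V₀), ∃ y ∈ Y,
    IsUnit (rres (X.basicOpen_le g) c) ∧
      mres E (X.basicOpen_le g) y = rres (X.basicOpen_le g) c • mres E h e

variable {Y}

lemma LocMem.res {V V' : X.Opens} (h : V' ≤ V) {e : Γ(E, V)} (he : LocMem Y V e) :
    LocMem Y V' (mres E h e) := fun g hg => by
  rw [mres_mres]
  exact he g (hg.trans h)

/-- Clearing denominators: `c⁻¹` is a fraction over a power of `g`, and both the relation saying so
and the relation `y = c e` hold over `V₀` up to powers of `g`. The exponent adds up the three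
powers. -/
lemma exists_pow_smul_mem (hE : qcoh X E) (hV₀ : IsAffineOpen V₀) {g c : Γ(X, V₀)} {y e : Γ(E, V₀)}
    (hy : y ∈ Y) (hc : IsUnit (rres (X.basicOpen_le g) c))
    (h : mres E (X.basicOpen_le g) y = rres (X.basicOpen_le g) c • mres E (X.basicOpen_le g) e) :
    ∃ n : ℕ, g ^ n • e ∈ Y := by
  obtain ⟨u, hu⟩ := hc
  obtain ⟨n, b, hb⟩ := exists_rres_eq hV₀ g (↑u⁻¹ : Γ(X, X.basicOpen g))
  obtain ⟨m, hm⟩ := exists_pow_mul_eq_zero hV₀ g (c * b - g ^ n) (by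
    rw [map_sub, map_mul, map_pow, hb, ← hu, mul_left_comm, Units.mul_inv, mul_one, sub_self])
  obtain ⟨k, hk⟩ := ((qcoh_iff_locAt E).1 hE V₀ hV₀ g).1 (y - c • e) (by
    rw [map_sub, h, mres_smul, sub_self])
  have h1 : (g ^ k * c) • e ∈ Y := by
    rw [smul_sub, sub_eq_zero] at hk
    rw [mul_smul, ← hk]
    exact Y.smul_mem _ hy
  refine ⟨k + (m + n), ?_⟩
  have h2 : g ^ (k + (m + n)) = (b * g ^ m) * (g ^ k * c) := by
    linear_combination (-g ^ k) * hm
  rw [h2, mul_smul]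
  exact Y.smul_mem _ h1

variable (Y) in
/-- The submodule of the sections which locally on `V₀` belong to `Y`. -/
def locSub (hV₀ : IsAffineOpen V₀) (V : X.Opens) : Submodule Γ(X, V) Γ(E, V) where
  carrier := {e | LocMem Y V e}
  zero_mem' := fun g h => ⟨1, 0, Y.zero_mem, by rw [map_one]; exact isUnit_one, by
    rw [map_zero, map_zero, smul_zero]⟩
  add_mem' {e₁ e₂} h₁ h₂ := fun g h => by
    obtain ⟨c₁, y₁, hy₁, hc₁, he₁⟩ := h₁ g h
    obtain ⟨c₂, y₂, hy₂, hc₂, he₂⟩ := h₂ g h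
    refine ⟨c₁ * c₂, c₂ • y₁ + c₁ • y₂, Y.add_mem (Y.smul_mem _ hy₁) (Y.smul_mem _ hy₂), ?_, ?_⟩
    · rw [map_mul]
      exact hc₁.mul hc₂
    · rw [map_add, mres_smul, mres_smul, he₁, he₂, map_mul, map_add, smul_add, ← mul_smul,
        ← mul_smul, mul_comm (rres _ c₂)]
  smul_mem' r e he := fun g h => by
    obtain ⟨c, y, hy, hc, he⟩ := he g h
    obtain ⟨n, a, ha⟩ := exists_rres_eq hV₀ g (rres h r)
    refine ⟨g ^ n * c, a • y, Y.smul_mem _ hy, ?_, ?_⟩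
    · rw [map_mul, map_pow]
      exact ((isUnit_rres g le_rfl).pow n).mul hc
    · rw [mres_smul, he, ha, mres_smul, map_mul, map_pow, ← mul_smul, ← mul_smul]
      congr 1
      ring

/-- After clearing a denominator the section becomes some `e₁` over `V₀`. The multipliers taking
`e₁` into `Y` form an ideal, and local membership says that the basic opens of its elements cover
that of `g`. -/
lemma locMem_of_local (hE : qcoh X E) (hV₀ : IsAffineOpen V₀) {V : X.Opens} {e : Γ(E, V)}
    (h : ∀ x ∈ V, x ∈ V₀ → ∃ (V' : X.Opens) (h : V' ≤ V), x ∈ V' ∧ LocMem Y V' (mres E h e)) :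
    LocMem Y V e := fun g hg => by
  obtain ⟨n, e₁, he₁⟩ := ((qcoh_iff_locAt E).1 hE V₀ hV₀ g).2 (mres E hg e)
  obtain ⟨m, hm⟩ := mem_of_forall_point hV₀
    (Y.comap (LinearMap.toSpanSingleton Γ(X, V₀) Γ(E, V₀) e₁)) g fun x hx => by
      obtain ⟨V', hV', hxV', he⟩ := h x (hg hx) (X.basicOpen_le g hx)
      obtain ⟨g', hg', hxg'⟩ := hV₀.exists_basicOpen_le (V := V' ⊓ X.basicOpen g)
        ⟨x, hxV', hx⟩ (X.basicOpen_le g hx)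
      obtain ⟨c, y, hy, hc, hye⟩ := he g' (hg'.trans inf_le_left)
      obtain ⟨m, hm⟩ := exists_pow_smul_mem (Y := Y) (g := g') (e := e₁) hE hV₀
        (Y.smul_mem (g ^ n) hy) hc (by
          have h1 := congrArg (mres E (hg'.trans inf_le_right)) he₁
          rw [mres_mres, mres_smul, mres_mres, map_pow, rres_rres] at h1
          rw [mres_smul, hye, h1, mres_mres, map_pow, ← mul_smul, ← mul_smul, mul_comm])
      refine ⟨g' ^ (m + 1), ?_, ?_⟩
      · change g' ^ (m + 1) • e₁ ∈ Y
        rw [pow_succ', mul_smul]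
        exact Y.smul_mem _ hm
      · rw [X.basicOpen_pow g' m.succ_pos]
        exact hxg'
  refine ⟨g ^ (m + n), g ^ m • e₁, hm, ?_, ?_⟩
  · rw [map_pow]
    exact (isUnit_rres g le_rfl).pow _
  · rw [mres_smul, he₁, map_pow, map_pow, pow_add, mul_smul]

/-- Near `x` write `f = a / g ^ k` and `e = e₁ / g ^ l` with `a`, `e₁` over `V₀`. Membership of `e`
where `f` is invertible gives `(a g) ^ m e₁ ∈ Y`, so the exponent `m` works for `f`. It depends on
`x`. -/
lemma exists_locMem_pow (hE : qcoh X E) (hV₀ : IsAffineOpen V₀) {V : X.Opens} (f : Γ(X, V))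
    (e : Γ(E, V)) (h : LocMem Y (X.basicOpen f) (mres E (X.basicOpen_le f) e)) {x : X}
    (hx : x ∈ V ⊓ V₀) : ∃ (V' : X.Opens) (h : V' ≤ V) (n : ℕ), x ∈ V' ∧ V' ≤ V ⊓ V₀ ∧
      LocMem Y V' (mres E h (f ^ n • e)) := by
  obtain ⟨g, hg, hxg⟩ := hV₀.exists_basicOpen_le (V := V) ⟨x, hx.1⟩ hx.2
  obtain ⟨k, a, ha⟩ := exists_rres_eq hV₀ g (rres hg f)
  obtain ⟨l, e₁, he₁⟩ := ((qcoh_iff_locAt E).1 hE V₀ hV₀ g).2 (mres E hg e)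
  have hag : X.basicOpen (a * g) ≤ X.basicOpen g := by
    rw [X.basicOpen_mul]
    exact inf_le_right
  have haf : X.basicOpen (a * g) ≤ X.basicOpen f := by
    have h1 : X.basicOpen (rres (X.basicOpen_le g) a) = X.basicOpen g ⊓ X.basicOpen a :=
      X.basicOpen_res a (homOfLE (X.basicOpen_le g)).op
    have h2 : X.basicOpen (rres hg f) = X.basicOpen g ⊓ X.basicOpen f :=
      X.basicOpen_res f (homOfLE hg).op
    rw [X.basicOpen_mul, inf_comm, ← h1, ha, X.basicOpen_mul, h2]
    exact inf_le_right.trans inf_le_right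
  obtain ⟨c, y, hy, hc, hye⟩ := h (a * g) haf
  obtain ⟨m, hm⟩ := exists_pow_smul_mem (Y := Y) (g := a * g) (e := e₁) hE hV₀
    (Y.smul_mem (g ^ l) hy) hc (by
      have h1 := congrArg (mres E hag) he₁
      rw [mres_mres, mres_smul, mres_mres, map_pow, rres_rres] at h1
      rw [mres_smul, hye, h1, mres_mres, map_pow, ← mul_smul, ← mul_smul, mul_comm (rres _ g ^ l)])
  refine ⟨X.basicOpen g, hg, m, hxg, le_inf hg (X.basicOpen_le g), fun g' hg' => ?_⟩
  -- On the basic open set `a = g ^ k f` and `e₁ = g ^ l e`, hence `(a g) ^ m e₁ = g ^ (k m + m + l)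
  -- f ^ m e`.
  refine ⟨g ^ (k * m + m + l), _, hm, ?_, ?_⟩
  · rw [map_pow]
    exact (isUnit_rres g hg').pow _
  · have h1 := congrArg (mres E hg') he₁
    rw [mres_mres, mres_smul, mres_mres, map_pow, rres_rres] at h1
    have h2 := congrArg (rres hg') ha
    rw [map_mul, map_pow, rres_rres, rres_rres, rres_rres] at h2
    rw [mres_smul, h1, mres_mres, mres_smul, map_pow, map_pow, map_pow, map_mul, h2, ← mul_smul,
      ← mul_smul]
    congr 1
    ring

end LocalMembership

/-! ### Uniform exponents by compactness -/

section Compactness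
variable {X : Scheme.{u}} {E : X.Modules}

lemma exists_uniform_pow (N : ∀ V : X.Opens, Submodule Γ(X, V) Γ(E, V)) {V T : X.Opens}
    (hT : IsCompact (T : Set X)) (f : Γ(X, V)) (e : Γ(E, V))
    (h : ∀ x ∈ T, ∃ (V' : X.Opens) (h : V' ≤ V) (n : ℕ), x ∈ V' ∧ V' ≤ T ∧
      mres E h (f ^ n • e) ∈ N V') :
    ∃ n : ℕ, ∀ x ∈ T, ∃ (V' : X.Opens) (h : V' ≤ V), x ∈ V' ∧ V' ≤ T ∧
      mres E h (f ^ n • e) ∈ N V' := by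
  have hmono {n m : ℕ} (hnm : n ≤ m) {V' : X.Opens} (h : V' ≤ V)
      (hn : mres E h (f ^ n • e) ∈ N V') : mres E h (f ^ m • e) ∈ N V' := by
    obtain ⟨d, rfl⟩ := Nat.exists_eq_add_of_le' hnm
    rw [pow_add, mul_smul, mres_smul]
    exact (N V').smul_mem _ hn
  refine hT.induction_on (p := fun s => ∃ n : ℕ, ∀ x ∈ s, ∃ (V' : X.Opens) (h : V' ≤ V), x ∈ V' ∧
    V' ≤ T ∧ mres E h (f ^ n • e) ∈ N V') ⟨0, by simp⟩ ?_ ?_ ?_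
  · rintro s t hst ⟨n, hn⟩
    exact ⟨n, fun x hx => hn x (hst hx)⟩
  · rintro s t ⟨n, hn⟩ ⟨m, hm⟩
    refine ⟨max n m, fun x hx => ?_⟩
    rcases hx with hx | hx
    · obtain ⟨V', h, hxV, hVT, hV'⟩ := hn x hx
      exact ⟨V', h, hxV, hVT, hmono (le_max_left _ _) h hV'⟩
    · obtain ⟨V', h, hxV, hVT, hV'⟩ := hm x hx
      exact ⟨V', h, hxV, hVT, hmono (le_max_right _ _) h hV'⟩
  · intro x hx
    obtain ⟨V', h, n, hxV, hVT, hV'⟩ := h x hx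
    exact ⟨V', mem_nhdsWithin_of_mem_nhds (V'.isOpen.mem_nhds hxV), n,
      fun y hy => ⟨V', h, hy, hVT, hV'⟩⟩

end Compactness

/-! ### Extension of quasi-coherent submodules which meet a kernel trivially -/

section QuasicoherentSubmodules
variable {X : Scheme.{u}}

/-- An affine open of a locally Noetherian scheme is a Noetherian space, in which all subsets are
quasi-compact. -/
lemma isCompact_of_le_affine [IsLocallyNoetherian X] {V T : X.Opens} (hV : IsAffineOpen V)
    (h : T ≤ V) : IsCompact (T : Set X) := by
  have : IsNoetherianRing Γ(X, V) := IsLocallyNoetherian.component_noetherian ⟨V, hV⟩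
  have hn : NoetherianSpace (V : Set X) := noetherianSpace_of_isAffineOpen V hV
  have h1 : IsCompact ((Subtype.val : ↥(V : Set X) → X) ⁻¹' T) := NoetherianSpace.isCompact _
  have h2 := h1.image continuous_subtype_val
  rwa [Subtype.image_preimage_coe, Set.inter_eq_right.2 h] at h2

/-- A quasi-coherent submodule of the restriction of `E` to `W`. -/
structure QSub (E : X.Modules) (W : X.Opens) where
  car : ∀ V : X.Opens, Submodule Γ(X, V) Γ(E, V)
  res {V V' : X.Opens} (h : V' ≤ V) : V ≤ W → ∀ e ∈ car V, mres E h e ∈ car V'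
  glue {V : X.Opens} : V ≤ W → ∀ e : Γ(E, V), (∀ x ∈ V, ∃ (V' : X.Opens) (h : V' ≤ V), x ∈ V' ∧
    mres E h e ∈ car V') → e ∈ car V
  pow {V : X.Opens} : V ≤ W → IsAffineOpen V → ∀ (f : Γ(X, V)) (e : Γ(E, V)),
    mres E (X.basicOpen_le f) e ∈ car (X.basicOpen f) → ∃ n : ℕ, f ^ n • e ∈ car V

namespace QSub
variable {E L : X.Modules} {W : X.Opens} (p : E ⟶ L) (N : QSub E W)

/-- The submodule meets the kernel of `p` trivially. -/
def DisjKer : Prop := ∀ V ≤ W, ∀ e ∈ N.car V, p.app V e = 0 → e = 0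

variable {N}

lemma mem_of_le {V V' : X.Opens} (hV : V ≤ W) (h : V' ≤ V) (h' : V ≤ V') (e : Γ(E, V))
    (he : mres E h e ∈ N.car V') : e ∈ N.car V :=
  N.glue hV e fun _ hx => ⟨V', h, h' hx, he⟩

/-- The submodule is only controlled on affine opens inside `W`; compactness of `V ⊓ W` makes the
exponents found there uniform. -/
lemma exists_pow_inf {V : X.Opens} (hVW : IsCompact ((V ⊓ W : X.Opens) : Set X))
    (f : Γ(X, V)) (e : Γ(E, V)) (he : mres E (inf_le_left.trans (X.basicOpen_le f)) e ∈
      N.car (X.basicOpen f ⊓ W)) : ∃ n : ℕ, mres E inf_le_left (f ^ n • e) ∈ N.car (V ⊓ W) := by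
  obtain ⟨n, hn⟩ := exists_uniform_pow N.car hVW f e fun x hx => by
    obtain ⟨A, hA, hxA, hAV⟩ := exists_isAffineOpen_mem_and_subset (U := V ⊓ W) hx
    have hAV' : A ≤ V ⊓ W := hAV
    have hb : X.basicOpen (rres (hAV'.trans inf_le_left) f) = A ⊓ X.basicOpen f :=
      X.basicOpen_res f (homOfLE (hAV'.trans inf_le_left)).op
    obtain ⟨n, hn⟩ := N.pow (hAV'.trans inf_le_right) hA (rres (hAV'.trans inf_le_left) f)
      (mres E (hAV'.trans inf_le_left) e) (by
        have h1 : X.basicOpen (rres (hAV'.trans inf_le_left) f) ≤ X.basicOpen f ⊓ W := by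
          rw [hb]
          exact le_inf inf_le_right (inf_le_left.trans (hAV'.trans inf_le_right))
        have h2 := N.res h1 inf_le_right _ he
        rw [mres_mres] at h2 ⊢
        exact h2)
    refine ⟨A, hAV'.trans inf_le_left, n, hxA, hAV', ?_⟩
    rw [mres_smul, map_pow]
    exact hn
  refine ⟨n, N.glue inf_le_right _ fun x hx => ?_⟩
  obtain ⟨V', h, hxV, hVT, hV'⟩ := hn x hx
  refine ⟨V', hVT, hxV, ?_⟩
  rw [mres_mres]
  exact hV'

variable (N) in
/-- The sections over `V₀` whose restriction to `W` belongs to `N`. -/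
def inter (V₀ : X.Opens) : Submodule Γ(X, V₀) Γ(E, V₀) where
  carrier := {e | mres E inf_le_left e ∈ N.car (V₀ ⊓ W)}
  zero_mem' := by
    rw [Set.mem_ofPred_eq, map_zero]
    exact zero_mem _
  add_mem' ha hb := by
    rw [Set.mem_ofPred_eq, map_add]
    exact add_mem ha hb
  smul_mem' r e he := by
    rw [Set.mem_ofPred_eq, mres_smul]
    exact Submodule.smul_mem _ _ he

lemma mem_inter {V₀ : X.Opens} {e : Γ(E, V₀)} :
    e ∈ N.inter V₀ ↔ mres E inf_le_left e ∈ N.car (V₀ ⊓ W) := Iff.rfl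

/-- There is a maximal submodule of `N.inter V₀` which meets the kernel of `p` trivially. -/
lemma exists_maximal (N : QSub E W) (V₀ : X.Opens) : ∃ Y : Submodule Γ(X, V₀) Γ(E, V₀),
    Maximal (fun Y => Y ≤ N.inter V₀ ∧ ∀ y ∈ Y, p.app V₀ y = 0 → y = 0) Y := by
  obtain ⟨Y, -, hY⟩ := zorn_le_nonempty₀ {Y : Submodule Γ(X, V₀) Γ(E, V₀) |
    Y ≤ N.inter V₀ ∧ ∀ y ∈ Y, p.app V₀ y = 0 → y = 0} (fun c hc hch Y hY => by
      refine ⟨sSup c, ⟨sSup_le fun Z hZ => (hc hZ).1, fun y hy hpy => ?_⟩,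
        fun Z hZ => le_sSup hZ⟩
      obtain ⟨Z, hZ, hyZ⟩ := (Submodule.mem_sSup_of_directed ⟨Y, hY⟩ hch.directedOn).1 hy
      exact (hc hZ).2 y hyZ hpy) ⊥ ⟨bot_le, fun y hy _ => (Submodule.mem_bot _).1 hy⟩
  exact ⟨Y, hY⟩

variable {p}

/-- The heart of the extension argument: the maximal `Y` still generates `N` on basic opens inside
`W`. If the ideals `{a | a g ^ n e ∈ Y}` stabilize at `n`, then `Y + (g ^ n e)` still meets the
kernel of `p` trivially, and maximality gives `g ^ n e ∈ Y`. -/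
lemma exists_pow_mem_of_maximal (hN : N.DisjKer p) (hE : qcoh X E) {V₀ : X.Opens}
    (hV₀ : IsAffineOpen V₀) [IsNoetherianRing Γ(X, V₀)] {Y : Submodule Γ(X, V₀) Γ(E, V₀)}
    (hY : Maximal (fun Y => Y ≤ N.inter V₀ ∧ ∀ y ∈ Y, p.app V₀ y = 0 → y = 0) Y)
    {g : Γ(X, V₀)} (hg : X.basicOpen g ≤ W) {e : Γ(E, V₀)} (he : e ∈ N.inter V₀) :
    ∃ n : ℕ, g ^ n • e ∈ Y := by
  let K : ℕ →o Ideal Γ(X, V₀) :=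
    { toFun := fun n => Y.comap (LinearMap.toSpanSingleton Γ(X, V₀) Γ(E, V₀) (g ^ n • e))
      monotone' := monotone_nat_of_le_succ fun n a (ha : a • g ^ n • e ∈ Y) => by
        change a • g ^ (n + 1) • e ∈ Y
        rw [pow_succ', mul_smul, smul_comm]
        exact Y.smul_mem _ ha }
  obtain ⟨n, hn⟩ := (monotone_stabilizes_iff_noetherian (R := Γ(X, V₀)) (M := Γ(X, V₀))).2
    inferInstance K
  refine ⟨n, by_contra fun hne => hne ?_⟩
  have hle : Y ≤ Y ⊔ Submodule.span Γ(X, V₀) {g ^ n • e} := le_sup_left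
  suffices h : Y ⊔ Submodule.span Γ(X, V₀) {g ^ n • e} ≤ Y from
    h (Submodule.mem_sup_right (Submodule.mem_span_singleton_self _))
  have hi : Y ⊔ Submodule.span Γ(X, V₀) {g ^ n • e} ≤ N.inter V₀ := by
    refine sup_le hY.prop.1 ((Submodule.span_singleton_le_iff_mem _ _).2 ?_)
    exact Submodule.smul_mem _ _ he
  refine hY.2 ⟨hi, fun z hz hpz => ?_⟩ hle
  -- An element `z = y + a g ^ n e` of the kernel vanishes on `V₀ ⊓ W`, as `N` avoids the kernel, so
  -- a power `g ^ k` kills it. Then `a` lies in the ideal of index `n + k`, hence in that of index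
  -- `n`, so `z` lies in `Y`.
  have hz0 : mres E (inf_le_left : V₀ ⊓ W ≤ V₀) z = 0 :=
    hN _ inf_le_right _ (hi hz) (by rw [app_mres, hpz, map_zero])
  obtain ⟨k, hk⟩ := ((qcoh_iff_locAt E).1 hE V₀ hV₀ g).1 z (by
    rw [← mres_mres E inf_le_left (le_inf (X.basicOpen_le g) hg), hz0, map_zero])
  obtain ⟨y, hy, w, hw, rfl⟩ := Submodule.mem_sup.1 hz
  obtain ⟨a, rfl⟩ := Submodule.mem_span_singleton.1 hw
  have h1 : a ∈ K (n + k) := by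
    change a • g ^ (n + k) • e ∈ Y
    rw [smul_add, ← eq_neg_iff_add_eq_zero, eq_comm, neg_eq_iff_eq_neg] at hk
    rw [pow_add, mul_comm, mul_smul, smul_comm a, hk]
    exact Y.neg_mem (Y.smul_mem _ hy)
  rw [← hn (n + k) (Nat.le_add_right _ _)] at h1
  exact hY.prop.2 _ (Y.add_mem hy h1) hpz

/-- Extension of a quasi-coherent submodule by a submodule of the sections over an affine open. -/
def extend (N : QSub E W) (hE : qcoh X E) {V₀ : X.Opens} (hV₀ : IsAffineOpen V₀)
    (hc : ∀ V : X.Opens, IsAffineOpen V → ∀ T ≤ V, IsCompact (T : Set X))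
    (Y : Submodule Γ(X, V₀) Γ(E, V₀)) : QSub E (W ⊔ V₀) where
  car V := N.inter V ⊓ locSub Y hV₀ V
  res {V V'} h hV e he := by
    refine ⟨?_, LocMem.res h he.2⟩
    have h1 := N.res (inf_le_inf_right W h) inf_le_right _ (mem_inter.1 he.1)
    rw [mres_mres] at h1
    refine mem_inter.2 ?_
    rw [mres_mres]
    exact h1
  glue {V} hV e he := by
    refine ⟨N.glue inf_le_right _ fun x hx => ?_, locMem_of_local hE hV₀ fun x hx _ => ?_⟩
    · obtain ⟨V', h, hxV', he'⟩ := he x hx.1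
      refine ⟨V' ⊓ W, inf_le_inf_right W h, ⟨hxV', hx.2⟩, ?_⟩
      have h1 := mem_inter.1 he'.1
      rw [mres_mres] at h1 ⊢
      exact h1
    · obtain ⟨V', h, hxV', he'⟩ := he x hx
      exact ⟨V', h, hxV', he'.2⟩
  pow {V} hV hVa f e he := by
    obtain ⟨n, hn⟩ := N.exists_pow_inf (hc V hVa _ inf_le_left) f e (by
      have h1 := mem_inter.1 he.1
      rw [mres_mres] at h1
      exact h1)
    obtain ⟨m, hm⟩ := exists_uniform_pow (locSub Y hV₀) (T := V ⊓ V₀) (hc V hVa _ inf_le_left) f e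
      fun x hx => exists_locMem_pow hE hV₀ f e he.2 hx
    refine ⟨n + m, ?_, ?_⟩
    · rw [add_comm, pow_add, mul_smul]
      exact (N.inter V).smul_mem _ hn
    · rw [pow_add, mul_smul]
      refine (locSub Y hV₀ V).smul_mem _ (locMem_of_local hE hV₀ fun x hx hx₀ => ?_)
      obtain ⟨V', h, hxV', -, hV'⟩ := hm x ⟨hx, hx₀⟩
      exact ⟨V', h, hxV', hV'⟩

/-- On `W` this is the property of `N`. Near a point of `V₀` a section in the kernel is, up to a
unit, an element `y` of `Y`; some `g ^ k y` is killed by `p` over all of `V₀`, hence zero. -/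
lemma extend_disjKer (hN : N.DisjKer p) (hE : qcoh X E) (hL : qcoh X L) {V₀ : X.Opens}
    (hV₀ : IsAffineOpen V₀) (hc : ∀ V : X.Opens, IsAffineOpen V → ∀ T ≤ V, IsCompact (T : Set X))
    {Y : Submodule Γ(X, V₀) Γ(E, V₀)} (hY : ∀ y ∈ Y, p.app V₀ y = 0 → y = 0) :
    (N.extend hE hV₀ hc Y).DisjKer p := fun V hV e he hpe => by
  refine mres_eq_of_cover E (ι := {V' : X.Opens // ∃ h : V' ≤ V, mres E h e = 0}) (fun V' => V'.1)
    (fun V' => V'.2.choose) (fun x hx => ?_) e 0 fun V' => by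
      rw [map_zero]
      exact V'.2.choose_spec
  suffices h : ∃ (V' : X.Opens) (h : V' ≤ V), x ∈ V' ∧ mres E h e = 0 by
    obtain ⟨V', h, hx, h0⟩ := h
    exact Opens.mem_iSup.2 ⟨⟨V', h, h0⟩, hx⟩
  rcases hV hx with hxW | hxV₀
  · exact ⟨V ⊓ W, inf_le_left, ⟨hx, hxW⟩, hN _ inf_le_right _ he.1 (by
      rw [app_mres, hpe, map_zero])⟩
  · obtain ⟨g, hg, hxg⟩ := hV₀.exists_basicOpen_le (V := V) ⟨x, hx⟩ hxV₀
    obtain ⟨c, y, hy, hcu, hye⟩ := he.2 g hg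
    refine ⟨X.basicOpen g, hg, hxg, ?_⟩
    obtain ⟨k, hk⟩ := ((qcoh_iff_locAt L).1 hL V₀ hV₀ g).1 (p.app V₀ y) (by
      rw [← app_mres, hye, Scheme.Modules.Hom.app_smul, app_mres, hpe, map_zero, smul_zero])
    have h1 := hY (g ^ k • y) (Y.smul_mem _ hy) (by
      rw [Scheme.Modules.Hom.app_smul, hk])
    have h2 := congrArg (mres E (X.basicOpen_le g)) h1
    rw [mres_smul, map_zero, map_pow, hye, ← mul_smul] at h2
    exact (((isUnit_rres g le_rfl).pow k).mul hcu).smul_eq_zero.1 h2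

/-- The new condition, local membership in `Y`, is no restriction over `W`: by maximality of `Y`,
sections of `N` satisfy it once denominators are cleared. -/
lemma mem_extend_iff (hN : N.DisjKer p) (hE : qcoh X E) {V₀ : X.Opens}
    (hV₀ : IsAffineOpen V₀) [IsNoetherianRing Γ(X, V₀)]
    (hc : ∀ V : X.Opens, IsAffineOpen V → ∀ T ≤ V, IsCompact (T : Set X))
    {Y : Submodule Γ(X, V₀) Γ(E, V₀)}
    (hY : Maximal (fun Y => Y ≤ N.inter V₀ ∧ ∀ y ∈ Y, p.app V₀ y = 0 → y = 0) Y)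
    {V : X.Opens} (hV : V ≤ W) (e : Γ(E, V)) :
    e ∈ (N.extend hE hV₀ hc Y).car V ↔ e ∈ N.car V := by
  constructor
  · exact fun he => N.mem_of_le hV inf_le_left (le_inf le_rfl hV) e he.1
  · intro he
    refine ⟨N.res inf_le_left hV e he, fun g hg => ?_⟩
    obtain ⟨n, e₁, he₁⟩ := ((qcoh_iff_locAt E).1 hE V₀ hV₀ g).2 (mres E hg e)
    obtain ⟨k, hk⟩ := N.exists_pow_inf (hc V₀ hV₀ _ inf_le_left) g e₁ (by
      have h1 := congrArg (mres E (inf_le_left : X.basicOpen g ⊓ W ≤ _)) he₁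
      rw [mres_mres] at h1
      rw [h1, mres_smul, mres_mres]
      exact (N.car _).smul_mem _ (N.res _ hV e he))
    obtain ⟨l, hl⟩ := exists_pow_mem_of_maximal hN hE hV₀ hY (hg.trans hV) (N.mem_inter.2 hk)
    refine ⟨g ^ (l + k + n), _, hl, ?_, ?_⟩
    · rw [map_pow]
      exact (isUnit_rres g le_rfl).pow _
    · rw [mres_smul, mres_smul, he₁, map_pow, map_pow, map_pow, ← mul_smul, ← mul_smul, pow_add,
        pow_add, mul_assoc]

end QSub

/-- A quasi-coherent submodule of the restriction of `E` to some open set, which meets the kernel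
of `p` trivially. -/
structure PartialQSub {E L : X.Modules} (p : E ⟶ L) where
  W : X.Opens
  N : QSub E W
  disj : N.DisjKer p

namespace PartialQSub
variable {E L : X.Modules} {p : E ⟶ L}

/-- The extension relation. -/
def Ext (a b : PartialQSub p) : Prop :=
  a.W ≤ b.W ∧ ∀ V ≤ a.W, ∀ e : Γ(E, V), e ∈ a.N.car V ↔ e ∈ b.N.car V

lemma Ext.refl (a : PartialQSub p) : a.Ext a := ⟨le_rfl, fun _ _ _ => Iff.rfl⟩

lemma Ext.trans {a b c : PartialQSub p} (h : a.Ext b) (h' : b.Ext c) : a.Ext c :=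
  ⟨h.1.trans h'.1, fun V hV e => (h.2 V hV e).trans (h'.2 V (hV.trans h.1) e)⟩

/-- For two members of a chain, membership in one already implies the condition of the other on its
domain, whichever is larger. This lets the union be described by an intersection of conditions. -/
lemma mem_of_chain {c : Set (PartialQSub p)} (hc : IsChain Ext c) {a b : PartialQSub p} (ha : a ∈ c)
    (hb : b ∈ c) {V : X.Opens} (hV : V ≤ a.W) {e : Γ(E, V)} (he : e ∈ a.N.car V) :
    e ∈ b.N.inter V := by
  rcases eq_or_ne a b with rfl | hab
  · exact a.N.res inf_le_left hV e he
  · rcases hc ha hb hab with h | h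
    · exact b.N.res inf_le_left (hV.trans h.1) e ((h.2 V hV e).1 he)
    · exact (h.2 _ inf_le_right _).2 (a.N.res inf_le_left hV e he)

lemma exists_le_of_isCompact {c : Set (PartialQSub p)} (hc : IsChain Ext c) (hne : c.Nonempty)
    {V : X.Opens} (hV : V ≤ ⨆ a : c, a.1.W) (hVc : IsCompact (V : Set X)) : ∃ a ∈ c, V ≤ a.W := by
  have := hne.to_subtype
  have hdir : Directed (· ⊆ ·) fun a : c => (a.1.W : Set X) := fun a b => by
    rcases eq_or_ne a b with rfl | hab
    · exact ⟨a, subset_rfl, subset_rfl⟩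
    · rcases hc a.2 b.2 (fun h => hab (Subtype.ext h)) with h | h
      · exact ⟨b, h.1, subset_rfl⟩
      · exact ⟨a, subset_rfl, h.1⟩
  obtain ⟨a, ha⟩ := hVc.elim_directed_cover _ (fun a => a.1.W.isOpen) (fun x hx => by
    obtain ⟨a, ha⟩ := Opens.mem_iSup.1 (hV hx)
    exact Set.mem_iUnion.2 ⟨a, ha⟩) hdir
  exact ⟨a.1, a.2, ha⟩

/-- The union of a chain. -/
def union (c : Set (PartialQSub p)) (hc : IsChain Ext c) (hne : c.Nonempty) : PartialQSub p where
  W := ⨆ a : c, a.1.W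
  N :=
    -- A section belongs to the union when each restriction to a domain `a.W` belongs to `a.N`;
    -- written this way, gluing is immediate.
    { car := fun V => ⨅ a : c, a.1.N.inter V
      res := fun {V V'} h hV e he => by
        refine (Submodule.mem_iInf _).2 fun a => ?_
        have h1 := a.1.N.res (inf_le_inf_right _ h) inf_le_right _ ((Submodule.mem_iInf _).1 he a)
        rw [mres_mres] at h1
        rw [QSub.mem_inter, mres_mres]
        exact h1
      glue := fun {V} hV e he => by
        refine (Submodule.mem_iInf _).2 fun a => a.1.N.glue inf_le_right _ fun x hx => ?_
        obtain ⟨V', h, hxV', he'⟩ := he x hx.1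
        refine ⟨V' ⊓ a.1.W, inf_le_inf_right _ h, ⟨hxV', hx.2⟩, ?_⟩
        have h1 := (Submodule.mem_iInf _).1 he' a
        rw [QSub.mem_inter, mres_mres] at h1
        rw [mres_mres]
        exact h1
      pow := fun {V} hV hVa f e he => by
        -- An affine open is quasi-compact, so it lies in the domain of a single member of the
        -- chain, which supplies the exponent.
        obtain ⟨a, ha, hVa'⟩ := exists_le_of_isCompact hc hne hV hVa.isCompact
        have h1 := (Submodule.mem_iInf _).1 he ⟨a, ha⟩
        obtain ⟨n, hn⟩ := a.N.pow hVa' hVa f e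
          (a.N.mem_of_le ((X.basicOpen_le f).trans hVa') inf_le_left
            (le_inf le_rfl ((X.basicOpen_le f).trans hVa')) _ h1)
        exact ⟨n, (Submodule.mem_iInf _).2 fun b => mem_of_chain hc ha b.2 hVa' hn⟩ }
  disj V hV e he hpe := by
    refine mres_eq_of_cover E (fun a : c => V ⊓ a.1.W) (fun a => inf_le_left) (by
      rw [← inf_iSup_eq]
      exact le_inf le_rfl hV) e 0 fun a => ?_
    rw [map_zero]
    exact a.1.disj _ inf_le_right _ ((Submodule.mem_iInf _).1 he a) (by
      rw [app_mres, hpe, map_zero])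

lemma ext_union {c : Set (PartialQSub p)} (hc : IsChain Ext c) (hne : c.Nonempty)
    {a : PartialQSub p} (ha : a ∈ c) : a.Ext (union c hc hne) := by
  refine ⟨le_iSup (fun a : c => a.1.W) ⟨a, ha⟩, fun V hV e => ⟨fun he => ?_, fun he => ?_⟩⟩
  · exact (Submodule.mem_iInf _).2 fun b => mem_of_chain hc ha b.2 hV he
  · exact a.N.mem_of_le hV inf_le_left (le_inf le_rfl hV) _ ((Submodule.mem_iInf _).1 he ⟨a, ha⟩)

/-- On a locally Noetherian scheme, quasi-coherent submodules which meet the kernel of `p`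
trivially extend to the whole scheme. -/
lemma exists_ext_top [IsLocallyNoetherian X] (hE : qcoh X E) (hL : qcoh X L)
    (a : PartialQSub p) : ∃ b : PartialQSub p, a.Ext b ∧ b.W = ⊤ := by
  have hc : ∀ V : X.Opens, IsAffineOpen V → ∀ T ≤ V, IsCompact (T : Set X) :=
    fun V hV T hT => isCompact_of_le_affine hV hT
  obtain ⟨b, hb⟩ := exists_maximal_of_chains_bounded (α := {b : PartialQSub p // a.Ext b})
    (r := fun b b' => b.1.Ext b'.1) (fun c hc => by
      rcases c.eq_empty_or_nonempty with rfl | hne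
      · exact ⟨⟨a, .refl a⟩, by simp⟩
      · have hc' : IsChain Ext (Subtype.val '' c) := by
          rintro _ ⟨x, hx, rfl⟩ _ ⟨y, hy, rfl⟩ hxy
          exact hc hx hy fun h => hxy (by rw [h])
        obtain ⟨x, hx⟩ := hne
        exact ⟨⟨union _ hc' ⟨x.1, x, hx, rfl⟩, x.2.trans (ext_union hc' _ ⟨x, hx, rfl⟩)⟩,
          fun y hy => ext_union hc' ⟨x.1, x, hx, rfl⟩ ⟨y, hy, rfl⟩⟩) fun h h' => h.trans h'
  refine ⟨b.1, b.2, top_le_iff.1 fun x _ => ?_⟩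
  obtain ⟨V₀, hV₀, hx, -⟩ := exists_isAffineOpen_mem_and_subset (U := (⊤ : X.Opens)) (x := x) trivial
  have : IsNoetherianRing Γ(X, V₀) := IsLocallyNoetherian.component_noetherian ⟨V₀, hV₀⟩
  -- At a point outside the domain of a maximal extension, adjoining an affine neighbourhood with
  -- such a `Y` gives a strictly larger one.
  obtain ⟨Y, hY⟩ := QSub.exists_maximal p b.1.N V₀
  let b' : PartialQSub p := ⟨b.1.W ⊔ V₀, b.1.N.extend hE hV₀ hc Y,
    QSub.extend_disjKer b.1.disj hE hL hV₀ hc hY.prop.2⟩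
  have hbb' : b.1.Ext b' := ⟨le_sup_left, fun V hV e =>
    (QSub.mem_extend_iff b.1.disj hE hV₀ hc hY hV e).symm⟩
  exact (hb ⟨b', b.2.trans hbb'⟩ hbb').1 (le_sup_right (a := b.1.W) hx)

end PartialQSub
end QuasicoherentSubmodules

/-! ### Modules from quasi-coherent submodules, and graphs of sections -/

section SubmoduleSheaf
variable {X : Scheme.{u}} {E : X.Modules}

namespace QSub

/-- The presheaf of submodules given by a quasi-coherent submodule. -/
def psub (N : QSub E ⊤) : PresheafOfModules.Submodule E.val where
  obj V := N.car V.unop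
  map f := fun e he => N.res (leOfHom f.unop) le_top e he

lemma psub_isSheaf (N : QSub E ⊤) : TopCat.Presheaf.IsSheaf (C := Ab.{u}) (X := X)
    N.psub.toPresheafOfModules.presheaf := by
  refine (TopCat.Presheaf.isSheaf_iff_isSheafUniqueGluing _).2 fun ι U sf hsf => ?_
  let sf' (i : ι) : N.car (U i) := sf i
  obtain ⟨t, ht⟩ := mres_glue E U (fun i => le_iSup U i) le_rfl (fun i => (sf' i).1)
    (fun i j => congrArg (fun z : N.car (U i ⊓ U j) => z.1) (hsf i j))
  have htN : t ∈ N.car (iSup U) := N.glue le_top t fun x hx => by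
    obtain ⟨i, hi⟩ := Opens.mem_iSup.1 hx
    refine ⟨U i, le_iSup U i, hi, ?_⟩
    rw [ht i]
    exact (sf' i).2
  refine ⟨(⟨t, htN⟩ : N.car (iSup U)), fun i => Subtype.ext (ht i), fun s hs => ?_⟩
  let s' : N.car (iSup U) := s
  refine Subtype.ext (a1 := s') (mres_eq_of_cover E U (fun i => le_iSup U i) le_rfl _ _ fun i => ?_)
  exact (congrArg (fun z : N.car (U i) => z.1) (hs i)).trans (ht i).symm

/-- The module given by a quasi-coherent submodule. -/
def toMod (N : QSub E ⊤) : X.Modules := ⟨N.psub.toPresheafOfModules, N.psub_isSheaf⟩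

/-- The inclusion of a quasi-coherent submodule. -/
def ι (N : QSub E ⊤) : N.toMod ⟶ E := ⟨N.psub.ι⟩

/-- A section which belongs to the submodule. -/
def mkSec (N : QSub E ⊤) {V : X.Opens} (e : Γ(E, V)) (he : e ∈ N.car V) : Γ(N.toMod, V) :=
  (⟨e, he⟩ : N.car V)

lemma ι_mkSec (N : QSub E ⊤) {V : X.Opens} (e : Γ(E, V)) (he : e ∈ N.car V) :
    N.ι.app V (N.mkSec e he) = e := rfl

lemma ι_mem (N : QSub E ⊤) {V : X.Opens} (s : Γ(N.toMod, V)) : N.ι.app V s ∈ N.car V :=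
  (show N.car V from s).2

lemma ι_injective (N : QSub E ⊤) (V : X.Opens) : Function.Injective (N.ι.app V) := fun a b h =>
  Subtype.ext (a1 := (show N.car V from a)) (a2 := (show N.car V from b)) h

/-- Torsion and denominators are handled in `E`; the power condition in `QSub` returns the numerator
to the submodule. -/
lemma qcoh_toMod (N : QSub E ⊤) (hE : qcoh X E) : qcoh X N.toMod := by
  refine (qcoh_iff_locAt _).2 fun V hV f => ⟨fun s hs => ?_, fun t => ?_⟩
  · obtain ⟨n, hn⟩ := ((qcoh_iff_locAt E).1 hE V hV f).1 (N.ι.app V s) (by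
      rw [← app_mres, hs, map_zero])
    refine ⟨n, N.ι_injective V ?_⟩
    rw [Scheme.Modules.Hom.app_smul, hn, map_zero]
  · obtain ⟨n, e, he⟩ := ((qcoh_iff_locAt E).1 hE V hV f).2 (N.ι.app _ t)
    obtain ⟨m, hm⟩ := N.pow le_top hV f e (by
      rw [he]
      exact Submodule.smul_mem _ _ (N.ι_mem t))
    refine ⟨m + n, N.mkSec _ hm, N.ι_injective _ ?_⟩
    rw [app_mres, ι_mkSec, mres_smul, he, Scheme.Modules.Hom.app_smul, ← mul_smul, map_pow, pow_add]

end QSub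

section Graph
variable (p : E ⟶ unitMod X) {U : X.Opens} (s : Γ(E, U))

/-- The values of `p`. -/
def pval {V : X.Opens} (e : Γ(E, V)) : Γ(X, V) := p.app V e

lemma pval_add {V : X.Opens} (e e' : Γ(E, V)) : pval p (e + e') = pval p e + pval p e' :=
  map_add (p.app V).hom e e'

lemma pval_smul {V : X.Opens} (r : Γ(X, V)) (e : Γ(E, V)) : pval p (r • e) = r * pval p e :=
  p.app_smul r e

lemma pval_mres {V V' : X.Opens} (h : V' ≤ V) (e : Γ(E, V)) :
    pval p (mres E h e) = rres h (pval p e) := app_mres p h e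

/-- The difference between a section `e` and the multiple `p(e) s` of `s`. -/
def graphDev (V : X.Opens) (e : Γ(E, V)) : Γ(E, V ⊓ U) :=
  mres E inf_le_left e - pval p (mres E (inf_le_left : V ⊓ U ≤ V) e) • mres E inf_le_right s

lemma graphDev_mres {V V' : X.Opens} (h : V' ≤ V) (e : Γ(E, V)) :
    graphDev p s V' (mres E h e) = mres E (inf_le_inf_right U h) (graphDev p s V e) := by
  simp only [graphDev, map_sub, mres_smul, mres_mres, ← pval_mres]

lemma graphDev_smul {V : X.Opens} (r : Γ(X, V)) (e : Γ(E, V)) :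
    graphDev p s V (r • e) = rres (inf_le_left : V ⊓ U ≤ V) r • graphDev p s V e := by
  simp only [graphDev, mres_smul, smul_sub, pval_smul, mul_smul]

/-- The submodule of the multiples of `s`. -/
def graphCar (V : X.Opens) : Submodule Γ(X, V) Γ(E, V) where
  carrier := {e | graphDev p s V e = 0}
  zero_mem' := by
    have h := graphDev_smul p s (0 : Γ(X, V)) 0
    rw [zero_smul, map_zero, zero_smul] at h
    exact h
  add_mem' {a b} ha hb := by
    rw [Set.mem_ofPred_eq] at ha hb ⊢
    have h : graphDev p s V (a + b) = graphDev p s V a + graphDev p s V b := by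
      simp only [graphDev, map_add, pval_add, add_smul]
      abel
    rw [h, ha, hb, add_zero]
  smul_mem' r e he := by
    rw [Set.mem_ofPred_eq] at he ⊢
    rw [graphDev_smul, he, smul_zero]

lemma mem_graphCar {V : X.Opens} {e : Γ(E, V)} :
    e ∈ graphCar p s V ↔ graphDev p s V e = 0 := Iff.rfl

/-- The submodule generated on `U` by `s`. -/
def graphSub (hE : qcoh X E) : PartialQSub p where
  W := U
  N :=
    { car := graphCar p s
      res := fun {V V'} h hV e he => by
        rw [mem_graphCar, graphDev_mres, (mem_graphCar p s).1 he, map_zero]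
      glue := fun {V} hV e he => by
        refine mres_eq_of_cover E (ι := {V' : X.Opens // ∃ h : V' ≤ V,
          mres E h e ∈ graphCar p s V'}) (fun V' => V'.1 ⊓ U)
          (fun V' => inf_le_inf_right U V'.2.choose) (fun x hx => ?_) _ 0 fun V' => ?_
        · obtain ⟨V', h, hxV', he'⟩ := he x hx.1
          exact Opens.mem_iSup.2 ⟨⟨V', h, he'⟩, hxV', hx.2⟩
        · rw [← graphDev_mres p s V'.2.choose, (mem_graphCar p s).1 V'.2.choose_spec, map_zero]
      pow := fun {V} hV hVa f e he => by
        have hVU : V ≤ V ⊓ U := le_inf le_rfl hV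
        obtain ⟨n, hn⟩ := ((qcoh_iff_locAt E).1 hE V hVa f).1 (mres E hVU (graphDev p s V e)) (by
          rw [mem_graphCar, graphDev_mres] at he
          have h1 := congrArg (mres E (le_inf le_rfl ((X.basicOpen_le f).trans hV) :
            X.basicOpen f ≤ X.basicOpen f ⊓ U)) he
          rw [mres_mres, map_zero] at h1
          rw [mres_mres]
          exact h1)
        refine ⟨n, ?_⟩
        have h2 := congrArg (mres E (inf_le_left : V ⊓ U ≤ V)) hn
        rw [mres_smul, mres_mres, mres_self, map_zero] at h2
        rw [mem_graphCar, graphDev_smul]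
        exact h2 }
  -- A section in the submodule satisfies `e = p(e) s` over opens inside `U`, so `p(e) = 0` forces
  -- `e = 0`.
  disj V hV e he hpe := by
    have h1 := (mem_graphCar p s).1 he
    have h2 : pval p e = 0 := hpe
    rw [graphDev, pval_mres, h2, map_zero, zero_smul, sub_zero] at h1
    have h3 := congrArg (mres E (le_inf le_rfl hV : V ≤ V ⊓ U)) h1
    rwa [mres_mres, mres_self, map_zero] at h3

variable {p s} in
/-- On a locally Noetherian scheme, a section `s` over an open set such that `p s = 1` belongs to a
quasi-coherent submodule which is embedded by `p`. -/
lemma exists_submodule_of_section [IsLocallyNoetherian X] (hE : qcoh X E) (hs : pval p s = 1) :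
    ∃ (I : X.Modules) (ι : I ⟶ E) (n : Γ(I, U)), qcoh X I ∧ Mono (ι ≫ p) ∧ ι.app U n = s := by
  obtain ⟨⟨_, N, hN⟩, h, rfl⟩ := PartialQSub.exists_ext_top hE (qcoh_unitMod X) (graphSub p s hE)
  have hsN : s ∈ N.car U := by
    refine (h.2 U le_rfl s).1 ?_
    refine (mem_graphCar p s).2 ?_
    rw [graphDev, pval_mres, hs, map_one, one_smul, sub_eq_zero]
  refine ⟨N.toMod, N.ι, N.mkSec s hsN, N.qcoh_toMod hE, ?_, N.ι_mkSec s hsN⟩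
  refine mono_of_app_injective _ fun V _ => (injective_iff_map_eq_zero _).2 fun x hx => ?_
  apply N.ι_injective V
  rw [map_zero]
  exact hN V le_top _ (N.ι_mem x) hx

end Graph
end SubmoduleSheaf

/-! ### Making sections global on locally Noetherian schemes -/

section Coproducts
variable {X : Scheme.{u}}

/-- Over an affine open the sections of a coproduct of quasi-coherent modules are the coproduct of
the sections, and direct sums of modules are exact. -/
lemma mono_sigma_map {T : Type u} {F G : T → X.Modules} (f : ∀ t, F t ⟶ G t) [∀ t, Mono (f t)]
    (hF : ∀ t, qcoh _ (F t)) (hG : ∀ t, qcoh _ (G t)) : Mono (Limits.Sigma.map f) := by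
  refine mono_of_app_injective _ fun V hV => ?_
  obtain ⟨h₁⟩ := nonempty_isColimit_secU (F := Discrete.functor F) (fun j => hF j.as)
    (coproductIsCoproduct F) (qcoh_colimit (fun j => hF j.as) (coproductIsCoproduct F)) hV
  obtain ⟨h₂⟩ := nonempty_isColimit_secU (F := Discrete.functor G) (fun j => hG j.as)
    (coproductIsCoproduct G) (qcoh_colimit (fun j => hG j.as) (coproductIsCoproduct G)) hV
  let φ : Discrete.functor F ⋙ secU V ⟶ Discrete.functor G ⋙ secU V :=
    Discrete.natTrans fun j => (secU V).map (f j.as)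
  have hφ (j) : Mono (φ.app j) := (ModuleCat.mono_iff_injective _).2
    (app_injective_of_mono (f j.as) V)
  have : Mono φ := NatTrans.mono_of_mono_app φ
  have h := colim.map_mono' φ h₁ h₂ ((secU V).map (Limits.Sigma.map f)) fun j => by
    change (secU V).map (Limits.Sigma.ι F j.as) ≫ _ = (secU V).map (f j.as) ≫
      (secU V).map (Limits.Sigma.ι G j.as)
    rw [← Functor.map_comp, ← Functor.map_comp, Limits.Sigma.ι_map]
  exact (ModuleCat.mono_iff_injective _).1 h

lemma qcoh_coproduct {T : Type u} {F : T → X.Modules} (hF : ∀ t, qcoh _ (F t)) : qcoh _ (∐ F) :=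
  qcoh_colimit (fun j => hF j.as) (coproductIsCoproduct F)

lemma qcoh_pushout {A B C : X.Modules} (f : A ⟶ B) (g : A ⟶ C) (hA : qcoh _ A) (hB : qcoh _ B)
    (hC : qcoh _ C) : qcoh _ (pushout f g) := by
  refine qcoh_colimit' (fun j => ?_) (colimit.isColimit (span f g))
  rcases j with _ | _ | _
  exacts [hA, hB, hC]

lemma qcoh_biprod {A B : X.Modules} (hA : qcoh _ A) (hB : qcoh _ B) : qcoh _ (A ⊞ B) := by
  refine qcoh_colimit' (fun j => ?_) (BinaryBiproduct.isColimit A B)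
  rcases j with ⟨_ | _⟩
  exacts [hA, hB]

/-- The unit section. -/
def oneOn (V : X.Opens) : Γ(unitMod X, V) := (1 : Γ(X, V))

lemma mres_oneOn {V V' : X.Opens} (h : V' ≤ V) : mres (unitMod X) h (oneOn V) = oneOn V' :=
  map_one (rres h)

variable [IsLocallyNoetherian X] {F : X.Modules}

/-- Apply the extension theorem to the section `(s, 1)` of `F ⊕ 𝒪` and the projection to `𝒪`. The
submodule obtained is an ideal through the second projection and maps to `F` through the first. -/
lemma exists_ideal_of_section (hF : qcoh X F) {U : X.Opens} (s : Γ(F, U)) :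
    ∃ (I : X.Modules) (i : I ⟶ unitMod X) (φ : I ⟶ F) (n : Γ(I, U)), qcoh X I ∧ Mono i ∧
      i.app U n = oneOn U ∧ φ.app U n = s := by
  let E := F ⊞ unitMod X
  let e : Γ(E, U) := (biprod.inl : F ⟶ E).app U s + (biprod.inr : unitMod X ⟶ E).app U (oneOn U)
  have h₁ : (biprod.snd : E ⟶ unitMod X).app U e = oneOn U := by
    rw [map_add]
    have h1 := congr(Scheme.Modules.Hom.app $(biprod.inl_snd (X := F) (Y := unitMod X)) U s)
    have h2 := congr(Scheme.Modules.Hom.app $(biprod.inr_snd (X := F) (Y := unitMod X)) U (oneOn U))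
    exact (congrArg₂ (· + ·) h1 h2).trans (zero_add _)
  have h₂ : (biprod.fst : E ⟶ F).app U e = s := by
    rw [map_add]
    have h1 := congr(Scheme.Modules.Hom.app $(biprod.inl_fst (X := F) (Y := unitMod X)) U s)
    have h2 := congr(Scheme.Modules.Hom.app $(biprod.inr_fst (X := F) (Y := unitMod X)) U (oneOn U))
    exact (congrArg₂ (· + ·) h1 h2).trans (add_zero _)
  obtain ⟨I, ι, n, hI, hm, hn⟩ := exists_submodule_of_section
    (qcoh_biprod hF (qcoh_unitMod X)) (p := (biprod.snd : E ⟶ unitMod X)) (s := e) h₁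
  refine ⟨I, ι ≫ biprod.snd, ι ≫ biprod.fst, n, hI, hm, ?_, ?_⟩
  · rw [← h₁, ← hn]
    rfl
  · rw [← h₂, ← hn]
    rfl

/-- On a locally Noetherian scheme, every quasi-coherent module embeds into a quasi-coherent module
in which its sections over all open sets extend to the whole scheme. -/
lemma exists_extend_sections (hF : qcoh X F) : ∃ (G : X.Modules) (j : F ⟶ G), qcoh X G ∧ Mono j ∧
    ∀ (U : X.Opens) (s : Γ(F, U)), ∃ t : Γ(G, ⊤), mres G le_top t = j.app U s := by
  choose I i φ n hI hi hin hφn using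
    fun t : Σ U : X.Opens, Γ(F, U) => exists_ideal_of_section hF t.2
  have := mono_sigma_map i hI fun _ => qcoh_unitMod X
  -- All pairs `(U, s)` are treated at once. In the pushout, the image of `s` is the restriction of
  -- the global section `1` of the copy of `𝒪` indexed by `(U, s)`.
  refine ⟨pushout (Limits.Sigma.map i) (Limits.Sigma.desc φ), pushout.inr _ _, ?_, inferInstance,
    fun U s => ?_⟩
  · exact qcoh_pushout _ _ (qcoh_coproduct hI) (qcoh_coproduct fun _ => qcoh_unitMod X) hF
  · let t : Σ U : X.Opens, Γ(F, U) := ⟨U, s⟩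
    refine ⟨(Limits.Sigma.ι (fun _ : Σ U : X.Opens, Γ(F, U) => unitMod X) t ≫
      pushout.inl _ _).app ⊤ (oneOn ⊤), ?_⟩
    rw [← app_mres, mres_oneOn, ← hin t]
    have h : i t ≫ Limits.Sigma.ι (fun _ : Σ U : X.Opens, Γ(F, U) => unitMod X) t ≫
        pushout.inl (Limits.Sigma.map i) (Limits.Sigma.desc φ) =
          φ t ≫ pushout.inr (Limits.Sigma.map i) (Limits.Sigma.desc φ) := by
      rw [← Limits.Sigma.ι_map_assoc, pushout.condition, Limits.Sigma.ι_desc_assoc]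
    refine (congr(Scheme.Modules.Hom.app $h U (n t))).trans ?_
    exact congrArg ((pushout.inr (Limits.Sigma.map i) (Limits.Sigma.desc φ)).app U) (hφn t)

end Coproducts

/-! ### Sequential colimits of quasi-coherent modules -/

section Sequential
variable {X : Scheme.{u}}

instance (R : Type u) [CommRing R] : PreservesColimitsOfShape ℕ (forget (ModuleCat.{u} R)) := by
  have := preservesFilteredColimitsOfSize_shrink.{0, u, 0, u} (forget (ModuleCat.{u} R))
  infer_instance

lemma mono_of_sequence {F : ℕ ⥤ X.Modules} (hF : ∀ n, qcoh _ (F.obj n))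
    (hm : ∀ n : ℕ, Mono (F.map (homOfLE n.le_succ))) {c : Cocone F} (hc : IsColimit c) (n : ℕ) :
    Mono (c.ι.app n) := by
  have hm' : ∀ {n m : ℕ} (f : n ⟶ m), Mono (F.map f) := fun {n m} f => by
    obtain ⟨d, rfl⟩ := Nat.exists_eq_add_of_le (leOfHom f)
    induction d with
    | zero =>
      rw [show f = 𝟙 _ from Subsingleton.elim _ _, CategoryTheory.Functor.map_id]
      infer_instance
    | succ d ih =>
      have h1 := ih (homOfLE (Nat.le_add_right n d))
      have h2 := hm (n + d)
      rw [show f = homOfLE (Nat.le_add_right n d) ≫ homOfLE (n + d).le_succ from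
        Subsingleton.elim _ _, Functor.map_comp]
      exact mono_comp _ _
  refine mono_of_app_injective _ fun V hV x y hxy => ?_
  obtain ⟨h⟩ := nonempty_isColimit_secU hF hc (qcoh_colimit' hF hc) hV
  obtain ⟨k, f, g, hfg⟩ := Concrete.isColimit_exists_of_rep_eq _ h x y hxy
  obtain rfl : f = g := Subsingleton.elim _ _
  have := hm' f
  exact app_injective_of_mono (F.map f) V hfg

/-- Sections of a sequential colimit of quasi-coherent modules over quasi-compact open sets. -/
lemma exists_rep_of_sequence {F : ℕ ⥤ X.Modules} (hF : ∀ n, qcoh _ (F.obj n)) {c : Cocone F}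
    (hc : IsColimit c) (hm : ∀ n, Mono (c.ι.app n)) {U : X.Opens} (hU : IsCompact (U : Set X))
    (s : Γ(c.pt, U)) : ∃ (n : ℕ) (t : Γ(F.obj n, U)), (c.ι.app n).app U t = s := by
  have hmon {n m : ℕ} (h : n ≤ m) (V : X.Opens) (t : Γ(F.obj n, V)) :
      (c.ι.app m).app V ((F.map (homOfLE h)).app V t) = (c.ι.app n).app V t :=
    congr(Scheme.Modules.Hom.app $(c.w (homOfLE h)) V t)
  -- Locally the section comes from a finite stage, and by compactness from one stage `n`. There the
  -- local representatives agree on overlaps because stage `n` embeds into the colimit.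
  obtain ⟨n, hn⟩ : ∃ n : ℕ, ∀ x ∈ U, ∃ (V : X.Opens) (h : V ≤ U), x ∈ V ∧
      ∃ t : Γ(F.obj n, V), (c.ι.app n).app V t = mres c.pt h s := by
    refine hU.induction_on (p := fun S => ∃ n : ℕ, ∀ x ∈ S, ∃ (V : X.Opens) (h : V ≤ U), x ∈ V ∧
      ∃ t : Γ(F.obj n, V), (c.ι.app n).app V t = mres c.pt h s) ⟨0, by simp⟩ ?_ ?_ ?_
    · rintro s t hst ⟨n, hn⟩
      exact ⟨n, fun x hx => hn x (hst hx)⟩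
    · rintro s t ⟨n, hn⟩ ⟨m, hm⟩
      refine ⟨max n m, fun x hx => ?_⟩
      rcases hx with hx | hx
      · obtain ⟨V, h, hxV, t, ht⟩ := hn x hx
        exact ⟨V, h, hxV, _, (hmon (le_max_left _ _) V t).trans ht⟩
      · obtain ⟨V, h, hxV, t, ht⟩ := hm x hx
        exact ⟨V, h, hxV, _, (hmon (le_max_right _ _) V t).trans ht⟩
    · intro x hx
      obtain ⟨V, hV, hxV, hVU⟩ := exists_isAffineOpen_mem_and_subset (U := U) hx
      obtain ⟨h⟩ := nonempty_isColimit_secU hF hc (qcoh_colimit' hF hc) hV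
      obtain ⟨n, t, ht⟩ := Concrete.isColimit_exists_rep _ h (mres c.pt hVU s)
      exact ⟨V, mem_nhdsWithin_of_mem_nhds (V.isOpen.mem_nhds hxV), n,
        fun y hy => ⟨V, hVU, hy, t, ht⟩⟩
  choose V hVU hxV t ht using fun x : U => hn x.1 x.2
  have := hm n
  have hcov : U ≤ ⨆ x, V x := fun x hx => Opens.mem_iSup.2 ⟨⟨x, hx⟩, hxV ⟨x, hx⟩⟩
  obtain ⟨t', ht'⟩ := mres_glue (F.obj n) V hVU hcov t fun x y => by
    apply app_injective_of_mono (c.ι.app n)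
    rw [app_mres, app_mres, ht, ht]
    exact (mres_mres c.pt (hVU x) _ s).trans (mres_mres c.pt (hVU y) _ s).symm
  refine ⟨n, t', mres_eq_of_cover c.pt V hVU hcov _ _ fun x => ?_⟩
  rw [← ht x, ← ht' x]
  exact (app_mres (c.ι.app n) (hVU x) t').symm

/-- On a locally Noetherian scheme, every quasi-coherent module embeds into a quasi-coherent module
whose sections over quasi-compact open sets extend to the whole scheme. -/
lemma exists_mono_extends [IsLocallyNoetherian X] {F : X.Modules} (hF : qcoh X F) :
    ∃ (G : X.Modules) (j : F ⟶ G), qcoh X G ∧ Mono j ∧ ∀ U : X.Opens, IsCompact (U : Set X) →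
      Function.Surjective (mres G (le_top : U ≤ ⊤)) := by
  choose G j hG hj hext using fun M : {M : X.Modules // qcoh X M} => exists_extend_sections M.2
  -- One step only extends the sections of the previous module, so it is iterated: a section over a
  -- quasi-compact open lives at some stage and extends at the next.
  let M (n : ℕ) : {M : X.Modules // qcoh X M} :=
    Nat.rec ⟨F, hF⟩ (fun _ M => ⟨G M, hG M⟩) n
  let f (n : ℕ) : (M n).1 ⟶ (M (n + 1)).1 := j (M n)
  let Fs : ℕ ⥤ X.Modules := Functor.ofSequence f
  have hmap (n : ℕ) : Fs.map (homOfLE n.le_succ) = f n := Functor.ofSequence_map_homOfLE_succ f n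
  have hFs (n) : qcoh X (Fs.obj n) := (M n).2
  have hm (n) := mono_of_sequence hFs (fun n => by rw [hmap]; exact hj (M n))
    (colimit.isColimit Fs) n
  refine ⟨colimit Fs, colimit.ι Fs 0, qcoh_colimit' hFs (colimit.isColimit Fs), hm 0,
    fun U hU s => ?_⟩
  obtain ⟨n, t, ht⟩ := exists_rep_of_sequence hFs (colimit.isColimit Fs) hm hU s
  obtain ⟨t', ht'⟩ := hext (M n) U t
  let t'' : Γ(Fs.obj (n + 1), ⊤) := t'
  refine ⟨(colimit.ι Fs (n + 1)).app ⊤ t'', ?_⟩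
  rw [← app_mres]
  have h1 : mres (Fs.obj (n + 1)) le_top t'' = (Fs.map (homOfLE n.le_succ)).app U t := by
    rw [hmap]
    exact ht'
  rw [h1]
  refine Eq.trans ?_ ht
  exact congr(Scheme.Modules.Hom.app $(colimit.w Fs (homOfLE n.le_succ)) U t)

end Sequential

/-! ### Acyclic embeddings on locally Noetherian schemes -/

section LocallyNoetherian
variable {k : Type u} [Field k] [Fintype k] {S : Over (Spec (CommRingCat.of k))}

variable (S) in
lemma isLocallyNoetherian_XA [IsLocallyNoetherian S.left] : IsLocallyNoetherian (XA S) := by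
  have h : LocallyOfFiniteType (Spec.map (CommRingCat.ofHom (Polynomial.C (R := k)))) := by
    rw [HasRingHomProperty.Spec_iff (P := @LocallyOfFiniteType)]
    exact RingHom.finiteType_algebraMap.2 (inferInstanceAs (Algebra.FiniteType k (Polynomial k)))
  exact inferInstanceAs (IsLocallyNoetherian (pullback S.hom _))

/-- Open subsets of an affine open of `S` have quasi-compact preimage in `S_A`, as the latter is
locally Noetherian and affine over `S`. So sections over them extend and the flasque argument
applies with the basis of affine opens. -/
lemma exists_mono_acyclic_of_locallyNoetherian [IsLocallyNoetherian S.left] (F : (XA S).Modules)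
    (hF : qcoh _ F) : ∃ (I : (XA S).Modules) (f : F ⟶ I), qcoh _ I ∧ Mono f ∧
      ∀ (p : ℕ) (x : Coh ⊤ (onS I) (p + 1)), x = 0 := by
  have := isLocallyNoetherian_XA S
  obtain ⟨G, j, hG, hj, h⟩ := exists_mono_extends hF
  refine ⟨G, j, hG, hj, fun p x => ExtendsFrom.coh_eq_zero (G := onS G)
    (B := {U : Opens S.left | IsAffineOpen (X := S.left) U}) S.left.isBasis_affineOpens ?_ x⟩
  intro V hV U hU s
  obtain ⟨t, ht⟩ := h (prS S ⁻¹ᵁ U) (isCompact_of_le_affine (IsAffineOpen.preimage hV (prS S))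
    fun x hx => hU hx) s
  exact ⟨t, ht⟩

end LocallyNoetherian

/-! ### Complexes in degrees `0` and `1` in the derived category -/

section TwoTerm
universe v w t
open HomologicalComplex
variable {D : Type w} [Category.{v} D] [Abelian D]

lemma twoMap_add {X₀ X₁ Y₀ Y₁ : D} {f : X₀ ⟶ X₁} {g : Y₀ ⟶ Y₁} (a a' : X₀ ⟶ Y₀) (b b' : X₁ ⟶ Y₁)
    (h : a ≫ g = f ≫ b) (h' : a' ≫ g = f ≫ b') (h'' : (a + a') ≫ g = f ≫ (b + b')) :
    twoMap (a + a') (b + b') h'' = twoMap a b h + twoMap a' b' h' := by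
  apply from_double_hom_ext
  · rw [add_f_apply, twoMap_f₀, twoMap_f₀, twoMap_f₀, Preadditive.add_comp, Preadditive.comp_add]
  · rw [add_f_apply, twoMap_f₁, twoMap_f₁, twoMap_f₁, Preadditive.add_comp, Preadditive.comp_add]

/-- The inclusion of the term in degree `1`. -/
def oneToTwo {X₀ X₁ : D} (f : X₀ ⟶ X₁) : (single D (ComplexShape.up ℤ) 1).obj X₁ ⟶ two f :=
  mkHomFromSingle (doubleXIso₁ f rel01 zero_ne_one).inv fun i _ => by
    rw [double_d_eq_zero₀ _ _ _ _ one_ne_zero, comp_zero]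

/-- The projection onto the term in degree `0`. -/
def twoToZero {X₀ X₁ : D} (f : X₀ ⟶ X₁) : two f ⟶ (single D (ComplexShape.up ℤ) 0).obj X₀ :=
  mkHomToSingle (doubleXIso₀ f rel01).hom fun i _ => by
    rw [double_d_eq_zero₁ _ _ _ _ zero_ne_one, zero_comp]

lemma oneToTwo_f {X₀ X₁ : D} (f : X₀ ⟶ X₁) : (oneToTwo f).f 1 =
    (singleObjXSelf _ 1 X₁).hom ≫ (doubleXIso₁ f rel01 zero_ne_one).inv := mkHomFromSingle_f _ _

lemma twoToZero_f {X₀ X₁ : D} (f : X₀ ⟶ X₁) : (twoToZero f).f 0 =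
    (doubleXIso₀ f rel01).hom ≫ (singleObjXSelf _ 0 X₀).inv := mkHomToSingle_f _ _

lemma oneToTwo_naturality {X₀ X₁ Y₀ Y₁ : D} {f : X₀ ⟶ X₁} {g : Y₀ ⟶ Y₁} (a : X₀ ⟶ Y₀)
    (b : X₁ ⟶ Y₁) (h : a ≫ g = f ≫ b) :
    oneToTwo f ≫ twoMap a b h = (single D (ComplexShape.up ℤ) 1).map b ≫ oneToTwo g := by
  apply from_single_hom_ext
  rw [comp_f, comp_f, oneToTwo_f, oneToTwo_f, twoMap_f₁, single_map_f_self]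
  simp

lemma twoToZero_naturality {X₀ X₁ Y₀ Y₁ : D} {f : X₀ ⟶ X₁} {g : Y₀ ⟶ Y₁} (a : X₀ ⟶ Y₀)
    (b : X₁ ⟶ Y₁) (h : a ≫ g = f ≫ b) :
    twoMap a b h ≫ twoToZero g = twoToZero f ≫ (single D (ComplexShape.up ℤ) 0).map a := by
  apply to_single_hom_ext
  rw [comp_f, comp_f, twoToZero_f, twoToZero_f, twoMap_f₀, single_map_f_self]
  simp

lemma singleToTwo_twoToZero {X₀ X₁ Z : D} {f : X₀ ⟶ X₁} (a : Z ⟶ X₀) (h : a ≫ f = 0) :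
    singleToTwo a h ≫ twoToZero f = (single D (ComplexShape.up ℤ) 0).map a := by
  apply to_single_hom_ext
  rw [comp_f, twoToZero_f, singleToTwo, mkHomFromSingle_f, single_map_f_self]
  simp

lemma singleToTwo_twoMap {X₀ X₁ Y₀ Y₁ Z : D} {f : X₀ ⟶ X₁} {g : Y₀ ⟶ Y₁} (s : Z ⟶ X₀)
    (hs : s ≫ f = 0) (a : X₀ ⟶ Y₀) (b : X₁ ⟶ Y₁) (h : a ≫ g = f ≫ b) (s' : Z ⟶ Y₀)
    (hs' : s' ≫ g = 0) (e : s ≫ a = s') :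
    singleToTwo s hs ≫ twoMap a b h = singleToTwo s' hs' := by
  apply from_single_hom_ext
  rw [comp_f, twoMap_f₀, singleToTwo, singleToTwo, mkHomFromSingle_f, mkHomFromSingle_f, ← e]
  simp

/-- The filtration of a complex in degrees `0` and `1`. -/
def twoSeq {X₀ X₁ : D} (f : X₀ ⟶ X₁) : ShortComplex (CochainComplex D ℤ) :=
  ShortComplex.mk (oneToTwo f) (twoToZero f) (by
    apply to_single_hom_ext
    exact (isZero_single_obj_X _ _ _ _ zero_ne_one).eq_of_src _ _)

lemma isIso_of_isZero {X Y : D} (hX : IsZero X) (hY : IsZero Y) (f : X ⟶ Y) : IsIso f :=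
  ⟨0, hX.eq_of_src _ _, hY.eq_of_src _ _⟩

lemma twoSeq_shortExact {X₀ X₁ : D} (f : X₀ ⟶ X₁) : (twoSeq f).ShortExact := by
  refine shortExact_of_degreewise_shortExact _ fun i => ?_
  have z₀ (j : ℤ) (h : j ≠ 0) : IsZero (((single D (ComplexShape.up ℤ) 0).obj X₀).X j) :=
    isZero_single_obj_X _ _ _ _ h
  have z₁ (j : ℤ) (h : j ≠ 1) : IsZero (((single D (ComplexShape.up ℤ) 1).obj X₁).X j) :=
    isZero_single_obj_X _ _ _ _ h
  by_cases h0 : i = 0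
  · subst h0
    refine (ShortComplex.Splitting.ofIsZeroOfIsIso _ (z₁ 0 zero_ne_one) ?_).shortExact
    change IsIso ((twoToZero f).f 0)
    rw [twoToZero_f]
    infer_instance
  by_cases h1 : i = 1
  · subst h1
    refine (ShortComplex.Splitting.ofIsIsoOfIsZero _ ?_ (z₀ 1 one_ne_zero)).shortExact
    change IsIso ((oneToTwo f).f 1)
    rw [oneToTwo_f]
    infer_instance
  · exact (ShortComplex.Splitting.ofIsZeroOfIsIso _ (z₁ i h1)
      (isIso_of_isZero (isZero_double_X f rel01 i h0 h1) (z₀ i h0) _)).shortExact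

lemma two_shortExact {X₀ X₁ Y₀ Y₁ Z₀ Z₁ : D}
    {d : X₀ ⟶ X₁} {d' : Y₀ ⟶ Y₁} {d'' : Z₀ ⟶ Z₁}
    (f₀ : X₀ ⟶ Y₀) (g₀ : Y₀ ⟶ Z₀) (f₁ : X₁ ⟶ Y₁) (g₁ : Y₁ ⟶ Z₁) (w₀ : f₀ ≫ g₀ = 0)
    (w₁ : f₁ ≫ g₁ = 0) (h : f₀ ≫ d' = d ≫ f₁) (h' : g₀ ≫ d'' = d' ≫ g₁)
    (w : twoMap f₀ f₁ h ≫ twoMap g₀ g₁ h' = 0)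
    (h₀ : (ShortComplex.mk f₀ g₀ w₀).ShortExact) (h₁ : (ShortComplex.mk f₁ g₁ w₁).ShortExact) :
    (ShortComplex.mk (twoMap f₀ f₁ h) (twoMap g₀ g₁ h') w).ShortExact := by
  refine shortExact_of_degreewise_shortExact _ fun i => ?_
  by_cases hi0 : i = 0
  · subst hi0
    refine ShortComplex.shortExact_of_iso (ShortComplex.isoMk (doubleXIso₀ d rel01)
      (doubleXIso₀ d' rel01) (doubleXIso₀ d'' rel01) ?_ ?_).symm h₀
    · refine ((congrArg (· ≫ _) (twoMap_f₀ f₀ f₁ h)).trans ?_).symm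
      exact (Category.assoc _ _ _).trans (congrArg _ ((Category.assoc _ _ _).trans
        ((congrArg _ (Iso.inv_hom_id _)).trans (Category.comp_id _))))
    · refine ((congrArg (· ≫ _) (twoMap_f₀ g₀ g₁ h')).trans ?_).symm
      exact (Category.assoc _ _ _).trans (congrArg _ ((Category.assoc _ _ _).trans
        ((congrArg _ (Iso.inv_hom_id _)).trans (Category.comp_id _))))
  by_cases hi1 : i = 1
  · subst hi1
    refine ShortComplex.shortExact_of_iso (ShortComplex.isoMk (doubleXIso₁ d rel01 zero_ne_one)
      (doubleXIso₁ d' rel01 zero_ne_one) (doubleXIso₁ d'' rel01 zero_ne_one) ?_ ?_).symm h₁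
    · refine ((congrArg (· ≫ _) (twoMap_f₁ f₀ f₁ h)).trans ?_).symm
      exact (Category.assoc _ _ _).trans (congrArg _ ((Category.assoc _ _ _).trans
        ((congrArg _ (Iso.inv_hom_id _)).trans (Category.comp_id _))))
    · refine ((congrArg (· ≫ _) (twoMap_f₁ g₀ g₁ h')).trans ?_).symm
      exact (Category.assoc _ _ _).trans (congrArg _ ((Category.assoc _ _ _).trans
        ((congrArg _ (Iso.inv_hom_id _)).trans (Category.comp_id _))))
  · refine (ShortComplex.Splitting.ofIsZeroOfIsIso _ (isZero_double_X d rel01 i hi0 hi1)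
      ?_).shortExact
    exact isIso_of_isZero (isZero_double_X d' rel01 i hi0 hi1)
      (isZero_double_X d'' rel01 i hi0 hi1) _

/-- The contracting homotopy of the complex `X ⟶ X`. -/
def twoIdContraction (X : D) (i j : ℤ) (_ : (ComplexShape.up ℤ).Rel j i) :
    (two (𝟙 X)).X i ⟶ (two (𝟙 X)).X j :=
  if h : i = 1 ∧ j = 0 then
    (XIsoOfEq (two (𝟙 X)) h.1).hom ≫ (doubleXIso₁ (𝟙 X) rel01 zero_ne_one).hom ≫
      (doubleXIso₀ (𝟙 X) rel01).inv ≫ (XIsoOfEq (two (𝟙 X)) h.2).inv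
  else 0

lemma twoIdContraction_eq (X : D) : twoIdContraction X 1 0 rel01 =
    (doubleXIso₁ (𝟙 X) rel01 zero_ne_one).hom ≫ (doubleXIso₀ (𝟙 X) rel01).inv := by
  rw [twoIdContraction, dif_pos ⟨rfl, rfl⟩]
  simp [XIsoOfEq]

lemma id_two_id (X : D) : 𝟙 (two (𝟙 X)) = Homotopy.nullHomotopicMap' (twoIdContraction X) := by
  apply from_double_hom_ext
  · rw [Homotopy.nullHomotopicMap'_f (k₂ := -1) (k₀ := 1) (by simp) rel01, twoIdContraction_eq,
      double_d _ _ zero_ne_one, double_d_eq_zero₀ _ _ _ _ (by simp)]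
    simp
  · rw [Homotopy.nullHomotopicMap'_f (k₂ := 0) (k₀ := 2) rel01 (by simp), twoIdContraction_eq,
      double_d _ _ zero_ne_one, double_d_eq_zero₀ _ _ _ _ one_ne_zero]
    simp

variable [HasDerivedCategory.{t} D]
open DerivedCategory

lemma isZero_Q_two_id (X : D) : IsZero (Q.obj (two (𝟙 X))) := by
  rw [IsZero.iff_id_eq_zero, ← CategoryTheory.Functor.map_id]
  refine (Q_map_eq_of_homotopy D ((Homotopy.ofEq (id_two_id X)).trans
    (Homotopy.nullHomotopy' (twoIdContraction X)))).trans ?_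
  rw [Functor.map_zero]

/-- The composite factors through the contractible complex of the identity of `X₁`. -/
lemma Q_twoToZero_map {X₀ X₁ : D} (f : X₀ ⟶ X₁) :
    Q.map (twoToZero f) ≫ Q.map ((single D (ComplexShape.up ℤ) 0).map f) = 0 := by
  rw [← Functor.map_comp, ← twoToZero_naturality (g := 𝟙 X₁) f (𝟙 X₁) rfl, Functor.map_comp,
    (isZero_Q_two_id X₁).eq_of_tgt (Q.map _) 0, zero_comp]

/-- A section `r` of the differential makes the inclusion of the term in degree `1` factor through
the contractible complex of the identity of `X₁`. -/
lemma Q_oneToTwo_eq_zero {X₀ X₁ : D} (f : X₀ ⟶ X₁) (r : X₁ ⟶ X₀) (h : r ≫ f = 𝟙 X₁) :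
    Q.map (oneToTwo f) = 0 := by
  have e := oneToTwo_naturality (f := 𝟙 X₁) (g := f) r (𝟙 X₁) (by rw [h, Category.comp_id])
  have e' := e.trans ((congrArg (· ≫ oneToTwo f) (CategoryTheory.Functor.map_id _ _)).trans
    (Category.id_comp _))
  rw [← e', Functor.map_comp, (isZero_Q_two_id X₁).eq_of_src (Q.map (twoMap _ _ _)) 0, comp_zero]

lemma shMap_zero {d X Y : DerivedCategory D} {i : ℤ} (x : ShiftedHom d X i) :
    shMap x (0 : X ⟶ Y) = 0 := by
  rw [shMap, Functor.map_zero, comp_zero]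

/-- A complex `X₀ ⟶ X₁` with a split differential has the hypercohomology of a subobject
of `X₀`. -/
lemma eq_zero_of_split {X₀ X₁ : D} (f : X₀ ⟶ X₁) (r : X₁ ⟶ X₀) (h : r ≫ f = 𝟙 X₁)
    {d : DerivedCategory D} {i : ℤ}
    (h₀ : ∀ x : ShiftedHom d (Q.obj ((single D (ComplexShape.up ℤ) 0).obj X₀)) i, x = 0)
    (x : ShiftedHom d (Q.obj (two f)) i) : x = 0 := by
  obtain ⟨y, rfl⟩ := sh_exact₂ (twoSeq_shortExact f) d x (h₀ _)
  exact (congrArg (shMap y) (Q_oneToTwo_eq_zero f r h)).trans (shMap_zero y)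

lemma shiftedHom_single_one_eq_zero {Z X : D} (y : ShiftedHom
    (Q.obj ((single D (ComplexShape.up ℤ) 0).obj Z))
    (Q.obj ((single D (ComplexShape.up ℤ) 1).obj X)) (0 : ℤ)) : y = 0 := by
  have h1 : (Q.obj ((single D (ComplexShape.up ℤ) 0).obj Z)).IsLE 0 :=
    inferInstanceAs (((singleFunctor D 0).obj Z).IsLE 0)
  have h2 : (Q.obj ((single D (ComplexShape.up ℤ) 1).obj X)).IsGE 1 :=
    inferInstanceAs (((singleFunctor D 1).obj X).IsGE 1)
  have h := TStructure.t.zero (Y := Q.obj ((single D (ComplexShape.up ℤ) 1).obj X)) (y ≫ (shiftFunctorZero (DerivedCategory D) ℤ).hom.app _) 0 1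
  exact (cancel_mono ((shiftFunctorZero (DerivedCategory D) ℤ).hom.app _)).1
    (h.trans zero_comp.symm)

/-- The difference lifts to a morphism from an object in degree `0` to one in degree `1`, which is
zero by the axioms of a t-structure. -/
lemma eq_of_shMap_twoToZero {Z X₀ X₁ : D} (f : X₀ ⟶ X₁)
    (x y : ShiftedHom (Q.obj ((single D (ComplexShape.up ℤ) 0).obj Z)) (Q.obj (two f)) (0 : ℤ))
    (h : shMap x (Q.map (twoToZero f)) = shMap y (Q.map (twoToZero f))) : x = y := by
  obtain ⟨z, hz⟩ := sh_exact₂ (twoSeq_shortExact f) _ (x - y)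
    ((Preadditive.sub_comp _ _ _).trans (sub_eq_zero.2 h))
  rw [shiftedHom_single_one_eq_zero z] at hz
  exact sub_eq_zero.1 (hz.symm.trans zero_comp)

/-- Morphisms from an object in degree `0` to a complex in degrees `0` and `1`. -/
lemma exists_singleToTwo {Z X₀ X₁ : D} (f : X₀ ⟶ X₁)
    (x : ShiftedHom (Q.obj ((single D (ComplexShape.up ℤ) 0).obj Z)) (Q.obj (two f)) (0 : ℤ)) :
    ∃ (a : Z ⟶ X₀) (h : a ≫ f = 0), ShiftedHom.mk₀ (0 : ℤ) rfl (Q.map (singleToTwo a h)) = x := by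
  obtain ⟨y, rfl⟩ := (ShiftedHom.homEquiv (0 : ℤ) rfl).surjective x
  obtain ⟨a, ha⟩ := (singleFunctor D 0).map_surjective (y ≫ Q.map (twoToZero f))
  have ha' : Q.map ((single D (ComplexShape.up ℤ) 0).map a) = y ≫ Q.map (twoToZero f) := ha
  have h : a ≫ f = 0 := by
    apply (singleFunctor D 0).map_injective
    rw [Functor.map_zero, Functor.map_comp]
    refine (congrArg (· ≫ _) ha).trans ?_
    refine (Category.assoc _ _ _).trans ?_
    exact (congrArg (y ≫ ·) (Q_twoToZero_map f)).trans comp_zero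
  refine ⟨a, h, eq_of_shMap_twoToZero f _ _ ?_⟩
  have e (z : Q.obj ((single D (ComplexShape.up ℤ) 0).obj Z) ⟶ Q.obj (two f)) :
      shMap (ShiftedHom.mk₀ (0 : ℤ) rfl z) (Q.map (twoToZero f)) =
        ShiftedHom.mk₀ (0 : ℤ) rfl (z ≫ Q.map (twoToZero f)) := by
    rw [shMap, ← ShiftedHom.comp_mk₀ _ 0 rfl, ShiftedHom.mk₀_comp_mk₀]
  refine (e _).trans (Eq.trans ?_ (e y).symm)
  rw [← Functor.map_comp, singleToTwo_twoToZero, ha']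

lemma mk₀_singleToTwo_injective {Z X₀ X₁ : D} (f : X₀ ⟶ X₁) (a a' : Z ⟶ X₀) (h : a ≫ f = 0)
    (h' : a' ≫ f = 0) (e : ShiftedHom.mk₀ (0 : ℤ) rfl (Q.map (singleToTwo a h)) =
      ShiftedHom.mk₀ (0 : ℤ) rfl (Q.map (singleToTwo a' h'))) : a = a' := by
  have e' := (ShiftedHom.homEquiv (0 : ℤ) rfl).injective e
  apply (singleFunctor D 0).map_injective
  have e'' := congrArg (· ≫ Q.map (twoToZero f)) e'
  simp only [← Functor.map_comp, singleToTwo_twoToZero] at e''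
  exact e''

end TwoTerm

/-! ### Exactness of the complex attached to a shtuka -/

section Exactness
variable {X : Scheme.{u}} {τ : X ⟶ X}

instance : PreservesFiniteLimits (Diag.fstF (X := X) (τ := τ)) :=
  Functor.preservesFiniteLimits_of_preservesKernels _

instance : PreservesFiniteColimits (Diag.fstF (X := X) (τ := τ)) :=
  Functor.preservesFiniteColimits_of_preservesCokernels _

instance : PreservesFiniteLimits (Diag.sndF (X := X) (τ := τ)) :=
  Functor.preservesFiniteLimits_of_preservesKernels _

instance : PreservesFiniteColimits (Diag.sndF (X := X) (τ := τ)) :=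
  Functor.preservesFiniteColimits_of_preservesCokernels _

lemma Diag.mono_of {P Q : Diag X τ} (a : P ⟶ Q) [Mono a.f] [Mono a.f'] : Mono a where
  right_cancellation _ _ h := Diag.hom_ext ((cancel_mono a.f).1 congr(Diag.Hom.f $h))
    ((cancel_mono a.f').1 congr(Diag.Hom.f' $h))

variable {k : Type u} [Field k] [Fintype k] {S : Over (Spec (CommRingCat.of k))}

lemma cplx_shortExact (P : ShortComplex (Shtuka S)) (hP : P.ShortExact) :
    (P.map cplx).ShortExact := by
  have h₀ : ((P.map Diag.fstF).map (onSF S)).ShortExact :=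
    onS_shortExact (hP.map_of_exact Diag.fstF) P.X₂.qcoh_M P.X₃.qcoh_M
  have h₁ : ((P.map Diag.sndF).map (onSF S)).ShortExact :=
    onS_shortExact (hP.map_of_exact Diag.sndF) P.X₂.qcoh_M' P.X₃.qcoh_M'
  exact two_shortExact (onSMap P.f.f) (onSMap P.g.f) (onSMap P.f.f') (onSMap P.g.f')
    _ _ (del_naturality P.f) (del_naturality P.g) _ h₀ h₁

end Exactness

/-! ### Effaceability of the hypercohomology of shtukas -/

section Effacement
variable {k : Type u} [Field k] [Fintype k] {S : Over (Spec (CommRingCat.of k))}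

/-- Frobenius is the identity on the underlying space, hence affine, and `frobA S` composed with the
affine projection `prS S` is therefore affine. Needed for `τ_* I'` to be quasi-coherent. -/
lemma isAffineHom_frobA : IsAffineHom (frobA S) := by
  have h1 : IsAffineHom (frob S) := ⟨fun U hU => hU⟩
  have h2 : IsAffineHom (frobA S ≫ prS S) := by
    rw [frobA_prS]
    infer_instance
  exact IsAffineHom.of_comp (frobA S) (prS S)

/-- Sections of `τ_* F` on the opens `pr⁻¹ U`, which are stable under `τ`. -/
def frobHom (F : (XA S).Modules) : onS ((Scheme.Modules.pushforward (frobA S)).obj F) ⟶ onS F :=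
  ⟨{ app U := secMap (frobA S) (frobA_prA S) (𝟙 ((Scheme.Modules.pushforward (frobA S)).obj F))
      (V := prS S ⁻¹ᵁ U.unop) (W := prS S ⁻¹ᵁ U.unop) (frobA_preimage S U.unop).ge
     naturality := fun U V i => secMap_naturality (frobA S) (frobA_prA S) _
      (frobA_preimage S U.unop).ge (frobA_preimage S V.unop).ge
      ((Opens.map (prS S).base).map i.unop) ((Opens.map (prS S).base).map i.unop) }⟩

lemma sapp_frobHom_bijective (F : (XA S).Modules) (U : S.left.Opens) :
    Function.Bijective (sapp (frobHom F) U) :=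
  mres_bijective_of_eq F (frobA_preimage S U).symm

instance (F : (XA S).Modules) : IsIso (frobHom F) := by
  refine @isIso_of_mono_of_epi _ _ _ _ _ _ (mono_of_sapp_injective _ fun V =>
    (sapp_frobHom_bijective F V).1) ((epi_iff_sapp _).2 fun U t x hx => ⟨U, le_rfl, ?_, hx⟩)
  obtain ⟨s, hs⟩ := (sapp_frobHom_bijective F U).2 t
  exact ⟨s, hs.trans (sres_self _ _ t).symm⟩

lemma coh_biprod_eq_zero {F G : (XA S).Modules} {p : ℕ} (hF : ∀ x : Coh ⊤ (onS F) p, x = 0)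
    (hG : ∀ x : Coh ⊤ (onS G) p, x = 0) (x : Coh ⊤ (onS (F ⊞ G)) p) : x = 0 := by
  have h : onSMap (biprod.fst : F ⊞ G ⟶ F) ≫ onSMap biprod.inl +
      onSMap (biprod.snd : F ⊞ G ⟶ G) ≫ onSMap biprod.inr = 𝟙 (onS (F ⊞ G)) :=
    congrArg (onSF S).map (biprod.total (X := F) (Y := G))
  rw [← Abelian.Ext.comp_mk₀_id x, ← h, Abelian.Ext.mk₀_add, Abelian.Ext.comp_add]
  have h1 : cmap (onSMap (biprod.fst : F ⊞ G ⟶ F) ≫ onSMap (biprod.inl : F ⟶ F ⊞ G)) x = 0 := by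
    rw [← cmap_cmap, hF (cmap _ x), cmap_zero]
  have h2 : cmap (onSMap (biprod.snd : F ⊞ G ⟶ G) ≫ onSMap (biprod.inr : G ⟶ F ⊞ G)) x = 0 := by
    rw [← cmap_cmap, hG (cmap _ x), cmap_zero]
  exact (congrArg₂ (· + ·) h1 h2).trans (add_zero 0)

lemma onSMap_tau_j_eq_zero {M : Shtuka S} {F : (XA S).Modules} (φ : F ⟶ M.M)
    (h : φ ≫ M.jAdj = 0) : onSMap φ ≫ tau M.M ≫ onSMap M.j = 0 := by
  have h1 : (Scheme.Modules.pullback (frobA S)).map φ ≫ M.j = 0 := by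
    apply ((Scheme.Modules.pullbackPushforwardAdjunction (frobA S)).homEquiv _ _).injective
    rw [Adjunction.homEquiv_naturality_left]
    refine h.trans ?_
    rw [Adjunction.homEquiv_unit, Functor.map_zero, comp_zero]
  rw [← Category.assoc, tau_naturality, Category.assoc, ← onSMap_comp, h1]
  exact (congrArg (tau F ≫ ·) ((onSF S).map_zero _ _)).trans comp_zero

/-- The shtuka with modules `I ⊕ I' ⊕ τ_* I'` and `I'`, and the projections as structure maps. -/
def splitShtuka (I I' : (XA S).Modules) (hI : qcoh _ I) (hI' : qcoh _ I') : Shtuka S where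
  -- The summand `I` receives `M`. The summands `I'` and `τ_* I'` make room for `σ` and for the
  -- adjoint of `j`, so that maps of modules into `I` and `I'` extend uniquely to a map of shtukas.
  M := I ⊞ (I' ⊞ (Scheme.Modules.pushforward (frobA S)).obj I')
  M' := I'
  qcoh_M := qcoh_biprod hI (qcoh_biprod hI' (haveI := isAffineHom_frobA (S := S)
    qcoh_pushforward (frobA S) hI'))
  qcoh_M' := hI'
  σ := biprod.snd ≫ biprod.fst
  j := ((Scheme.Modules.pullbackPushforwardAdjunction (frobA S)).homEquiv _ _).symm
    (biprod.snd ≫ biprod.snd)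

variable {I I' : (XA S).Modules} (hI : qcoh _ I) (hI' : qcoh _ I')

lemma splitShtuka_jAdj : (splitShtuka I I' hI hI').jAdj = biprod.snd ≫ biprod.snd :=
  Equiv.apply_symm_apply _ _

lemma inl_inr_snd_snd {C : Type*} [Category C] [Preadditive C] [HasBinaryBiproducts C] (X Y Z : C) :
    (biprod.inl ≫ biprod.inr : Y ⟶ X ⊞ (Y ⊞ Z)) ≫ biprod.snd ≫ biprod.snd = 0 := by
  simp

lemma lift_lift_snd_snd {C : Type*} [Category C] [Preadditive C] [HasBinaryBiproducts C]
    {W X Y Z : C} (a : W ⟶ X) (b : W ⟶ Y) (c : W ⟶ Z) :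
    biprod.lift a (biprod.lift b c) ≫ biprod.snd ≫ biprod.snd = c := by
  simp

/-- On the summand `I'` the map `σ` is the identity and the adjoint of `j` vanishes, so this summand
is a section of `∂ = σ - j ∘ τ`. -/
lemma splitShtuka_del : onSMap (biprod.inl ≫ biprod.inr : I' ⟶ (splitShtuka I I' hI hI').M) ≫
    del (splitShtuka I I' hI hI') = 𝟙 (onS I') := by
  rw [del, Preadditive.comp_sub, onSMap_tau_j_eq_zero, sub_zero, ← onSMap_comp]
  · have h : (biprod.inl ≫ biprod.inr : I' ⟶ (splitShtuka I I' hI hI').M) ≫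
        (splitShtuka I I' hI hI').σ = 𝟙 I' := by simp [splitShtuka]
    exact congrArg (onSF S).map h
  · exact (congrArg ((biprod.inl ≫ biprod.inr) ≫ ·) (splitShtuka_jAdj hI hI')).trans
      (inl_inr_snd_snd _ _ _)

/-- The morphism to `splitShtuka` given by morphisms of the modules of a shtuka. -/
def toSplit {M : Shtuka S} (f : M.M ⟶ I) (f' : M.M' ⟶ I') : M ⟶ splitShtuka I I' hI hI' where
  f := biprod.lift f (biprod.lift (M.σ ≫ f')
    (M.jAdj ≫ (Scheme.Modules.pushforward (frobA S)).map f'))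
  f' := f'
  comm_σ := by simp [splitShtuka]
  comm_j := Diag.comm_j_iff.2 ((congrArg (biprod.lift f (biprod.lift _ _) ≫ ·)
    (splitShtuka_jAdj hI hI')).trans (lift_lift_snd_snd _ _ _))

lemma exists_mono_acyclic (hS : Admissible S.left) (F : (XA S).Modules)
    (hF : qcoh _ F) : ∃ (I : (XA S).Modules) (f : F ⟶ I), qcoh _ I ∧ Mono f ∧
      ∀ (p : ℕ) (x : Coh ⊤ (onS I) (p + 1)), x = 0 := by
  obtain h | ⟨h, h'⟩ := hS
  · exact exists_mono_acyclic_of_locallyNoetherian F hF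
  · exact exists_mono_acyclic_of_affineDiagonal F hF

/-- Passes from Ext out of the free sheaf on the whole space, where vanishing was proved, to
morphisms from the constant sheaf in the derived category. -/
lemma shiftedHom_eq_zero {A : Type u} [CommRing A] {X : TopCat.{u}} {F : Shv A X} {i : ℕ}
    (h : ∀ x : Coh ⊤ F i, x = 0)
    (x : ShiftedHom (dA A X) (DerivedCategory.Q.obj
      ((HomologicalComplex.single _ (ComplexShape.up ℤ) 0).obj F)) (i : ℤ)) : x = 0 := by
  have h' (y : Abelian.Ext.{u} (constA A X) F i) : y = 0 := by
    have e := h ((Abelian.Ext.mk₀ (constIso A X).inv).comp y (zero_add i))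
    have e' := congrArg (fun z => (Abelian.Ext.mk₀ (constIso A X).hom).comp z (zero_add i)) e
    simpa using e'
  obtain ⟨y, rfl⟩ := (Abelian.Ext.homEquiv (X := constA A X) (Y := F) (n := i)).surjective x
  rw [h' y]
  exact Abelian.Ext.zero_hom _ _ _

variable (S) in
/-- Hypercohomology of shtukas as a `δ`-functor. -/
def hypShtuka : DeltaFunctor (Polynomial k) (Shtuka S) :=
  hypDelta cplx cplx_shortExact (dA (Polynomial k) S.left)

/-- The split shtuka on acyclic `I` and `I'` has no hypercohomology in positive degree at all: its
differential is split, and the sheaves of `τ_* I'` and `I'` on `S` agree since the opens `pr⁻¹ U`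
are stable under `τ`. -/
lemma hypShtuka_effaceable (hS : Admissible S.left) : (hypShtuka S).Effaceable := by
  intro i M x
  obtain ⟨I, f, hI, hf, hIa⟩ := exists_mono_acyclic hS M.M M.qcoh_M
  obtain ⟨I', f', hI', hf', hIa'⟩ := exists_mono_acyclic hS M.M' M.qcoh_M'
  refine ⟨splitShtuka I I' hI hI', toSplit hI hI' f f', ?_, ?_⟩
  · have h1 : Mono (toSplit hI hI' f f').f := by
      let p : (splitShtuka I I' hI hI').M ⟶ I :=
        (biprod.fst : I ⊞ (I' ⊞ (Scheme.Modules.pushforward (frobA S)).obj I') ⟶ I)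
      have h : (toSplit hI hI' f f').f ≫ p = f := biprod.lift_fst _ _
      have : Mono ((toSplit hI hI' f f').f ≫ p) := by
        rw [h]
        exact hf
      exact mono_of_mono _ p
    have h2 : Mono (toSplit hI hI' f f').f' := hf'
    exact Diag.mono_of _
  · refine eq_zero_of_split (del (splitShtuka I I' hI hI')) _ (splitShtuka_del hI hI')
      (shiftedHom_eq_zero (coh_biprod_eq_zero (hIa i) (coh_biprod_eq_zero (hIa' i) fun x => ?_))) _
    exact eq_zero_of_cmap_iso (asIso (frobHom I')) x (hIa' i _)

end Effacement

/-! ### Morphisms out of the structure sheaf -/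

section UnitHom
variable {X : Scheme.{u}}

lemma unitHom_app {M : X.Modules} (f : unitMod X ⟶ M) (V : X.Opens) (r : Γ(X, V)) :
    f.app V r = r • mres M le_top (f.app ⊤ (oneOn ⊤)) := by
  rw [← app_mres, mres_oneOn, ← Scheme.Modules.Hom.app_smul]
  exact congrArg (f.app V).hom (mul_one r).symm

lemma unitHom_ext {M : X.Modules} {f g : unitMod X ⟶ M}
    (h : f.app ⊤ (oneOn ⊤) = g.app ⊤ (oneOn ⊤)) : f = g := by
  ext V r
  exact (unitHom_app f V r).trans ((congrArg (fun s => (show Γ(X, V) from r) • mres M (le_top : V ≤ ⊤) s) h).trans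
    (unitHom_app g V r).symm)

/-- The morphism from the structure sheaf given by a global section. -/
def unitHom (M : X.Modules) (s : Γ(M, ⊤)) : unitMod X ⟶ M :=
  ⟨{ app V := ModuleCat.ofHom (X := (unitMod X).val.obj V) (Y := M.val.obj V)
      { toFun := fun r : Γ(X, V.unop) => r • mres M (le_top : V.unop ≤ ⊤) s
        map_add' := fun (x y : Γ(X, V.unop)) => add_smul x y (mres M (le_top : V.unop ≤ ⊤) s)
        map_smul' := fun (r x : Γ(X, V.unop)) =>
          mul_smul r x (mres M (le_top : V.unop ≤ ⊤) s) }
     naturality := fun {V W} i => by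
      refine ModuleCat.hom_ext (LinearMap.ext fun (r : Γ(X, V.unop)) => ?_)
      have h := mres_smul M (leOfHom i.unop) (r : Γ(X, V.unop)) (mres M le_top s)
      rw [mres_mres] at h
      exact h.symm }⟩

lemma unitHom_app_one (M : X.Modules) (s : Γ(M, ⊤)) : (unitHom M s).app ⊤ (oneOn ⊤) = s :=
  (one_smul Γ(X, ⊤) (mres M le_rfl s)).trans (mres_self M _ s)

end UnitHom

/-! ### The comparison in degree zero -/

section DegreeZero
variable {k : Type u} [Field k] [Fintype k] {S : Over (Spec (CommRingCat.of k))}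
open DerivedCategory HomologicalComplex

lemma unitShtuka_hom_ext {M : Shtuka S} {f g : unitShtuka S ⟶ M}
    (h : f.f.app ⊤ (oneOn ⊤) = g.f.app ⊤ (oneOn ⊤)) : f = g := by
  have h1 : f.f = g.f := unitHom_ext h
  refine Diag.hom_ext h1 ?_
  have e (f : unitShtuka S ⟶ M) : f.f' = f.f ≫ M.σ := (Category.id_comp _).symm.trans f.comm_σ.symm
  rw [e, e, h1]

/-- Compatibility with `σ` forces the second component to be the first followed by `σ`.
Compatibility with `j` is then an equality of two maps out of `𝒪`, tested on `1`, where it reads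
`σ(s) = j(τ s)`. -/
lemma exists_unitShtuka_hom (M : Shtuka S) (s : Sec (onS M.M) ⊤) (hs : sapp (del M) ⊤ s = 0) :
    ∃ f : unitShtuka S ⟶ M, f.f.app ⊤ (oneOn ⊤) = s := by
  have hj : (unitHom M.M s).app ⊤ (oneOn ⊤) = s := unitHom_app_one M.M s
  refine ⟨⟨unitHom M.M s, unitHom M.M s ≫ M.σ, (Category.id_comp _).symm,
    Diag.comm_j_iff.2 (unitHom_ext ?_)⟩, hj⟩
  rw [unitDiag_jAdj]
  have h1 : M.σ.app ⊤ s = sapp (tau M.M ≫ onSMap M.j) ⊤ s := sub_eq_zero.1 hs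
  have h2 : sapp (tau M.M ≫ onSMap M.j) ⊤ s = M.jAdj.app ⊤ s := by
    refine (congr(($(tau_j M ⊤)).hom s)).trans ?_
    exact mres_self M.M' le_rfl (M.jAdj.app ⊤ s)
  have h3 : (unitToPushforward (frobA S)).app ⊤ (oneOn ⊤) = oneOn (X := XA S) ⊤ :=
    map_one ((frobA S).app ⊤).hom
  refine (congrArg (M.jAdj.app ⊤).hom hj).trans ((h1.trans h2).symm.trans ?_)
  refine (congrArg (M.σ.app ⊤).hom hj).symm.trans ?_
  exact (congrArg ((unitHom M.M s ≫ M.σ).app ⊤).hom h3).symm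

/-- The section of a complex in degrees `0` and `1` given by a global cocycle. -/
def cocycle {A : Type u} [CommRing A] {X : TopCat.{u}} {F G : Shv A X} (d : F ⟶ G) (s : Sec F ⊤)
    (h : constHom s ≫ d = 0) : Hyp (two d) 0 :=
  ShiftedHom.mk₀ _ rfl (Q.map (singleToTwo (constHom s) h))

lemma cocycle_injective {A : Type u} [CommRing A] {X : TopCat.{u}} {F G : Shv A X} (d : F ⟶ G)
    (s t : Sec F ⊤) (h : constHom s ≫ d = 0) (h' : constHom t ≫ d = 0)
    (e : cocycle d s h = cocycle d t h') : s = t :=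
  constHom_injective (mk₀_singleToTwo_injective d _ _ h h' e)

lemma cocycle_surjective {A : Type u} [CommRing A] {X : TopCat.{u}} {F G : Shv A X} (d : F ⟶ G)
    (x : Hyp (two d) 0) : ∃ (s : Sec F ⊤) (h : constHom s ≫ d = 0), cocycle d s h = x := by
  obtain ⟨a, h, hx⟩ := exists_singleToTwo d x
  obtain ⟨s, rfl⟩ := constHom_surjective a
  exact ⟨s, h, hx⟩

lemma hypMap_mk₀ {A : Type u} [CommRing A] {X : TopCat.{u}} {K L : CochainComplex (Shv A X) ℤ}
    (φ : K ⟶ L) (x : (single _ (ComplexShape.up ℤ) 0).obj (constA A X) ⟶ K) :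
    Hyp.map φ (ShiftedHom.mk₀ ((0 : ℕ) : ℤ) rfl (Q.map x)) =
      ShiftedHom.mk₀ ((0 : ℕ) : ℤ) rfl (Q.map (x ≫ φ)) := by
  rw [Hyp.map, ← ShiftedHom.comp_mk₀ _ 0 rfl, ShiftedHom.mk₀_comp_mk₀, Functor.map_comp]

lemma constHom_del {M : Shtuka S} (f : unitShtuka S ⟶ M) :
    constHom (show Sec (onS M.M) ⊤ from f.f.app ⊤ (oneOn ⊤)) ≫ del M = 0 := by
  have h : sapp (del M) ⊤ (sapp (onSMap f.f) ⊤ (oneSec S)) = 0 := by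
    have h1 := congr(sapp $(del_naturality f) ⊤ (oneSec S))
    refine h1.trans ?_
    exact (congrArg (sapp (onSMap f.f') ⊤) (del_oneSec S)).trans (map_zero _)
  rw [constHom_comp]
  exact (congrArg constHom h).trans (constHom_zero _)

lemma hypMap_oneClass {M : Shtuka S} (f : unitShtuka S ⟶ M) :
    Hyp.map (cplx.map f) (oneClass S) = cocycle (del M) (f.f.app ⊤ (oneOn ⊤)) (constHom_del f) := by
  refine (hypMap_mk₀ _ _).trans (congrArg (fun y => ShiftedHom.mk₀ ((0 : ℕ) : ℤ) rfl (Q.map y)) ?_)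
  exact singleToTwo_twoMap _ _ _ _ (del_naturality f) _ _ (constHom_comp _ _)

/-- Both sides are the global sections `s` with `∂ s = 0`: morphisms from the unit by evaluation at
`1`, and classes of degree `0` because the complex starts in degree `0`. -/
lemma hypMap_oneClass_bijective (M : Shtuka S) :
    Function.Bijective fun f : unitShtuka S ⟶ M => Hyp.map (cplx.map f) (oneClass S) := by
  refine ⟨fun f g h => unitShtuka_hom_ext ?_, fun x => ?_⟩
  · exact cocycle_injective (del M) _ _ (constHom_del f) (constHom_del g)
      ((hypMap_oneClass f).symm.trans (h.trans (hypMap_oneClass g)))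
  · obtain ⟨s, h, rfl⟩ := cocycle_surjective (del M) x
    have hs : sapp (del M) ⊤ s = 0 := by
      apply constHom_injective
      rw [constHom_zero, ← h, constHom_comp]
      rfl
    obtain ⟨f, rfl⟩ := exists_unitShtuka_hom M s hs
    exact ⟨f, hypMap_oneClass f⟩

lemma onSMap_smul {F G : (XA S).Modules} (a : Polynomial k) (f : F ⟶ G) :
    onSMap (smulEnd (prA S) a F ≫ f) = a • onSMap f :=
  shv_hom_ext fun U (s : Γ(F, prS S ⁻¹ᵁ U)) =>
    f.app_smul (aScalars (prA S) (prS S ⁻¹ᵁ U) a) s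

lemma cplx_map_add {M N : Shtuka S} (f g : M ⟶ N) :
    cplx.map (f + g) = cplx.map f + cplx.map g :=
  twoMap_add _ _ _ _ (del_naturality f) (del_naturality g) (del_naturality (f + g))

lemma cplx_map_smul {M N : Shtuka S} (a : Polynomial k) (f : M ⟶ N) :
    cplx.map (a • f) = a • cplx.map f := by
  apply from_double_hom_ext
  · refine (twoMap_f₀ _ _ (del_naturality (a • f))).trans (Eq.trans ?_
      (congrArg (a • ·) (twoMap_f₀ _ _ (del_naturality f))).symm)
    rw [← Linear.comp_smul, ← Linear.smul_comp]
    exact congrArg (fun y => _ ≫ y ≫ _) (onSMap_smul a f.f)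
  · refine (twoMap_f₁ _ _ (del_naturality (a • f))).trans (Eq.trans ?_
      (congrArg (a • ·) (twoMap_f₁ _ _ (del_naturality f))).symm)
    rw [← Linear.comp_smul, ← Linear.smul_comp]
    exact congrArg (fun y => _ ≫ y ≫ _) (onSMap_smul a f.f')

lemma hypMap_comp {A : Type u} [CommRing A] {X : TopCat.{u}} {K L N : CochainComplex (Shv A X) ℤ}
    (φ : K ⟶ L) (ψ : L ⟶ N) {i : ℕ} (x : Hyp K i) :
    Hyp.map (φ ≫ ψ) x = Hyp.map ψ (Hyp.map φ x) := by
  rw [Hyp.map, Hyp.map, Hyp.map, Functor.map_comp, Functor.map_comp, Category.assoc]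

lemma hypMap_add {A : Type u} [CommRing A] {X : TopCat.{u}} {K L : CochainComplex (Shv A X) ℤ}
    (φ ψ : K ⟶ L) {i : ℕ} (x : Hyp K i) :
    Hyp.map (φ + ψ) x = Hyp.map φ x + Hyp.map ψ x := by
  rw [Hyp.map, Functor.map_add, Functor.map_add, Preadditive.comp_add]
  rfl

lemma hypMap_smul {A : Type u} [CommRing A] {X : TopCat.{u}} {K L : CochainComplex (Shv A X) ℤ}
    (a : A) (φ : K ⟶ L) {i : ℕ} (x : Hyp K i) :
    Hyp.map (a • φ) x = a • Hyp.map φ x := by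
  rw [Hyp.map, Functor.map_smul, Functor.map_smul, Linear.comp_smul]
  rfl

/-- The map which sends `f : 𝟙 ⟶ M` to the class of `f(1)`. -/
def homToHyp (M : Shtuka S) : (unitShtuka S ⟶ M) →ₗ[Polynomial k] Hyp (cplx.obj M) 0 where
  toFun f := Hyp.map (cplx.map f) (oneClass S)
  map_add' f g := (congrArg (Hyp.map · (oneClass S)) (cplx_map_add f g)).trans (hypMap_add _ _ _)
  map_smul' a f :=
    (congrArg (Hyp.map · (oneClass S)) (cplx_map_smul a f)).trans (hypMap_smul _ _ _)

variable (S) in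
/-- The comparison map in degree `0`. -/
def extToHypZero : (extDelta (A := Polynomial k) (unitShtuka S)).H 0 ⟶ (hypShtuka S).H 0 where
  app M := ModuleCat.ofHom (X := Abelian.Ext (unitShtuka S) M 0) (Y := Hyp (cplx.obj M) 0)
    (homToHyp M ∘ₗ (Abelian.Ext.linearEquiv₀ (R := Polynomial k)).toLinearMap)
  naturality M N f := by
    ext x
    obtain ⟨g, rfl⟩ := (Abelian.Ext.mk₀_bijective _ _).2 x
    have e {M : Shtuka S} (g : unitShtuka S ⟶ M) :
        Abelian.Ext.linearEquiv₀ (R := Polynomial k) (Abelian.Ext.mk₀ g) = g :=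
      Abelian.Ext.homEquiv₀.apply_symm_apply g
    change Hyp.map (cplx.map (Abelian.Ext.linearEquiv₀ (R := Polynomial k)
      ((Abelian.Ext.mk₀ g).comp (Abelian.Ext.mk₀ f) (add_zero 0)))) (oneClass S) =
      Hyp.map (cplx.map f) (Hyp.map (cplx.map (Abelian.Ext.linearEquiv₀ (R := Polynomial k)
        (Abelian.Ext.mk₀ g))) (oneClass S))
    rw [Abelian.Ext.mk₀_comp_mk₀, e, e, Functor.map_comp, hypMap_comp]

lemma extToHypZero_mk₀ {M : Shtuka S} (f : unitShtuka S ⟶ M) :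
    (extToHypZero S).app M (Abelian.Ext.mk₀ f : Abelian.Ext (unitShtuka S) M 0) =
      Hyp.map (cplx.map f) (oneClass S) :=
  congrArg (fun y => Hyp.map (cplx.map y) (oneClass S))
    (Abelian.Ext.homEquiv₀.apply_symm_apply f)

lemma extToHypZero_bijective (M : Shtuka S) :
    Function.Bijective ((extToHypZero S).app M) :=
  (hypMap_oneClass_bijective M).comp
    (Abelian.Ext.linearEquiv₀ (R := Polynomial k) (X := unitShtuka S) (Y := M)).bijective

end DegreeZero

/-! ### Naturality of maps between complexes over an additive functor -/

section TwoMapTo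
universe v w v' w'
open HomologicalComplex
variable {C : Type w} [Category.{v} C] [Preadditive C] [HasZeroObject C]
variable {D : Type w'} [Category.{v'} D] [Preadditive D] [HasZeroObject D]
variable (G : C ⥤ D) [G.Additive]

lemma twoMapTo_f₀ {X₀ X₁ : D} {Y₀ Y₁ : C} {f : X₀ ⟶ X₁} {g : Y₀ ⟶ Y₁}
    (a : X₀ ⟶ G.obj Y₀) (b : X₁ ⟶ G.obj Y₁) (h : a ≫ G.map g = f ≫ b) :
    (twoMapTo G a b h).f 0 = (doubleXIso₀ f rel01).hom ≫ a ≫ G.map (doubleXIso₀ g rel01).inv :=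
  mkHomFromDouble_f₀ _ _ _ _ _ _

lemma twoMapTo_f₁ {X₀ X₁ : D} {Y₀ Y₁ : C} {f : X₀ ⟶ X₁} {g : Y₀ ⟶ Y₁}
    (a : X₀ ⟶ G.obj Y₀) (b : X₁ ⟶ G.obj Y₁) (h : a ≫ G.map g = f ≫ b) :
    (twoMapTo G a b h).f 1 = (doubleXIso₁ f rel01 zero_ne_one).hom ≫ b ≫
      G.map (doubleXIso₁ g rel01 zero_ne_one).inv :=
  mkHomFromDouble_f₁ _ _ _ _ _ _

lemma conj_comp_eq {X₁ X₂ X₃ X₄ : D} {Y₁ Y₂ Y₃ Y₄ : C} (p : X₁ ⟶ X₂) (a : X₂ ⟶ X₃) (i : X₃ ≅ X₄)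
    (c : X₃ ⟶ G.obj Y₁) (q : Y₁ ⟶ Y₂) (c' : X₂ ⟶ G.obj Y₃) (j : Y₃ ≅ Y₄) (b : Y₃ ⟶ Y₁)
    (h : a ≫ c = c' ≫ G.map b) :
    (p ≫ a ≫ i.hom) ≫ i.inv ≫ c ≫ G.map q = (p ≫ c' ≫ G.map j.hom) ≫ G.map (j.inv ≫ b ≫ q) := by
  simp only [Category.assoc, Functor.map_comp, Iso.hom_inv_id_assoc]
  rw [reassoc_of% h, ← G.map_comp_assoc j.hom, Iso.hom_inv_id, CategoryTheory.Functor.map_id,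
    Category.id_comp]

lemma twoMap_twoMapTo {X₀ X₁ X₀' X₁' : D} {Y₀ Y₁ Y₀' Y₁' : C} {f : X₀ ⟶ X₁} {f' : X₀' ⟶ X₁'}
    {g : Y₀ ⟶ Y₁} {g' : Y₀' ⟶ Y₁'} (a : X₀ ⟶ X₀') (a' : X₁ ⟶ X₁') (ha : a ≫ f' = f ≫ a')
    (b : Y₀ ⟶ Y₀') (b' : Y₁ ⟶ Y₁') (hb : b ≫ g' = g ≫ b')
    (c : X₀ ⟶ G.obj Y₀) (c' : X₁ ⟶ G.obj Y₁) (hc : c ≫ G.map g = f ≫ c')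
    (d : X₀' ⟶ G.obj Y₀') (d' : X₁' ⟶ G.obj Y₁') (hd : d ≫ G.map g' = f' ≫ d')
    (h₀ : a ≫ d = c ≫ G.map b) (h₁ : a' ≫ d' = c' ≫ G.map b') :
    twoMap a a' ha ≫ twoMapTo G d d' hd =
      twoMapTo G c c' hc ≫ (G.mapHomologicalComplex (ComplexShape.up ℤ)).map (twoMap b b' hb) := by
  apply from_double_hom_ext
  · refine (congrArg₂ (· ≫ ·) (twoMap_f₀ a a' ha) (twoMapTo_f₀ G d d' hd)).trans
      (Eq.trans ?_ (congrArg₂ (· ≫ ·) (twoMapTo_f₀ G c c' hc)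
        (congrArg G.map (twoMap_f₀ b b' hb))).symm)
    exact conj_comp_eq G _ a (doubleXIso₀ f' rel01).symm d _ c (doubleXIso₀ g rel01).symm b h₀
  · refine (congrArg₂ (· ≫ ·) (twoMap_f₁ a a' ha) (twoMapTo_f₁ G d d' hd)).trans
      (Eq.trans ?_ (congrArg₂ (· ≫ ·) (twoMapTo_f₁ G c c' hc)
        (congrArg G.map (twoMap_f₁ b b' hb))).symm)
    exact conj_comp_eq G _ a' (doubleXIso₁ f' rel01 zero_ne_one).symm d' _ c'
      (doubleXIso₁ g rel01 zero_ne_one).symm b' h₁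

end TwoMapTo

/-! ### Pullback of shtuka complexes and of the class of `1` -/

section PullbackUnit
variable {k : Type u} [Field k] [Fintype k] {S T : Over (Spec (CommRingCat.of k))} {g : S ⟶ T}
open DerivedCategory HomologicalComplex

lemma cplxOver_naturality {M₁ M₂ : Shtuka T} {N₁ N₂ : Shtuka S} (φ₁ : HomOver g M₁ N₁)
    (φ₂ : HomOver g M₂ N₂) (a : M₁ ⟶ M₂) (b : N₁ ⟶ N₂) (h : φ₁.Compat φ₂ a b) :
    cplx.map a ≫ cplxOver φ₂ = cplxOver φ₁ ≫ ((TopCat.Sheaf.pushforward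
      (ModuleCat.{u} (Polynomial k)) g.left.base).mapHomologicalComplex
        (ComplexShape.up ℤ)).map (cplx.map b) :=
  twoMap_twoMapTo _ _ _ (del_naturality a) _ _ (del_naturality b) _ _ (onSOver_del φ₁) _ _
    (onSOver_del φ₂) (onSOver_comp h.1.symm).symm (onSOver_comp h.2.symm).symm

lemma unit_map_map_counit {C D : Type*} [Category C] [Category D] {F : C ⥤ D} {G : D ⥤ C}
    (adj : F ⊣ G) {X : C} {Y : D} (u : X ⟶ G.obj Y) :
    adj.unit.app X ≫ G.map (F.map u ≫ adj.counit.app Y) = u := by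
  simp

lemma conj_adj_eq {C D : Type*} [Category C] [Category D] {F : C ⥤ D} {G : D ⥤ C} (adj : F ⊣ G)
    {W₀ W W₁ Z Z' : D} {V V' U U' : C} (i₀ : W₀ ⟶ W) (c : W ⟶ F.obj V) (i₁ : W₁ ≅ F.obj V)
    (j : V' ≅ V) (a : V ⟶ U) (e : U' ≅ U) (o : U ⟶ G.obj Z) (e' : Z ⟶ Z') (t : W ⟶ Z)
    (h : c ≫ F.map (a ≫ o) ≫ adj.counit.app Z = t) :
    ((i₀ ≫ c ≫ i₁.inv) ≫ i₁.hom ≫ F.map j.inv) ≫ F.map (j.hom ≫ a ≫ e.inv) ≫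
      F.map (e.hom ≫ o ≫ G.map e') ≫ adj.counit.app Z' = i₀ ≫ t ≫ e' := by
  rw [← h]
  simp only [Category.assoc, Functor.map_comp, Iso.inv_hom_id_assoc]
  rw [← F.map_comp_assoc j.inv, Iso.inv_hom_id, ← F.map_comp_assoc e.inv, Iso.inv_hom_id]
  simp

/-- A map out of the constant sheaf is determined by the image of `1`; a triangle identity of the
adjunction identifies this image with that of `1` under the adjoint `u`. -/
lemma constToPullback_comp {A : Type u} [CommRing A] {X Y : TopCat.{u}} (g : X ⟶ Y) {F : Shv A X}
    (u : constA A Y ⟶ (TopCat.Sheaf.pushforward (ModuleCat.{u} A) g).obj F) (s : Sec F ⊤)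
    (h : sapp u ⊤ (constOne A Y) = s) :
    constToPullback A X g ≫ (TopCat.Sheaf.pullback (ModuleCat.{u} A) g).map u ≫
      (TopCat.Sheaf.pullbackPushforwardAdjunction (ModuleCat.{u} A) g).counit.app F =
        constHom s := by
  let adj := TopCat.Sheaf.pullbackPushforwardAdjunction (ModuleCat.{u} A) g
  refine (constHom_comp _ _).trans (congrArg constHom ?_)
  rw [← h]
  have h1 : adj.unit.app (constA A Y) ≫ (TopCat.Sheaf.pushforward (ModuleCat.{u} A) g).map
      ((TopCat.Sheaf.pullback (ModuleCat.{u} A) g).map u ≫ adj.counit.app F) = u := by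
    exact unit_map_map_counit adj u
  exact congr(sapp $h1 ⊤ (constOne A Y))

variable (g) in
lemma constHom_oneSec_onSOver :
    sapp (constHom (oneSec T) ≫ onSOver (unitOver g).f) ⊤ (constOne (Polynomial k) T.left) =
      oneSec S := by
  refine (sapp_comp _ _ _ _).trans ?_
  refine (congrArg (sapp (onSOver (unitOver g).f) ⊤) (constHom_sapp (oneSec T))).trans ?_
  exact (congrArg ((XA S).presheaf.map (homOfLE (mapA_preimage g ⊤).ge).op).hom
    (map_one ((mapA g).app (prS T ⁻¹ᵁ ⊤)).hom)).trans (map_one _)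

variable (g) in
lemma single_adjCplx_unitOver :
    ((single _ (ComplexShape.up ℤ) 0).map (constToPullback (Polynomial k) S.left g.left.base) ≫
      (singleMapHomologicalComplex (TopCat.Sheaf.pullback (ModuleCat.{u} (Polynomial k))
        g.left.base) (ComplexShape.up ℤ) 0).inv.app _) ≫
      ((TopCat.Sheaf.pullback (ModuleCat.{u} (Polynomial k)) g.left.base).mapHomologicalComplex
        (ComplexShape.up ℤ)).map (singleToTwo (f := del (unitShtuka T)) (constHom (oneSec T))
          (by rw [constHom_comp, del_oneSec, constHom_zero])) ≫ adjCplx (cplxOver (unitOver g)) =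
    singleToTwo (f := del (unitShtuka S)) (constHom (oneSec S))
      (by rw [constHom_comp, del_oneSec, constHom_zero]) := by
  apply from_single_hom_ext
  let F := TopCat.Sheaf.pullback (ModuleCat.{u} (Polynomial k)) g.left.base
  refine (congrArg₂ (· ≫ ·) (congrArg₂ (· ≫ ·) (single_map_f_self _ 0 _)
    (singleMapHomologicalComplex_inv_app_self F (ComplexShape.up ℤ) 0 _))
    (congrArg₂ (· ≫ ·) (congrArg F.map (mkHomFromSingle_f _ _))
      (congrArg (F.map · ≫ _) (twoMapTo_f₀ _ _ _ (onSOver_del (unitOver g)))))).trans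
    (Eq.trans ?_ (mkHomFromSingle_f _ _).symm)
  exact conj_adj_eq (TopCat.Sheaf.pullbackPushforwardAdjunction (ModuleCat.{u} (Polynomial k))
    g.left.base) _ _ (singleObjXSelf _ 0 _) (singleObjXSelf _ 0 _) _ (doubleXIso₀ _ rel01)
    (onSOver (unitOver g).f) _ _ (constToPullback_comp _ _ _ (constHom_oneSec_onSOver g))

lemma comp_mk₀_shMap {D : Type*} [Category D] [Abelian D] [HasDerivedCategory D]
    {d d' X Y : DerivedCategory D} (a : d ⟶ d') (b : d' ⟶ X) (c : X ⟶ Y) :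
    a ≫ shMap (ShiftedHom.mk₀ ((0 : ℕ) : ℤ) rfl b) c =
      ShiftedHom.mk₀ ((0 : ℕ) : ℤ) rfl (a ≫ b ≫ c) := by
  rw [shMap, ← ShiftedHom.comp_mk₀ _ 0 rfl, ShiftedHom.mk₀_comp_mk₀]
  simp only [ShiftedHom.mk₀, Category.assoc]

/-- For a class represented by a map of complexes the pullback can be computed before passing to the
derived category, the comparison isomorphisms cancelling. -/
lemma hypPullback_mk₀ {A : Type u} [CommRing A] {X Y : TopCat.{u}} (g : X ⟶ Y)
    {K : CochainComplex (Shv A X) ℤ} {L : CochainComplex (Shv A Y) ℤ}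
    (φ : L ⟶ ((TopCat.Sheaf.pushforward (ModuleCat.{u} A) g).mapHomologicalComplex
        (ComplexShape.up ℤ)).obj K)
    (s : (single _ (ComplexShape.up ℤ) 0).obj (constA A Y) ⟶ L)
    (t : (single _ (ComplexShape.up ℤ) 0).obj (constA A X) ⟶ K)
    (h : ((single _ (ComplexShape.up ℤ) 0).map (constToPullback A X g) ≫
      (singleMapHomologicalComplex (TopCat.Sheaf.pullback (ModuleCat.{u} A) g)
        (ComplexShape.up ℤ) 0).inv.app _) ≫
      ((TopCat.Sheaf.pullback (ModuleCat.{u} A) g).mapHomologicalComplex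
        (ComplexShape.up ℤ)).map s ≫ adjCplx φ = t) :
    hypPullback g φ (ShiftedHom.mk₀ ((0 : ℕ) : ℤ) rfl (Q.map s)) =
      ShiftedHom.mk₀ ((0 : ℕ) : ℤ) rfl (Q.map t) := by
  rw [hypPullback_eq, ShiftedHom.map_mk₀]
  refine (comp_mk₀_shMap _ _ _).trans (congrArg (ShiftedHom.mk₀ ((0 : ℕ) : ℤ) rfl) ?_)
  rw [← h, hypTgt, Functor.mapDerivedCategoryFactors_hom_naturality_assoc, hypSrc,
    Functor.map_comp Q (_ ≫ _), Category.assoc]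
  exact congrArg (_ ≫ ·) ((Iso.inv_hom_id_app_assoc _ _ _).trans (Functor.map_comp Q _ _).symm)

variable (g) in
lemma hypPullback_oneClass :
    hypPullback g.left.base (cplxOver (unitOver g)) (oneClass T) = oneClass S :=
  hypPullback_mk₀ _ _ _ _ (single_adjCplx_unitOver g)

end PullbackUnit

/-! ### The comparison isomorphism and the pullback of extensions -/

section Comparison
variable {k : Type u} [Field k] [Fintype k] (S : Over (Spec (CommRingCat.of k)))

lemma exists_extToHyp : ∃ ψ : ∀ i, (extDelta (A := Polynomial k) (unitShtuka S)).H i ⟶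
    (hypShtuka S).H i, ψ 0 = extToHypZero S ∧ ∀ (i : ℕ) {E : ShortComplex (Shtuka S)}
      (hE : E.ShortExact), (extDelta (A := Polynomial k) (unitShtuka S)).δ hE i ≫
        (ψ (i + 1)).app _ = (ψ i).app _ ≫ (hypShtuka S).δ hE i :=
  DeltaFunctor.exists_extension (extDelta_effaceable _) (extToHypZero S)

/-- The comparison map from extensions to hypercohomology. -/
def extToHyp (i : ℕ) : (extDelta (A := Polynomial k) (unitShtuka S)).H i ⟶ (hypShtuka S).H i :=
  (exists_extToHyp S).choose i

variable {S}

/-- The comparison map is an isomorphism. -/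
def extEquivHyp (hS : Admissible S.left) (M : Shtuka S) (i : ℕ) :
    Abelian.Ext (unitShtuka S) M i ≃ₗ[Polynomial k] Hyp (cplx.obj M) i :=
  LinearEquiv.ofBijective ((extToHyp S i).app M).hom
    (DeltaFunctor.bijective_of_effaceable (extDelta_effaceable _) (hypShtuka_effaceable hS)
      (extToHyp S) (exists_extToHyp S).choose_spec.2 (fun M => by
        rw [extToHyp, (exists_extToHyp S).choose_spec.1]
        exact extToHypZero_bijective M) i M)

variable (hS : Admissible S.left)

lemma extEquivHyp_natural {M N : Shtuka S} (a : M ⟶ N) (i : ℕ)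
    (x : Abelian.Ext (unitShtuka S) M i) :
    extEquivHyp hS N i (x.comp (Abelian.Ext.mk₀ a) (add_zero i)) =
      Hyp.map (cplx.map a) (extEquivHyp hS M i x) :=
  congr(($((extToHyp S i).naturality a)).hom x)

lemma extEquivHyp_unit :
    extEquivHyp hS (unitShtuka S) 0 (Abelian.Ext.mk₀ (𝟙 (unitShtuka S))) = oneClass S := by
  have h := congr(($((exists_extToHyp S).choose_spec.1).app (unitShtuka S)).hom
    (Abelian.Ext.mk₀ (𝟙 (unitShtuka S)) : Abelian.Ext (unitShtuka S) (unitShtuka S) 0))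
  refine h.trans ((extToHypZero_mk₀ (𝟙 (unitShtuka S))).trans ?_)
  rw [CategoryTheory.Functor.map_id, Hyp.map, CategoryTheory.Functor.map_id,
    CategoryTheory.Functor.map_id, Category.comp_id]

lemma extEquivHyp_connecting (P : ShortComplex (Shtuka S)) (hP : P.ShortExact) (i : ℕ)
    (x : Abelian.Ext (unitShtuka S) P.X₃ i) :
    extEquivHyp hS P.X₁ (i + 1) (x.comp hP.extClass rfl) =
      Hyp.connecting (cplx_shortExact P hP) (extEquivHyp hS P.X₃ i x) :=
  congr(($((exists_extToHyp S).choose_spec.2 i hP)).hom x)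

variable {T : Over (Spec (CommRingCat.of k))} (hT : Admissible T.left) {g : S ⟶ T}

/-- The pullback of extensions. -/
def extPullback {M : Shtuka T} {N : Shtuka S} (φ : HomOver g M N) (i : ℕ) :
    Abelian.Ext (unitShtuka T) M i →ₗ[Polynomial k] Abelian.Ext (unitShtuka S) N i :=
  (extEquivHyp hS N i).symm.toLinearMap ∘ₗ hypPullbackₗ (cplxOver φ) i ∘ₗ
    (extEquivHyp hT M i).toLinearMap

lemma extEquivHyp_extPullback {M : Shtuka T} {N : Shtuka S} (φ : HomOver g M N) (i : ℕ)
    (x : Abelian.Ext (unitShtuka T) M i) :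
    extEquivHyp hS N i (extPullback hS hT φ i x) =
      hypPullback g.left.base (cplxOver φ) (extEquivHyp hT M i x) :=
  (extEquivHyp hS N i).apply_symm_apply _

variable (g) in
-- As the pullback is transported from hypercohomology, each property may be tested after the
-- injective comparison map, where it becomes the corresponding property of pullback on
-- hypercohomology.
lemma isExtPullback_extPullback : IsExtPullback g (fun φ i => extPullback hS hT φ i) where
  unit := by
    apply (extEquivHyp hS _ 0).injective
    rw [extEquivHyp_extPullback, extEquivHyp_unit, extEquivHyp_unit, hypPullback_oneClass]
  natural φ₁ φ₂ a b h i x := by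
    apply (extEquivHyp hS _ i).injective
    rw [extEquivHyp_extPullback, extEquivHyp_natural, extEquivHyp_natural,
      extEquivHyp_extPullback]
    exact hypPullback_map _ _ _ _ (cplxOver_naturality φ₁ φ₂ a b h) _
  connecting {P Q} hP hQ φ₁ φ₂ φ₃ h₁ h₂ i x := by
    apply (extEquivHyp hS _ (i + 1)).injective
    rw [extEquivHyp_extPullback, extEquivHyp_connecting, extEquivHyp_connecting,
      extEquivHyp_extPullback]
    exact hypPullback_connecting (cplx_shortExact Q hQ) (cplx_shortExact P hP) _ (cplxOver φ₂) _
      (cplxOver_naturality φ₁ φ₂ _ _ h₁) (cplxOver_naturality φ₂ φ₃ _ _ h₂) _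

end Comparison

end Sht

end

theorem proposition3 (k : Type u) [Field k] [Fintype k] :
    ∃ Φ : ∀ (S : Over (Spec (CommRingCat.of k))) (_ : Sht.Admissible S.left) (M : Sht.Shtuka S)
        (i : ℕ),
        Abelian.Ext (Sht.unitShtuka S) M i ≃ₗ[Polynomial k] Sht.Hyp (Sht.cplx.obj M) i,
      (∀ (S : Over (Spec (CommRingCat.of k))) (hS : Sht.Admissible S.left) (M N : Sht.Shtuka S)
        (a : M ⟶ N) (i : ℕ) (x : Abelian.Ext (Sht.unitShtuka S) M i),
        Φ S hS N i (x.comp (Abelian.Ext.mk₀ a) (add_zero i)) =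
          Sht.Hyp.map (Sht.cplx.map a) (Φ S hS M i x)) ∧
      (∀ (S : Over (Spec (CommRingCat.of k))) (hS : Sht.Admissible S.left),
        Φ S hS (Sht.unitShtuka S) 0 (Abelian.Ext.mk₀ (𝟙 (Sht.unitShtuka S))) =
          Sht.oneClass S) ∧
      (∀ (S : Over (Spec (CommRingCat.of k))) (hS : Sht.Admissible S.left)
        (P : ShortComplex (Sht.Shtuka S)) (hP : P.ShortExact),
        ∃ h : (P.map Sht.cplx).ShortExact,
          ∀ (i : ℕ) (x : Abelian.Ext (Sht.unitShtuka S) P.X₃ i),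
            Φ S hS P.X₁ (i + 1) (x.comp hP.extClass rfl) =
              Sht.Hyp.connecting h (Φ S hS P.X₃ i x)) ∧
      (∀ (S T : Over (Spec (CommRingCat.of k))) (hS : Sht.Admissible S.left)
        (hT : Sht.Admissible T.left) (g : S ⟶ T),
        ∃ pb : ∀ {M : Sht.Shtuka T} {N : Sht.Shtuka S}, Sht.HomOver g M N → ∀ i : ℕ,
            Abelian.Ext (Sht.unitShtuka T) M i →ₗ[Polynomial k]
              Abelian.Ext (Sht.unitShtuka S) N i,
          Sht.IsExtPullback g pb ∧
          ∀ (M : Sht.Shtuka T) (N : Sht.Shtuka S) (φ : Sht.HomOver g M N) (i : ℕ)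
            (x : Abelian.Ext (Sht.unitShtuka T) M i),
            Φ S hS N i (pb φ i x) =
              Sht.hypPullback g.left.base (Sht.cplxOver φ) (Φ T hT M i x)) := by
  exact ⟨fun S hS M i => Sht.extEquivHyp hS M i,
    fun S hS M N a i x => Sht.extEquivHyp_natural hS a i x,
    fun S hS => Sht.extEquivHyp_unit hS,
    fun S hS P hP => ⟨Sht.cplx_shortExact P hP, Sht.extEquivHyp_connecting hS P hP⟩,
    fun S T hS hT g => ⟨fun φ i => Sht.extPullback hS hT φ i,
      Sht.isExtPullback_extPullback hS hT g,
      fun M N φ i x => Sht.extEquivHyp_extPullback hS hT φ i x⟩⟩
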